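/- On $\mathbb R^4$ with coordinates $(q_1,p_1,q_2,p_2)$ consider $F=(H,J)$, $H=q_1q_2-p_1p_2$, $J=\tfrac12(q_1^2+p_1^2)-\tfrac12(q_2^2+p_2^2)$, with Hamiltonian vector fields $\dot q_i=\partial f/\partial p_i$, $\dot p_i=-\partial f/\partial q_i$ and (complete) flows $\varphi_H^t$, $\varphi_J^t$; the flow $\varphi_J$ is $2\pi$-periodic and defines an $\mathbb S^1$-action. Let $\Gamma$ be a simple closed path in the set of regular values $v=(h,j)$ of $F$, bounding a closed disk $D$ that contains $0=F(0)$, and oriented so that it winds once, in the positive sense, around the origin of the $(j,h)$-plane. *Construction.* Let $\rho:F^{-1}(D)\to F^{-1}(D)/\mathbb S^1$ be the reduction map and $g:F^{-1}(D)/\mathbb S^1\to D\times\mathbb R$ a homeomorphism over $D$, oriented so that its $\mathbb R$-component is non-decreasing along the flow of $X_H$. For $m>0$ let $A_{\pm m}=\rho^{-1}(g^{-1}(D\times\{\pm m\}))$ and let $\sigma_{\pm m}:D\to A_{\pm m}$ be continuous sections of $F$. The space $T_m$ is obtained from $\rho^{-1}(g^{-1}(\Gamma\times[-m,m]))$ by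 identifying $\varphi_J^t(\sigma_{+m}(v))$ with $\varphi_J^t(\sigma_{-m}(v))$ for all $v\in\Gamma$ and $t\in\mathbb R$; $F$ induces a map $T_m\to\Gamma$. If $T_m\to\Gamma$ is a torus bundle, its monodromy is the automorphism of $H_1$ of a fibre induced by transport along $\Gamma$. It has monodromy number $k$ if its matrix is $\begin{pmatrix}1&k\\0&1\end{pmatrix}$ in the basis $(\gamma_J,\gamma)$, where $\gamma_J$ is the class of an $X_J$-orbit and $\gamma$ the class of a loop that follows $X_H$ from $\sigma_{-m}(v)$ to $A_{+m}$ and then $X_J$ to $\sigma_{+m}(v)\sim\sigma_{-m}(v)$ (the choice of the latter path changes $\gamma$ only by multiples of $\gamma_J$). The noncompact monodromy of $F^{-1}(\Gamma)\to\Gamma$ has number $k$ if there is $M>0$ such that for all $m>M$ sections $\sigma_{\pm m}$ exist and every $T_m$ is a torus bundle with monodromy number $k$. The variation along $\Gamma$ of a real function on $\Gamma$ with finitely many discontinuities, all of them jumps, is minus the sum of its jumps. **Proposition.** Such homeomorphisms $g$ exist, and for each of them: 1. The noncompact monodromy of $F$ along $\Gamma$ is well defined and has monodromy number $k=-1$.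 More precisely, whenever $m$ exceeds the absolute value of the $\mathbb R$-component of $g(\rho(0))$, sections $\sigma_{\pm m}$ exist, and for any such sections $T_m\to\Gamma$ is a torus bundle with monodromy number $-1$. 2. It equals the local monodromy: let $r>0$ be such that $|v|<r$ on $\Gamma$, put $B=\{q_1^2+q_2^2+p_1^2+p_2^2<2r\}$ and $\vartheta=\dfrac{p_1\,dq_1-q_1\,dp_1}{q_1^2+p_1^2}$, and let $\Phi_{\rm rel}(v)$ be the integral of $\vartheta$ along the part in $B$ of an $X_H$-orbit in $F^{-1}(v)$. If $\Gamma$ meets the image under $F$ of the polar set $\{q_1=p_1=0\}$ in finitely many points, then the variation of $\Phi_{\rm rel}$ along $\Gamma$ is $-2\pi k$ for $k=-1$ and for no other integer $k$. 3. It matches scattering monodromy: for $v\in\Gamma$ the projections to the $(q_1,p_1)$-plane of the $X_H$-orbits in $F^{-1}(v)$ have asymptotic directions for $t\to\pm\infty$, and the scattering angle $\Theta_s(v)$ (the time, determined modulo $2\pi$, in which $\varphi_J$ takes the incoming asymptotic direction to the outgoing one) has variation $-2\pi k$ along $\Gamma$ for $k=-1$ and for no other integer $k$, for any choice of representatives in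 $\mathbb R$ with finitely many discontinuities, all of them jumps; such a choice exists. -/

import Mathlib

open Set Filter Topology unitInterval

noncomputable section

namespace FocusFocus

/-! ### The integrable system on `ℝ⁴` -/

/-- Phase space `ℝ⁴`, a point `(q₁, p₁, q₂, p₂)` being written `(q₁ + i p₁, q₂ + i p₂)`. -/
abbrev Phase : Type := ℂ × ℂ

/-- `H = q₁ q₂ - p₁ p₂`. -/
def H (x : Phase) : ℝ := x.1.re * x.2.re - x.1.im * x.2.im

/-- `J = (q₁² + p₁²)/2 - (q₂² + p₂²)/2`. -/
def J (x : Phase) : ℝ := (x.1.re ^ 2 + x.1.im ^ 2) / 2 - (x.2.re ^ 2 + x.2.im ^ 2) / 2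

/-- The integral map `F = (H, J)`; its values are written `v = (h, j)`. -/
def F (x : Phase) : ℝ × ℝ := (H x, J x)

/-- The Hamiltonian vector field of `f`: `q̇ᵢ = ∂f/∂pᵢ`, `ṗᵢ = -∂f/∂qᵢ`. -/
def hamVec (f : Phase → ℝ) (x : Phase) : Phase :=
  (⟨fderiv ℝ f x (Complex.I, 0), -fderiv ℝ f x (1, 0)⟩,
   ⟨fderiv ℝ f x (0, Complex.I), -fderiv ℝ f x (0, 1)⟩)

/-- The flow of `X_J`, see `hasDerivAt_flowJ`. -/
def flowJ (u : ℝ) (x : Phase) : Phase :=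
  (Complex.exp (-(u * Complex.I)) * x.1, Complex.exp (u * Complex.I) * x.2)

/-- The (complete) flow of `X_H`, see `hasDerivAt_flowH`. -/
def flowH (t : ℝ) (x : Phase) : Phase :=
  (Real.cosh t * x.1 - Complex.I * Real.sinh t * (starRingEnd ℂ) x.2,
   Real.cosh t * x.2 - Complex.I * Real.sinh t * (starRingEnd ℂ) x.1)

theorem hamVec_H (x : Phase) :
    hamVec H x = (-Complex.I * (starRingEnd ℂ) x.2, -Complex.I * (starRingEnd ℂ) x.1) := by
  have h : HasFDerivAt H _ x :=
    (((Complex.reCLM.comp (.fst ℝ ℂ ℂ)).hasFDerivAt (x := x)).mul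
      ((Complex.reCLM.comp (.snd ℝ ℂ ℂ)).hasFDerivAt (x := x))).sub
    (((Complex.imCLM.comp (.fst ℝ ℂ ℂ)).hasFDerivAt (x := x)).mul
      ((Complex.imCLM.comp (.snd ℝ ℂ ℂ)).hasFDerivAt (x := x)))
  simp only [hamVec, h.fderiv]
  refine Prod.ext ?_ ?_ <;> apply Complex.ext <;> simp

theorem hamVec_J (x : Phase) : hamVec J x = (-Complex.I * x.1, Complex.I * x.2) := by
  have h : HasFDerivAt J _ x :=
    (((((Complex.reCLM.comp (.fst ℝ ℂ ℂ)).hasFDerivAt (x := x)).pow 2).add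
      (((Complex.imCLM.comp (.fst ℝ ℂ ℂ)).hasFDerivAt (x := x)).pow 2)).mul_const (2 : ℝ)⁻¹).sub
    (((((Complex.reCLM.comp (.snd ℝ ℂ ℂ)).hasFDerivAt (x := x)).pow 2).add
      (((Complex.imCLM.comp (.snd ℝ ℂ ℂ)).hasFDerivAt (x := x)).pow 2)).mul_const (2 : ℝ)⁻¹)
  simp only [hamVec, h.fderiv]
  refine Prod.ext ?_ ?_ <;> apply Complex.ext <;> simp

theorem flowJ_zero (x : Phase) : flowJ 0 x = x := by simp [flowJ]

theorem flowH_zero (x : Phase) : flowH 0 x = x := by simp [flowH]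

theorem hasDerivAt_flowJ (x : Phase) (u : ℝ) :
    HasDerivAt (fun s : ℝ => flowJ s x) (hamVec J (flowJ u x)) u := by
  have h1 : HasDerivAt (fun s : ℝ => (s : ℂ) * Complex.I) (1 * Complex.I) u :=
    (HasDerivAt.ofReal_comp (hasDerivAt_id u)).mul_const _
  rw [hamVec_J]
  have h2 : HasDerivAt (fun s : ℝ => -((s : ℂ) * Complex.I)) (-(1 * Complex.I)) u := h1.neg
  convert (h2.cexp.mul_const x.1).prodMk (h1.cexp.mul_const x.2) using 2 <;>
    simp only [flowJ] <;> ring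

theorem hasDerivAt_flowH (x : Phase) (t : ℝ) :
    HasDerivAt (fun s : ℝ => flowH s x) (hamVec H (flowH t x)) t := by
  have hc : HasDerivAt (fun s : ℝ => ((Real.cosh s : ℝ) : ℂ)) (Real.sinh t : ℝ) t :=
    (Real.hasDerivAt_cosh t).ofReal_comp
  have hs : HasDerivAt (fun s : ℝ => ((Real.sinh s : ℝ) : ℂ)) (Real.cosh t : ℝ) t :=
    (Real.hasDerivAt_sinh t).ofReal_comp
  rw [hamVec_H]
  have hI := Complex.I_mul_I
  convert ((hc.mul_const x.1).sub ((hs.const_mul Complex.I).mul_const ((starRingEnd ℂ) x.2))).prodMk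
    ((hc.mul_const x.2).sub ((hs.const_mul Complex.I).mul_const ((starRingEnd ℂ) x.1))) using 2
  · rfl
  · simp only [flowH, map_sub, map_mul, Complex.conj_conj, Complex.conj_I, Complex.conj_ofReal]
    linear_combination -(Real.sinh t : ℂ) * x.1 * hI
  · simp only [flowH, map_sub, map_mul, Complex.conj_conj, Complex.conj_I, Complex.conj_ofReal]
    linear_combination -(Real.sinh t : ℂ) * x.2 * hI

theorem F_flowJ (u : ℝ) (x : Phase) : F (flowJ u x) = F x := by
  have h := Real.sin_sq_add_cos_sq u
  simp only [F, H, J, flowJ, Complex.mul_re, Complex.mul_im, Complex.exp_re, Complex.exp_im,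
    Complex.neg_re, Complex.neg_im, Complex.ofReal_re, Complex.ofReal_im, Complex.I_re,
    Complex.I_im, mul_zero, mul_one, sub_self, neg_zero, add_zero,
    Real.exp_zero, one_mul, Real.cos_neg, Real.sin_neg, Prod.mk.injEq]
  constructor
  · linear_combination (x.1.re * x.2.re - x.1.im * x.2.im) * h
  · linear_combination ((x.1.re ^ 2 + x.1.im ^ 2) / 2 - (x.2.re ^ 2 + x.2.im ^ 2) / 2) * h

theorem flowJ_add (u s : ℝ) (x : Phase) : flowJ (u + s) x = flowJ u (flowJ s x) := by
  simp only [flowJ, Complex.ofReal_add, add_mul, neg_add, Complex.exp_add, mul_assoc]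

/-- Regular values of `F`. -/
def IsRegularValue (v : ℝ × ℝ) : Prop :=
  ∀ x : Phase, F x = v → Function.Surjective (fderiv ℝ F x)

/-! ### First homology and the monodromy of a torus bundle -/

/-- The first integral homology group of a path connected space, as the abelianized
fundamental group. -/
abbrev H1 (X : Type) [TopologicalSpace X] (x : X) : Type :=
  Additive (Abelianization (FundamentalGroup X x))

/-- The homology class of a loop `c` at `y`, moved to the base point `x` along `α` (the result
does not depend on `α`). -/
def loopClass {X : Type} [TopologicalSpace X] {x y : X} (α : Path x y) (c : Path y y) : H1 X x :=
  Additive.ofMul (Abelianization.of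
    (FundamentalGroup.fromPath (Path.Homotopic.Quotient.mk ((α.trans c).trans α.symm))))

/-- `π : E → B` is a locally trivial bundle of 2-tori. -/
def IsTorusBundle {E B : Type} [TopologicalSpace E] [TopologicalSpace B] (π : E → B) : Prop :=
  ∀ b : B, ∃ e : Bundle.Trivialization (Circle × Circle) π, b ∈ e.baseSet

/-- A transport of the fibre of `π` along a closed path `γ`: a continuous family of
homeomorphisms from the fibre over `b = γ 0` to the fibres over `γ t`, starting at the identity. -/
structure FibreTransport {E B : Type} [TopologicalSpace E] [TopologicalSpace B] (π : E → B)
    {b : B} (γ : Path b b) where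
  toFun : I → (π ⁻¹' {b}) → E
  continuous_uncurry : Continuous (Function.uncurry toFun)
  mem_fibre : ∀ t x, toFun t x ∈ π ⁻¹' {γ t}
  isHomeomorph : ∀ t, IsHomeomorph fun x => (⟨toFun t x, mem_fibre t x⟩ : π ⁻¹' {γ t})
  start : ∀ x, toFun 0 x = x

/-- The return map of the fibre over the base point. -/
def FibreTransport.returnMap {E B : Type} [TopologicalSpace E] [TopologicalSpace B] {π : E → B}
    {b : B} {γ : Path b b} (Ψ : FibreTransport π γ) : C(π ⁻¹' {b}, π ⁻¹' {b}) where
  toFun x := ⟨Ψ.toFun 1 x, by simpa using Ψ.mem_fibre 1 x⟩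
  continuous_toFun :=
    (Ψ.continuous_uncurry.comp (Continuous.prodMk_right (1 : I))).subtype_mk _

/-- `M` is the monodromy of `π` along `γ`: the automorphism of the first homology group of the
fibre induced by the return map of a transport along `γ`. -/
def IsMonodromy {E B : Type} [TopologicalSpace E] [TopologicalSpace B] (π : E → B)
    {b : B} (γ : Path b b) (x : π ⁻¹' {b}) (M : H1 (π ⁻¹' {b}) x ≃+ H1 (π ⁻¹' {b}) x) : Prop :=
  ∃ (Ψ : FibreTransport π γ) (α : Path x (Ψ.returnMap x)), ∀ c : Path x x,
    M (loopClass (Path.refl x) c) = loopClass α (c.map Ψ.returnMap.continuous)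

/-! ### Reduction by the circle action and the torus bundles `T_m` -/

/-- `F⁻¹(D)`. -/
abbrev Over (D : Set (ℝ × ℝ)) : Type := {x : Phase // F x ∈ D}

/-- `F : F⁻¹(D) → D`. -/
def Over.base {D : Set (ℝ × ℝ)} (x : Over D) : D := ⟨F x.1, x.2⟩

/-- Two points of `F⁻¹(D)` are equivalent if they lie on the same `X_J`-orbit. -/
def orbitSetoid (D : Set (ℝ × ℝ)) : Setoid (Over D) where
  r x y := ∃ u : ℝ, y.1 = flowJ u x.1
  iseqv := by
    refine ⟨fun x => ⟨0, (flowJ_zero _).symm⟩, ?_, ?_⟩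
    · rintro x y ⟨u, h⟩
      exact ⟨-u, by rw [h, ← flowJ_add, neg_add_cancel, flowJ_zero]⟩
    · rintro x y z ⟨u, h⟩ ⟨s, h'⟩
      exact ⟨s + u, by rw [h', h, flowJ_add]⟩

/-- The reduced space `F⁻¹(D) / S¹`. -/
abbrev Reduced (D : Set (ℝ × ℝ)) : Type := Quotient (orbitSetoid D)

/-- The reduction map `ρ`. -/
def reduction {D : Set (ℝ × ℝ)} (x : Over D) : Reduced D := Quotient.mk (orbitSetoid D) x

/-- A homeomorphism `g : F⁻¹(D) / S¹ → D × ℝ` over `D`. By convention the second factor is oriented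
so that the flow of `X_H` goes from `-∞` to `+∞`. -/
structure ReducedTriv (D : Set (ℝ × ℝ)) where
  g : Reduced D ≃ₜ D × ℝ
  fst_eq : ∀ x : Over D, (g (reduction x)).1 = x.base
  mono : ∀ (x y : Over D) (t : ℝ), 0 ≤ t → y.1 = flowH t x.1 →
    (g (reduction x)).2 ≤ (g (reduction y)).2

/-- The `ℝ`-component of `g ∘ ρ`. -/
def ReducedTriv.height {D : Set (ℝ × ℝ)} (g : ReducedTriv D) (x : Over D) : ℝ :=
  (g.g (reduction x)).2

/-- A continuous section over `D` of the set `{height = c}`; for `c = ± m` this set is `A_{± m}`. -/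
structure EndSection {D : Set (ℝ × ℝ)} (g : ReducedTriv D) (c : ℝ) where
  toFun : D → Over D
  continuous_toFun : Continuous toFun
  base_eq : ∀ v, (toFun v).base = v
  height_eq : ∀ v, g.height (toFun v) = c

/-- The truncated cylinder bundle `ρ⁻¹(g⁻¹(Γ × [-m, m]))`. -/
abbrev Cut {D : Set (ℝ × ℝ)} (g : ReducedTriv D) (m : ℝ) (Γ : Set D) : Type :=
  {x : Over D // x.base ∈ Γ ∧ |g.height x| ≤ m}

/-- `η_m x = y`, where `η_m (φ_J^t (σ₊ v)) = φ_J^t (σ₋ v)`. -/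
def glue {D : Set (ℝ × ℝ)} {g : ReducedTriv D} {m : ℝ} (Γ : Set D)
    (σp : EndSection g m) (σn : EndSection g (-m)) (x y : Cut g m Γ) : Prop :=
  ∃ (v : D) (t : ℝ), x.1.1 = flowJ t (σp.toFun v).1 ∧ y.1.1 = flowJ t (σn.toFun v).1

/-- The space `T_m`, with the quotient topology. -/
abbrev Tm {D : Set (ℝ × ℝ)} {g : ReducedTriv D} {m : ℝ} (Γ : Set D)
    (σp : EndSection g m) (σn : EndSection g (-m)) : Type :=
  Quot (glue Γ σp σn)

theorem base_eq_of_flowJ {D : Set (ℝ × ℝ)} {x y : Over D} {t : ℝ} (h : x.1 = flowJ t y.1) :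
    x.base = y.base := by
  apply Subtype.ext
  simp [Over.base, h, F_flowJ]

/-- The projection `F : T_m → Γ`. -/
def projTm {D : Set (ℝ × ℝ)} {g : ReducedTriv D} {m : ℝ} (Γ : Set D)
    (σp : EndSection g m) (σn : EndSection g (-m)) : Tm Γ σp σn → Γ :=
  Quot.lift (fun x => ⟨x.1.base, x.2.1⟩) (by
    rintro x y ⟨v, t, hx, hy⟩
    apply Subtype.ext
    change x.1.base = y.1.base
    rw [base_eq_of_flowJ hx, base_eq_of_flowJ hy, σp.base_eq, σn.base_eq])

/-- The point `x` of `T_m` is the class of the phase space point `p`. -/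
def IsClassOf {D : Set (ℝ × ℝ)} {g : ReducedTriv D} {m : ℝ} {Γ : Set D}
    {σp : EndSection g m} {σn : EndSection g (-m)} (x : Tm Γ σp σn) (p : Phase) : Prop :=
  ∃ y : Cut g m Γ, y.1.1 = p ∧ x = Quot.mk _ y

/-- The basis `(b 0, b 1)` of the homology of the fibre of `T_m` over `v` is of the form
`(γ_J, γ)`, where `γ_J` is the class of the `X_J`-orbit of `σ₋ v` and `γ` is the class of the loop
that follows the flow of `X_H` from `σ₋ v ∈ A_{-m}` to `A_{+m}` and then the flow
of `X_J` (for time `-θ`) to `σ₊ v`, a point which is identified with `σ₋ v`. -/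
def IsAdaptedBasis {D : Set (ℝ × ℝ)} {g : ReducedTriv D} {m : ℝ} {Γ : Set D}
    (σp : EndSection g m) (σn : EndSection g (-m)) (v : Γ) (x : projTm Γ σp σn ⁻¹' {v})
    (b : Module.Basis (Fin 2) ℤ (H1 (projTm Γ σp σn ⁻¹' {v}) x)) : Prop :=
  ∃ (cJ : Path x x) (y : projTm Γ σp σn ⁻¹' {v}) (c₁ : Path x y) (c₂ : Path y x) (T θ : ℝ),
    (∀ s : I, IsClassOf (cJ s).1 (flowJ (2 * Real.pi * s) (σn.toFun v.1).1)) ∧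
    0 < T ∧ flowH T (σn.toFun v.1).1 = flowJ θ (σp.toFun v.1).1 ∧
    (∀ s : I, IsClassOf (c₁ s).1 (flowH (s * T) (σn.toFun v.1).1)) ∧
    (∀ s : I, IsClassOf (c₂ s).1 (flowJ ((1 - s) * θ) (σp.toFun v.1).1)) ∧
    b 0 = loopClass (Path.refl x) cJ ∧ b 1 = loopClass (Path.refl x) (c₁.trans c₂)

/-- `T_m` is a torus bundle over `Γ` whose monodromy along the closed path `γ` (exists, is unique
and) has the matrix `(1 k; 0 1)` in every basis `(γ_J, γ)` as above. -/
def HasMonodromyNumber {D : Set (ℝ × ℝ)} {g : ReducedTriv D} {m : ℝ} {Γ : Set D}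
    (σp : EndSection g m) (σn : EndSection g (-m)) {v : Γ} (γ : Path v v) (k : ℤ) : Prop :=
  Continuous (projTm Γ σp σn) ∧ IsTorusBundle (projTm Γ σp σn) ∧
  ∃ x : projTm Γ σp σn ⁻¹' {v}, IsClassOf x.1 (σn.toFun v.1).1 ∧
    (∃ b, IsAdaptedBasis σp σn v x b) ∧
    ∃ M, (∀ M', IsMonodromy (projTm Γ σp σn) γ x M' ↔ M' = M) ∧
      ∀ b, IsAdaptedBasis σp σn v x b →
        LinearMap.toMatrix b b M.toAddMonoidHom.toIntLinearMap = !![1, k; 0, 1]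

/-- The noncompact monodromy of the cylinder bundle over `Γ` along `γ` is defined, with monodromy
number `k`: for all large `m` the construction of `T_m` can be carried out, and every `T_m` so
obtained has monodromy number `k`. -/
def HasNoncompactMonodromyNumber {D : Set (ℝ × ℝ)} (g : ReducedTriv D) {Γ : Set D}
    {v : Γ} (γ : Path v v) (k : ℤ) : Prop :=
  ∃ M > 0, ∀ m > M, Nonempty (EndSection g m) ∧ Nonempty (EndSection g (-m)) ∧
    ∀ (σp : EndSection g m) (σn : EndSection g (-m)), HasMonodromyNumber σp σn γ k

/-! ### Simple closed paths bounding a disk -/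

/-- An embedded closed disk in the plane of values of `F`. -/
structure Disk where
  toFun : Metric.closedBall (0 : ℂ) 1 → ℝ × ℝ
  continuous_toFun : Continuous toFun
  injective : Function.Injective toFun

/-- The disk as a subset `D` of the plane. -/
def Disk.D (d : Disk) : Set (ℝ × ℝ) := range d.toFun

/-- The boundary path of the disk, with period 1. -/
def Disk.bdry (d : Disk) (s : ℝ) : d.D :=
  ⟨d.toFun ⟨Complex.exp ((2 * Real.pi * s : ℝ) * Complex.I), by
    rw [mem_closedBall_zero_iff, Complex.norm_exp_ofReal_mul_I]⟩, mem_range_self _⟩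

/-- The boundary curve `Γ` of the disk. -/
def Disk.Γ (d : Disk) : Set d.D := range d.bdry

theorem Disk.continuous_bdry (d : Disk) : Continuous d.bdry := by
  refine Continuous.subtype_mk (d.continuous_toFun.comp (Continuous.subtype_mk ?_ _)) _
  fun_prop

theorem Disk.bdry_one (d : Disk) : d.bdry 1 = d.bdry 0 := by
  apply Subtype.ext
  simp only [Disk.bdry]
  congr 2
  simp [Complex.exp_two_pi_mul_I]

/-- The boundary path as a closed path in `Γ`. -/
def Disk.loop (d : Disk) :
    Path (⟨d.bdry 0, mem_range_self 0⟩ : d.Γ) ⟨d.bdry 0, mem_range_self 0⟩ where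
  toFun s := ⟨d.bdry s, mem_range_self _⟩
  continuous_toFun := (d.continuous_bdry.comp continuous_subtype_val).subtype_mk _
  source' := by simp
  target' := by simp [d.bdry_one]

/-- The boundary path winds once around the origin, in the positive sense of the `(j, h)`-plane:
a continuous argument of `j + i h` increases by `2π`. -/
def Disk.WindsOnce (d : Disk) : Prop :=
  ∃ θ : ℝ → ℝ, Continuous θ ∧ θ 1 = θ 0 + 2 * Real.pi ∧ ∀ s : ℝ, ∃ ρ : ℝ, 0 < ρ ∧
    ((d.bdry s).1.2 : ℂ) + (d.bdry s).1.1 * Complex.I = ρ * Complex.exp (θ s * Complex.I)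

/-! ### Variation, local monodromy and scattering monodromy -/

/-- The function `g` on the circle `ℝ / ℤ` has finitely many discontinuities, all of them jumps,
and its variation (minus the sum of its jumps) is `V`. -/
def HasVariation (g : ℝ → ℝ) (V : ℝ) : Prop :=
  Function.Periodic g 1 ∧ ∃ (S : Finset ℝ) (l r : ℝ → ℝ), (S : Set ℝ) ⊆ Ico 0 1 ∧
    (∀ s ∈ Ico (0 : ℝ) 1, s ∉ S → ContinuousAt g s) ∧
    (∀ s ∈ S, Tendsto g (𝓝[<] s) (𝓝 (l s)) ∧ Tendsto g (𝓝[>] s) (𝓝 (r s))) ∧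
    V = -∑ s ∈ S, (r s - l s)

/-- The rotation 1-form `ϑ = (p₁ dq₁ - q₁ dp₁) / (q₁² + p₁²)` at `x`, applied to the vector `ξ`.
Its polar set is `{q₁ = p₁ = 0}`. -/
def rotForm (x ξ : Phase) : ℝ :=
  (x.1.im * ξ.1.re - x.1.re * ξ.1.im) / (x.1.re ^ 2 + x.1.im ^ 2)

/-- The ball `B = {q₁² + q₂² + p₁² + p₂² < 2 r}`. -/
def ballB (r : ℝ) : Set Phase :=
  {x | x.1.re ^ 2 + x.2.re ^ 2 + x.1.im ^ 2 + x.2.im ^ 2 < 2 * r}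

/-- `Φ_rel`: the integral of `ϑ` along the part in `B` of the `X_H`-orbit of `x`. -/
def phiRel (r : ℝ) (x : Phase) : ℝ :=
  ∫ t in {t : ℝ | flowH t x ∈ ballB r}, rotForm (flowH t x) (hamVec H (flowH t x))

/-- The local monodromy number along the closed path `γ` of period 1 is `k`, that is, the variation
along `γ` of `Φ_rel`, as a function of the fibre, is `-2πk`. -/
def IsLocalMonodromyNumber (r : ℝ) (γ : ℝ → ℝ × ℝ) (k : ℤ) : Prop :=
  ∀ x : ℝ → Phase, (∀ s, F (x s) = γ s) →
    HasVariation (fun s => phiRel r (x s)) (-(2 * Real.pi * k))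

/-- `θ` is a scattering angle of the `X_H`-orbit of `x`: the projection of the orbit to the
`(q₁, p₁)`-plane has asymptotic directions for `t → ∓∞`, and the flow of `X_J`, which acts on this
plane by `exp (-i u)`, takes the incoming direction to the outgoing one in time `θ`. -/
def IsScatteringAngle (x : Phase) (θ : ℝ) : Prop :=
  ∃ e₁ e₂ : ℂ,
    Tendsto (fun t : ℝ => (flowH t x).1 / (‖(flowH t x).1‖ : ℂ)) atBot (𝓝 e₁) ∧
    Tendsto (fun t : ℝ => (flowH t x).1 / (‖(flowH t x).1‖ : ℂ)) atTop (𝓝 e₂) ∧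
    ‖e₁‖ = 1 ∧ e₂ = Complex.exp (-(θ * Complex.I)) * e₁

/-- The scattering monodromy number along `γ` is `k`: the scattering angle, as a function of the
fibre, has variation `-2πk` along `γ`. -/
def IsScatteringMonodromyNumber (γ : ℝ → ℝ × ℝ) (k : ℤ) : Prop :=
  ∃ θ : ℝ → ℝ, (∀ s x, F x = γ s → IsScatteringAngle x (θ s)) ∧
    HasVariation θ (-(2 * Real.pi * k))

end FocusFocus

end

open FocusFocus

noncomputable section

namespace FocusFocus

/-! ### Angles of paths in the circle -/

/-! Write `z₁ = q₁ + i p₁`, `z₂ = q₂ + i p₂` and use the coordinates `a = z₁ - i z̄₂` (`unst`) and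
`b = z₁ + i z̄₂` (`stab`). The flow of `X_H` multiplies `a` by `e^t` and `b` by `e^{-t}`, the flow
of `X_J` multiplies both by `e^{-iu}`, and `a b̄ = 2 conj (j + i h)` (`unst_mul_conj_stab`). Off `F
= 0` both coordinates are nonzero and, for directions, `dir a = (dir val)⁻¹ dir b` (`dir_unst`),
where `val = j + i h` winds once along `Γ`. This one factor produces all three monodromies.

Noncompact monodromy. Points with `a = 0` flow forward to the origin and points with `b = 0`
backward, so `a ≠ 0` above the height of `0` and `b ≠ 0` below it. If `m` exceeds the absolute value
of that height, `dir a` on `σ₊` and `dir b` on `σ₋` are therefore continuous on the whole disk and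
have degree `0` along `Γ`. Hence the relative position `dir a(σ₋) / dir a(σ₊)` of the sections has
degree `-1` (`hasAngle_offset`). Polar coordinates of `a` present `T_m` as `Γ × [0,1] × S¹` glued by
this rotation (`isTwistedTorus_projTm`). Such a bundle is locally trivial with a shear as monodromy
(`IsTwistedTorus.exists_monodromy`), computed from `H₁ ≅ ℤ²` by degrees (`degreesEquiv`); in the
basis `(γ_J, γ)` it sends `γ` to `γ - γ_J`.

Scattering. The projected orbit has asymptotic directions `dir b` and `dir a`, so the scattering
angle is an argument of `val` (`isScatteringAngle_iff`).

Local monodromy. The integral is elementary: `Φ_rel = 2 arctan (κ tan (θ/2))`, with `θ` an argument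
of `val` and `κ > 0` (`phiRel_eq`). Modulo `2π` it has a continuous lift which gains `2π` along `Γ`,
just like `θ`.

For both angle functions the variation is then forced: a periodic function that agrees modulo `2π`
with a continuous function gaining `2π` per period must make up for the gain by its jumps
(`HasVariation.eq_two_pi`). -/

theorem eq_of_mem_two_pi_int {X : Type*} [TopologicalSpace X] {S : Set X} (hS : IsPreconnected S)
    {u : X → ℝ} (hu : ContinuousOn u S) (h : ∀ x ∈ S, ∃ n : ℤ, u x = n * (2 * Real.pi))
    {x y : X} (hx : x ∈ S) (hy : y ∈ S) : u x = u y := by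
  refine hS.constant_of_mapsTo (T := (AddSubgroup.zmultiples (2 * Real.pi) : Set ℝ)) ?_ hu ?_ hx hy
  · exact ⟨inferInstanceAs (DiscreteTopology (AddSubgroup.zmultiples (2 * Real.pi)))⟩
  · intro z hz
    obtain ⟨n, hn⟩ := h z hz
    exact AddSubgroup.mem_zmultiples_iff.2 ⟨n, by simp [hn]⟩

theorem exp_add_int (x : ℝ) (n : ℤ) : Circle.exp (x + n * (2 * Real.pi)) = Circle.exp x :=
  Circle.exp_eq_exp.2 ⟨n, rfl⟩

/-- A continuous argument of the circle valued function `p` on `[0, 1]` increases by `δ`. -/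
def HasAngle (p : I → Circle) (δ : ℝ) : Prop :=
  ∃ f : I → ℝ, Continuous f ∧ (∀ s, Circle.exp (f s) = p s) ∧ f 1 = f 0 + δ

theorem HasAngle.unique {p : I → Circle} {δ ε : ℝ} (h : HasAngle p δ) (h' : HasAngle p ε) :
    δ = ε := by
  obtain ⟨f, hf, hfp, hδ⟩ := h
  obtain ⟨g, hg, hgp, hε⟩ := h'
  have := eq_of_mem_two_pi_int (isPreconnected_univ (α := I)) (u := fun s => f s - g s)
    (hf.sub hg).continuousOn (fun s _ => by
      obtain ⟨n, hn⟩ := Circle.exp_eq_exp.1 ((hfp s).trans (hgp s).symm)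
      exact ⟨n, by linarith⟩) (mem_univ 0) (mem_univ 1)
  linarith

theorem exists_angle {p : I → Circle} (hp : Continuous p) : ∃ δ, HasAngle p δ := by
  obtain ⟨f, hf, -⟩ := Circle.isCoveringMap_exp.exists_path_lifts ⟨p, hp⟩ (Complex.arg (p 0))
    (Circle.exp_arg _).symm
  exact ⟨f 1 - f 0, f, f.continuous, fun s => congr_fun hf s, by ring⟩

theorem HasAngle.exists_int {p : I → Circle} {δ : ℝ} (h : HasAngle p δ) (h01 : p 0 = p 1) :
    ∃ n : ℤ, δ = n * (2 * Real.pi) := by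
  obtain ⟨f, -, hfp, hδ⟩ := h
  obtain ⟨n, hn⟩ := Circle.exp_eq_exp.1 ((hfp 1).trans (h01.symm.trans (hfp 0).symm))
  exact ⟨n, by linarith⟩

theorem HasAngle.mul {p q : I → Circle} {δ ε : ℝ} (h : HasAngle p δ) (h' : HasAngle q ε) :
    HasAngle (fun s => p s * q s) (δ + ε) := by
  obtain ⟨f, hf, hfp, hδ⟩ := h
  obtain ⟨g, hg, hgp, hε⟩ := h'
  exact ⟨fun s => f s + g s, hf.add hg, fun s => by rw [Circle.exp_add, hfp, hgp],
    by simp only [hδ, hε]; ring⟩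

theorem HasAngle.inv {p : I → Circle} {δ : ℝ} (h : HasAngle p δ) :
    HasAngle (fun s => (p s)⁻¹) (-δ) := by
  obtain ⟨f, hf, hfp, hδ⟩ := h
  exact ⟨fun s => - f s, hf.neg, fun s => by rw [Circle.exp_neg, hfp], by simp only [hδ]; ring⟩

theorem HasAngle.trans {X : Type*} [TopologicalSpace X] {x y z : X} {u : X → Circle}
    {c : Path x y} {c' : Path y z} {δ ε : ℝ}
    (h : HasAngle (fun s => u (c s)) δ) (h' : HasAngle (fun s => u (c' s)) ε) :
    HasAngle (fun s => u (c.trans c' s)) (δ + ε) := by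
  obtain ⟨f, hf, hfp, hδ⟩ := h
  obtain ⟨g, hg, hgp, hε⟩ := h'
  have h1 : Circle.exp (f 1) = Circle.exp (g 0) := by simp only [hfp, hgp, c.target, c'.source]
  obtain ⟨n, hn⟩ := Circle.exp_eq_exp.1 h1
  let P : Path (f 0) (f 1) := ⟨⟨f, hf⟩, rfl, rfl⟩
  -- The second lift is moved by a multiple of `2π` so that it starts where the first one ends.
  let Q : Path (f 1) (f 0 + (δ + ε)) :=
    ⟨⟨fun s => g s + n * (2 * Real.pi), by fun_prop⟩, by simp [hn], by simp [hε]; linarith⟩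
  refine ⟨P.trans Q, (P.trans Q).continuous, fun s => ?_, by simp⟩
  simp only [Path.trans_apply]
  split_ifs
  · exact hfp _
  · exact (exp_add_int _ _).trans (hgp _)

theorem HasAngle.symm {X : Type*} [TopologicalSpace X] {x y : X} {u : X → Circle}
    {c : Path x y} {δ : ℝ} (h : HasAngle (fun s => u (c s)) δ) :
    HasAngle (fun s => u (c.symm s)) (-δ) := by
  obtain ⟨f, hf, hfp, hδ⟩ := h
  exact ⟨fun s => f (σ s), by fun_prop, fun s => hfp _, by simp [hδ]⟩

/-- After lifting the homotopy to `ℝ`, the increment of each stage lies in `2πℤ` because the stage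
is closed, so it does not vary. The homotopy is free; moving base points occur both for fibre
transports and for the contraction of the disk. -/
theorem HasAngle.homotopy {K : I × I → Circle} (hK : Continuous K) (h : ∀ t, K (t, 0) = K (t, 1))
    {δ : ℝ} (h0 : HasAngle (fun s => K (0, s)) δ) : HasAngle (fun s => K (1, s)) δ := by
  obtain ⟨f, hf, hfp, hδ⟩ := h0
  let L := Circle.isCoveringMap_exp.liftHomotopy ⟨K, hK⟩ ⟨f, hf⟩ (fun s => (hfp s).symm)
  have hL : ∀ z, Circle.exp (L z) = K z :=
    fun z => congr_fun (Circle.isCoveringMap_exp.liftHomotopy_lifts ⟨K, hK⟩ ⟨f, hf⟩ _) z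
  have hL0 : ∀ s, L (0, s) = f s :=
    Circle.isCoveringMap_exp.liftHomotopy_zero ⟨K, hK⟩ ⟨f, hf⟩ _
  have := eq_of_mem_two_pi_int (isPreconnected_univ (α := I)) (u := fun t => L (t, 1) - L (t, 0))
    (by fun_prop) (fun t _ => by
      obtain ⟨n, hn⟩ := Circle.exp_eq_exp.1 ((hL (t, 1)).trans ((h t).symm.trans (hL (t, 0)).symm))
      exact ⟨n, by linarith⟩) (mem_univ 0) (mem_univ 1)
  simp only [hL0] at this
  exact ⟨fun s => L (1, s), by fun_prop, fun s => hL _, by linarith⟩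

theorem HasAngle.homotopic {X : Type*} [TopologicalSpace X] {x : X} {u : X → Circle}
    (hu : Continuous u) {c c' : Path x x} (h : c.Homotopic c') {δ : ℝ}
    (hc : HasAngle (fun s => u (c s)) δ) : HasAngle (fun s => u (c' s)) δ := by
  obtain ⟨F⟩ := h
  have := HasAngle.homotopy (K := fun z => u (F z)) (by fun_prop) (by simp) (δ := δ)
    (by simpa using hc)
  simpa using this

/-- The degree of a closed path in the circle. -/
def degree (p : I → Circle) : ℤ :=
  open Classical in if h : ∃ n : ℤ, HasAngle p (n * (2 * Real.pi)) then h.choose else 0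

theorem HasAngle.degree_eq {p : I → Circle} {n : ℤ} (h : HasAngle p (n * (2 * Real.pi))) :
    degree p = n := by
  have h' : ∃ n : ℤ, HasAngle p (n * (2 * Real.pi)) := ⟨n, h⟩
  have := h'.choose_spec.unique h
  rw [degree, dif_pos h']
  exact_mod_cast mul_right_cancel₀ Real.two_pi_pos.ne' this

theorem hasAngle_degree {p : I → Circle} (hp : Continuous p) (h01 : p 0 = p 1) :
    HasAngle p (degree p * (2 * Real.pi)) := by
  obtain ⟨δ, hδ⟩ := exists_angle hp
  obtain ⟨n, rfl⟩ := hδ.exists_int h01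
  rwa [hδ.degree_eq]

/-! ### The first homology of a torus -/

section Torus

variable {X : Type} [TopologicalSpace X] (u : X ≃ₜ Circle × Circle) (x : X)

theorem hasAngle_fst {y : X} (c : Path y y) :
    HasAngle (fun s => (u (c s)).1) (degree (fun s => (u (c s)).1) * (2 * Real.pi)) :=
  hasAngle_degree (by fun_prop) (by simp)

theorem hasAngle_snd {y : X} (c : Path y y) :
    HasAngle (fun s => (u (c s)).2) (degree (fun s => (u (c s)).2) * (2 * Real.pi)) :=
  hasAngle_degree (by fun_prop) (by simp)

/-- The pair of degrees of a closed path in a torus. -/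
def degrees {y : X} (c : Path y y) : ℤ × ℤ :=
  (degree fun s => (u (c s)).1, degree fun s => (u (c s)).2)

theorem degrees_trans {y : X} (c c' : Path y y) :
    degrees u (c.trans c') = degrees u c + degrees u c' := by
  have h1 := (hasAngle_fst u c).trans (u := fun z => (u z).1) (hasAngle_fst u c')
  have h2 := (hasAngle_snd u c).trans (u := fun z => (u z).2) (hasAngle_snd u c')
  rw [← add_mul, ← Int.cast_add] at h1 h2
  exact Prod.ext h1.degree_eq h2.degree_eq

theorem degrees_eq_of_homotopic {y : X} {c c' : Path y y} (h : c.Homotopic c') :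
    degrees u c = degrees u c' :=
  Prod.ext ((hasAngle_fst u c).homotopic (u := fun z => (u z).1) (by fun_prop) h).degree_eq.symm
    ((hasAngle_snd u c).homotopic (u := fun z => (u z).2) (by fun_prop) h).degree_eq.symm

/-- With both degrees zero the loop lifts to a closed path in `ℝ × ℝ`, which is simply connected;
the contraction there is pushed down. -/
theorem homotopic_refl_of_degrees {y : X} {c : Path y y} (h : degrees u c = 0) :
    c.Homotopic (Path.refl y) := by
  obtain ⟨f, hf, hfp, hf1⟩ := hasAngle_fst u c
  obtain ⟨g, hg, hgp, hg1⟩ := hasAngle_snd u c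
  have h1 : degree (fun s => (u (c s)).1) = 0 := congr_arg Prod.fst h
  have h2 : degree (fun s => (u (c s)).2) = 0 := congr_arg Prod.snd h
  rw [h1] at hf1
  rw [h2] at hg1
  let P : Path (f 0, g 0) (f 0, g 0) :=
    ⟨⟨fun s => (f s, g s), by fun_prop⟩, rfl, by simp [hf1, hg1]⟩
  let E : C(ℝ × ℝ, X) := ⟨fun z => u.symm (Circle.exp z.1, Circle.exp z.2), by fun_prop⟩
  have hE : ∀ s, E (P s) = c s := fun s => by
    change u.symm (Circle.exp (f s), Circle.exp (g s)) = c s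
    rw [hfp, hgp, Prod.mk.eta, u.symm_apply_apply]
  have hy : y = E (f 0, g 0) := by simpa using (hE 0).symm
  have key : (P.map E.continuous).Homotopic ((Path.refl (f 0, g 0)).map E.continuous) :=
    (SimplyConnectedSpace.paths_homotopic P (Path.refl _)).map E
  have e1 : c = (P.map E.continuous).cast hy hy := by ext s; exact (hE s).symm
  have e2 : Path.refl y = ((Path.refl (f 0, g 0)).map E.continuous).cast hy hy := by
    ext s; exact hy
  rw [e1, e2]
  obtain ⟨K⟩ := key
  exact ⟨K.cast rfl rfl⟩

/-- The pair of degrees as a homomorphism on the fundamental group. -/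
def degreesHom : FundamentalGroup X x →* Multiplicative (ℤ × ℤ) where
  toFun g := Multiplicative.ofAdd
    (Quotient.lift (fun c : Path x x => degrees u c) (fun _ _ h => degrees_eq_of_homotopic u h)
      (FundamentalGroup.toPath g))
  map_one' := by
    change Multiplicative.ofAdd (degrees u (Path.refl x)) = 1
    -- The constant path is idempotent under concatenation, so its degrees satisfy `n = n + n`.
    have h := degrees_trans u (Path.refl x) (Path.refl x)
    rw [Path.refl_trans_refl] at h
    rw [left_eq_add.1 h]
    rfl
  map_mul' := by
    rintro ⟨p⟩ ⟨q⟩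
    -- The product of the fundamental group reverses concatenation, which is harmless in the
    -- commutative group `ℤ × ℤ`.
    change Multiplicative.ofAdd (degrees u (q.trans p)) =
      Multiplicative.ofAdd (degrees u p) * Multiplicative.ofAdd (degrees u q)
    rw [degrees_trans, ofAdd_add, mul_comm]

/-- The pair of degrees on the first homology group of a torus. -/
def degreesH1 : H1 X x →+ ℤ × ℤ :=
  MonoidHom.toAdditiveLeft (Abelianization.lift (degreesHom u x))

theorem exists_loopClass (g : H1 X x) : ∃ c : Path x x, g = Additive.ofMul (Abelianization.of
    (FundamentalGroup.fromPath (Path.Homotopic.Quotient.mk c))) := by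
  obtain ⟨p, hp⟩ := QuotientGroup.mk_surjective g.toMul
  obtain ⟨c, rfl⟩ := Path.Homotopic.Quotient.mk_surjective p
  exact ⟨c, congr_arg Additive.ofMul hp.symm⟩

theorem loopClass_refl (c : Path x x) : loopClass (Path.refl x) c = Additive.ofMul
    (Abelianization.of (FundamentalGroup.fromPath (Path.Homotopic.Quotient.mk c))) := by
  unfold loopClass
  congr 3
  refine Path.Homotopic.Quotient.eq.2 ?_
  refine Path.Homotopic.trans ?_ ⟨Path.Homotopy.reflTrans c⟩
  rw [Path.refl_symm]
  exact ⟨Path.Homotopy.transRefl _⟩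

theorem degreesH1_of (c : Path x x) : degreesH1 u x (Additive.ofMul (Abelianization.of
    (FundamentalGroup.fromPath (Path.Homotopic.Quotient.mk c)))) = degrees u c := rfl

variable {x} in
-- The angle swept along `α` is undone along `α.symm`, so conjugating by `α` does not affect the
-- degrees.
theorem degreesH1_loopClass {y : X} (α : Path x y) (c : Path y y) :
    degreesH1 u x (loopClass α c) = degrees u c := by
  rw [loopClass, degreesH1_of]
  obtain ⟨δ, hδ⟩ := exists_angle (p := fun s => (u (α s)).1) (by fun_prop)
  obtain ⟨ε, hε⟩ := exists_angle (p := fun s => (u (α s)).2) (by fun_prop)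
  have h1 := (hδ.trans (u := fun z => (u z).1) (hasAngle_fst u c)).trans
    (u := fun z => (u z).1) (hδ.symm (u := fun z => (u z).1))
  have h2 := (hε.trans (u := fun z => (u z).2) (hasAngle_snd u c)).trans
    (u := fun z => (u z).2) (hε.symm (u := fun z => (u z).2))
  rw [add_comm δ, add_neg_cancel_right] at h1
  rw [add_comm ε, add_neg_cancel_right] at h2
  exact Prod.ext h1.degree_eq h2.degree_eq

theorem degreesH1_injective : Function.Injective (degreesH1 u x) := by
  rw [injective_iff_map_eq_zero]
  intro g hg
  obtain ⟨c, rfl⟩ := exists_loopClass x g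
  rw [degreesH1_of] at hg
  have := Path.Homotopic.Quotient.eq.2 (homotopic_refl_of_degrees u hg)
  rw [this]
  exact congr_arg Additive.ofMul (map_one Abelianization.of)

theorem degreesH1_surjective : Function.Surjective (degreesH1 u x) := by
  rintro ⟨i, j⟩
  let c : Path x x :=
    { toFun := fun s => u.symm ((u x).1 * Circle.exp (s * (i * (2 * Real.pi))),
        (u x).2 * Circle.exp (s * (j * (2 * Real.pi))))
      continuous_toFun := by fun_prop
      source' := by simp
      target' := by
        have h : ∀ n : ℤ, Circle.exp (n * (2 * Real.pi)) = 1 := fun n => by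
          rw [← zero_add ((n : ℝ) * _), exp_add_int, Circle.exp_zero]
        simp [h] }
  have key : ∀ (z : Circle) (n : ℤ),
      HasAngle (fun s : I => z * Circle.exp (s * (n * (2 * Real.pi)))) (n * (2 * Real.pi)) :=
    fun z n => ⟨fun s => Complex.arg z + s * (n * (2 * Real.pi)), by fun_prop,
      fun s => by rw [Circle.exp_add, Circle.exp_arg], by simp⟩
  refine ⟨loopClass (Path.refl x) c, ?_⟩
  rw [degreesH1_loopClass]
  refine Prod.ext (HasAngle.degree_eq ?_) (HasAngle.degree_eq ?_)
  · simpa [c] using key (u x).1 i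
  · simpa [c] using key (u x).2 j

/-- The first homology group of a torus. -/
def degreesEquiv : H1 X x ≃+ ℤ × ℤ :=
  AddEquiv.ofBijective (degreesH1 u x) ⟨degreesH1_injective u x, degreesH1_surjective u x⟩

end Torus

/-! ### Twisted torus bundles -/

theorem circleExp_two_pi_eq_iff {s t : I}
    (h : Circle.exp (2 * Real.pi * s) = Circle.exp (2 * Real.pi * t)) :
    s = t ∨ (s = 0 ∧ t = 1) ∨ (s = 1 ∧ t = 0) := by
  obtain ⟨n, hn⟩ := Circle.exp_eq_exp.1 h
  have hn' : (s : ℝ) = t + n := by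
    have := Real.two_pi_pos
    have h2 : 2 * Real.pi * (s : ℝ) = 2 * Real.pi * (t + n) := by rw [hn]; ring
    exact mul_left_cancel₀ this.ne' h2
  have hs := s.2
  have ht := t.2
  have h1 : (n : ℝ) ≤ 1 := by linarith [hs.2, ht.1]
  have h2 : (-1 : ℝ) ≤ n := by linarith [hs.1, ht.2]
  have h1' : n ≤ 1 := by exact_mod_cast h1
  have h2' : -1 ≤ n := by exact_mod_cast h2
  obtain rfl | rfl | rfl : n = -1 ∨ n = 0 ∨ n = 1 := by omega
  · right; left
    push_cast at hn'
    exact ⟨Subtype.ext (by simpa using (by linarith [hs.1, ht.2] : (s : ℝ) = 0)),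
      Subtype.ext (by simpa using (by linarith [hs.1, ht.2] : (t : ℝ) = 1))⟩
  · left
    exact Subtype.ext (by simpa using hn')
  · right; right
    push_cast at hn'
    exact ⟨Subtype.ext (by simpa using (by linarith [hs.2, ht.1] : (s : ℝ) = 1)),
      Subtype.ext (by simpa using (by linarith [hs.2, ht.1] : (t : ℝ) = 0))⟩

/-- The argument of a point of the circle, as a fraction of a full turn. -/
def turn (z : Circle) : I :=
  ⟨Int.fract (Complex.arg z / (2 * Real.pi)), Int.fract_nonneg _, (Int.fract_lt_one _).le⟩

theorem circleExp_turn (z : Circle) : Circle.exp (2 * Real.pi * turn z) = z := by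
  have h : 2 * Real.pi * (turn z : ℝ) =
      Complex.arg z + ((-⌊Complex.arg z / (2 * Real.pi)⌋ : ℤ) : ℝ) * (2 * Real.pi) := by
    have := Real.pi_ne_zero
    simp only [turn, Int.fract]
    push_cast
    field_simp
    ring
  rw [h, exp_add_int, Circle.exp_arg]

/-- A quotient map times an identity need not be a quotient map. Here `[0,1] → S¹` is proper, and
proper maps are stable under products and closed. -/
theorem isQuotientMap_circleExp (K : Type*) [TopologicalSpace K] :
    IsQuotientMap fun z : K × I × Circle => (z.1, Circle.exp (2 * Real.pi * z.2.1), z.2.2) := by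
  have hp : IsProperMap fun s : I => Circle.exp (2 * Real.pi * s) :=
    Continuous.isProperMap (by fun_prop)
  have h := (isProperMap_id (X := K)).prodMap (hp.prodMap (isProperMap_id (X := Circle)))
  refine h.isClosedMap.isQuotientMap h.continuous ?_
  rintro ⟨k, z, w⟩
  exact ⟨(k, turn z, w), by simp [Prod.map, circleExp_turn]⟩

/-- `turn` inverts `s ↦ exp (2πis)` except at `s = 1`, where it returns `0`; a function with equal
values at both ends does not notice. -/
theorem apply_turn {K Z : Type*} {f : K × I × Circle → Z}
    (h : ∀ k w, f (k, 1, w) = f (k, 0, w)) (k : K) (s : I) (w : Circle) :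
    f (k, turn (Circle.exp (2 * Real.pi * s)), w) = f (k, s, w) := by
  rcases circleExp_two_pi_eq_iff (circleExp_turn (Circle.exp (2 * Real.pi * s))) with
    h' | ⟨h', h''⟩ | ⟨h', h''⟩
  · rw [h']
  · rw [h', h'', h]
  · rw [h', h'', h]

theorem continuous_comp_turn {K Z : Type*} [TopologicalSpace K] [TopologicalSpace Z]
    {f : K × I × Circle → Z} (hf : Continuous f) (h : ∀ k w, f (k, 1, w) = f (k, 0, w)) :
    Continuous fun z : K × Circle × Circle => f (z.1, turn z.2.1, z.2.2) := by
  rw [(isQuotientMap_circleExp K).continuous_iff]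
  refine hf.congr ?_
  rintro ⟨k, s, w⟩
  exact (apply_turn h k s w).symm

/-- The bundle `π` is obtained from `B × [0, 1] × S¹` by identifying `(v, 1, w)` with
`(v, 0, w * lam v)`. -/
structure IsTwistedTorus {E B : Type} [TopologicalSpace E] [TopologicalSpace B] (π : E → B)
    (lam : B → Circle) (q : B × I × Circle → E) : Prop where
  quot : IsQuotientMap q
  proj : ∀ v s w, π (q (v, s, w)) = v
  glue : ∀ v w, q (v, 1, w) = q (v, 0, w * lam v)
  inj : ∀ v s s' w w', q (v, s, w) = q (v, s', w') →
    (s = s' ∧ w = w') ∨ (s = 1 ∧ s' = 0 ∧ w' = w * lam v) ∨ (s = 0 ∧ s' = 1 ∧ w = w' * lam v)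

namespace IsTwistedTorus

variable {E B : Type} [TopologicalSpace E] [TopologicalSpace B] {π : E → B}
  {lam : B → Circle} {q : B × I × Circle → E}

theorem continuous_proj (h : IsTwistedTorus π lam q) : Continuous π := by
  rw [h.quot.continuous_iff]
  exact continuous_fst.congr fun z => (h.proj _ _ _).symm

/-- The chart `E → B × S¹ × S¹` defined by an argument `-θ` of `lam`. -/
def chart (h : IsTwistedTorus π lam q) (θ : B → ℝ) (e : E) : B × (Circle × Circle) :=
  let p := Function.surjInv h.quot.surjective e
  (p.1, Circle.exp (2 * Real.pi * p.2.1), p.2.2 * Circle.exp (-(p.2.1 * θ p.1)))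

/-- The preimage chosen by `surjInv` may be the other of two glued points; the factor `exp (-(s θ))`
equals `lam v` at `s = 1` and `1` at `s = 0`, so the result is the same. -/
theorem chart_apply (h : IsTwistedTorus π lam q) {θ : B → ℝ} (v : B) (s : I) (w : Circle)
    (hθ : lam v = Circle.exp (-θ v)) :
    h.chart θ (q (v, s, w)) =
      (v, Circle.exp (2 * Real.pi * s), w * Circle.exp (-(s * θ v))) := by
  have hp := Function.surjInv_eq h.quot.surjective (q (v, s, w))
  rcases hp' : Function.surjInv h.quot.surjective (q (v, s, w)) with ⟨v', s', w'⟩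
  rw [hp'] at hp
  have hv : v' = v := by rw [← h.proj v' s' w', hp, h.proj]
  subst hv
  simp only [chart, hp']
  rcases h.inj _ _ _ _ _ hp with ⟨rfl, rfl⟩ | ⟨rfl, rfl, rfl⟩ | ⟨rfl, rfl, rfl⟩
  · rfl
  · simp [hθ]
  · simp [hθ]

/-- The factor `exp (s θ)` spreads the gluing rotation evenly over `[0,1]`, so that the circles
close up without a twist. -/
theorem apply_one (h : IsTwistedTorus π lam q) {v : B} {θ : ℝ} (hθ : lam v = Circle.exp (-θ))
    (w : Circle) : q (v, 1, w * Circle.exp ((1 : I) * θ)) =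
      q (v, 0, w * Circle.exp ((0 : I) * θ)) := by
  rw [h.glue, hθ]
  simp

theorem isTorusBundle (h : IsTwistedTorus π lam q) (hlam : Continuous lam) : IsTorusBundle π := by
  intro b
  -- On `U` the value `lam v` is not antipodal to `lam b`, so the principal argument of the quotient
  -- is a continuous branch.
  let U : Set B := {v | ((lam v / lam b : Circle) : ℂ) ∈ Complex.slitPlane}
  have hU : IsOpen U := Complex.isOpen_slitPlane.preimage (by fun_prop)
  have hb : b ∈ U := by simp [U]
  let θ : B → ℝ := fun v => -Complex.arg (lam v / lam b : Circle) - Complex.arg (lam b)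
  have hθ : ∀ v, lam v = Circle.exp (-θ v) := fun v => by
    rw [show -θ v = Complex.arg (lam v / lam b : Circle) + Complex.arg (lam b) by
      simp only [θ]; ring,
      Circle.exp_add, Circle.exp_arg, Circle.exp_arg, div_mul_cancel]
  have hθc : ContinuousOn θ U := by
    refine ContinuousOn.sub (ContinuousOn.neg ?_) continuousOn_const
    intro v hv
    exact ((Complex.continuousAt_arg hv).comp (f := fun v => ((lam v / lam b : Circle) : ℂ))
      (by fun_prop)).continuousWithinAt
  clear_value θ
  let inv : B × (Circle × Circle) → E :=
    fun z => q (z.1, turn z.2.1, z.2.2 * Circle.exp (turn z.2.1 * θ z.1))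
  have hright : ∀ z, h.chart θ (inv z) = z := by
    rintro ⟨v, z, w⟩
    simp only [inv]
    rw [h.chart_apply _ _ _ (hθ v), circleExp_turn, mul_assoc, ← Circle.exp_add]
    simp
  have hleft : ∀ e, inv (h.chart θ e) = e := by
    intro e
    obtain ⟨⟨v, s, w⟩, rfl⟩ := h.quot.surjective e
    rw [h.chart_apply _ _ _ (hθ v)]
    have := apply_turn (f := fun z : B × I × Circle => q (z.1, z.2.1, z.2.2 *
      Circle.exp (z.2.1 * θ z.1))) (fun v w => h.apply_one (hθ v) w) v s
      (w * Circle.exp (-(s * θ v)))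
    simp only [inv]
    refine this.trans ?_
    rw [mul_assoc, ← Circle.exp_add]
    simp
  have hfst : ∀ e, (h.chart θ e).1 = π e := by
    intro e
    obtain ⟨⟨v, s, w⟩, rfl⟩ := h.quot.surjective e
    rw [h.chart_apply _ _ _ (hθ v), h.proj]
  refine ⟨{ toFun := h.chart θ, invFun := inv, source := π ⁻¹' U, target := U ×ˢ univ,
            map_source' := ?_, map_target' := ?_, left_inv' := fun e _ => hleft e,
            right_inv' := fun z _ => hright z, continuousOn_toFun := ?_,
            continuousOn_invFun := ?_, open_source := hU.preimage h.continuous_proj,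
            open_target := hU.prod isOpen_univ, baseSet := U, open_baseSet := hU,
            source_eq := rfl, target_eq := rfl, proj_toFun := fun e _ => hfst e }, hb⟩
  · intro e he
    exact ⟨by simpa [hfst] using he, mem_univ _⟩
  · rintro ⟨v, z, w⟩ hz
    change π (q _) ∈ U
    rw [h.proj]
    exact hz.1
  · rw [h.quot.continuousOn_isOpen_iff (hU.preimage h.continuous_proj)]
    have hc : ContinuousOn (fun z : B × I × Circle => (z.1, Circle.exp (2 * Real.pi * z.2.1),
        z.2.2 * Circle.exp (-(z.2.1 * θ z.1)))) (q ⁻¹' (π ⁻¹' U)) := by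
      have h1 : ContinuousOn (fun z : B × I × Circle => θ z.1) (q ⁻¹' (π ⁻¹' U)) := by
        refine hθc.comp continuousOn_fst ?_
        rintro ⟨v, s, w⟩ hz
        simpa [h.proj] using hz
      have h2 : ContinuousOn (fun z : B × I × Circle => Circle.exp (-(z.2.1 * θ z.1)))
          (q ⁻¹' (π ⁻¹' U)) := by
        refine Circle.exp.continuous.comp_continuousOn ?_
        exact ((by fun_prop : Continuous fun z : B × I × Circle => (z.2.1 : ℝ)).continuousOn.mul
          h1).neg
      refine continuousOn_fst.prodMk (ContinuousOn.prodMk (by fun_prop) ?_)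
      exact (by fun_prop : Continuous fun z : B × I × Circle => z.2.2).continuousOn.mul h2
    refine hc.congr ?_
    rintro ⟨v, s, w⟩ -
    exact h.chart_apply _ _ _ (hθ v)
  · have hUc : Continuous fun v : U => θ v := hθc.domRestrict
    have hUc' : Continuous fun z : U × I × Circle => Circle.exp (z.2.1 * θ z.1) :=
      Circle.exp.continuous.comp ((by fun_prop : Continuous fun z : U × I × Circle =>
        (z.2.1 : ℝ)).mul (hUc.comp continuous_fst))
    have := continuous_comp_turn (f := fun z : U × I × Circle => q (z.1, z.2.1, z.2.2 *
      Circle.exp (z.2.1 * θ z.1))) (h.quot.continuous.comp (by fun_prop))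
      (fun v w => h.apply_one (hθ v) w)
    rw [continuousOn_iff_continuous_domRestrict]
    exact this.comp (f := fun z : (U ×ˢ univ : Set (B × Circle × Circle)) =>
      ((⟨z.1.1, z.2.1⟩, z.1.2) : U × Circle × Circle)) (by fun_prop)

end IsTwistedTorus

/-- Points of different fibres are separated in the base, points of one fibre in a common chart. For
the quotient `T_m` this makes the compact-to-Hausdorff argument of `exists_frame` available. -/
theorem IsTorusBundle.t2Space {E B : Type} [TopologicalSpace E] [TopologicalSpace B] [T2Space B]
    {π : E → B} (hc : Continuous π) (h : IsTorusBundle π) : T2Space E := by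
  refine ⟨fun x y hxy => ?_⟩
  by_cases hπ : π x = π y
  · obtain ⟨e, he⟩ := h (π x)
    have hx : x ∈ e.source := e.mem_source.2 he
    have hy : y ∈ e.source := e.mem_source.2 (hπ ▸ he)
    obtain ⟨U, V, hU, hV, hxU, hyV, hd⟩ := t2_separation (e.injOn.ne hx hy hxy)
    refine ⟨_, _, e.isOpen_inter_preimage hU, e.isOpen_inter_preimage hV, ⟨hx, hxU⟩, ⟨hy, hyV⟩, ?_⟩
    exact (hd.preimage e).mono inter_subset_right inter_subset_right
  · exact separated_by_continuous hc hπ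

/-! ### Monodromy of a twisted torus bundle. -/

namespace IsTwistedTorus

variable {E B : Type} [TopologicalSpace E] [TopologicalSpace B] {π : E → B}
  {lam : B → Circle} {q : B × I × Circle → E}

/-- The trivialization along the path `γ` defined by an argument `-θ` of `lam`. -/
def frame (q : B × I × Circle → E) {b b' : B} (γ : Path b b') (θ : I → ℝ)
    (z : I × Circle × Circle) : E :=
  q (γ z.1, turn z.2.1, z.2.2 * Circle.exp (turn z.2.1 * θ z.1))

/-- An argument of `lam` exists along all of a path, so the untwisting that defines the local charts
trivializes the whole pullback to `[0,1]`. It is a continuous bijection from a compact to a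
Hausdorff space. -/
theorem exists_frame (h : IsTwistedTorus π lam q) [T2Space E] {b : B} (γ : Path b b)
    {θ : I → ℝ} (hθ : Continuous θ) (hlam : ∀ t, lam (γ t) = Circle.exp (-θ t)) :
    ∃ N : I × Circle × Circle ≃ₜ {p : I × E // π p.2 = γ p.1}, ∀ (t s : I) (w : Circle),
      (N.symm ⟨(t, q (γ t, s, w)), h.proj _ _ _⟩) =
        (t, Circle.exp (2 * Real.pi * s), w * Circle.exp (-(s * θ t))) := by
  have hc : Continuous (frame q γ θ) :=
    continuous_comp_turn (f := fun z : I × I × Circle => q (γ z.1, z.2.1, z.2.2 *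
      Circle.exp (z.2.1 * θ z.1))) (h.quot.continuous.comp (by fun_prop))
      (fun t w => h.apply_one (hlam t) w)
  let N : I × Circle × Circle → {p : I × E // π p.2 = γ p.1} :=
    fun z => ⟨(z.1, frame q γ θ z), h.proj _ _ _⟩
  have key : ∀ (t s : I) (w : Circle), N (t, Circle.exp (2 * Real.pi * s), w * Circle.exp (-(s * θ t))) =
      ⟨(t, q (γ t, s, w)), h.proj _ _ _⟩ := by
    intro t s w
    refine Subtype.ext (Prod.ext rfl ?_)
    have := apply_turn (f := fun z : I × I × Circle => q (γ z.1, z.2.1, z.2.2 *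
      Circle.exp (z.2.1 * θ z.1))) (fun t w => h.apply_one (hlam t) w) t s
      (w * Circle.exp (-(s * θ t)))
    refine this.trans ?_
    rw [mul_assoc, ← Circle.exp_add]
    simp
  have hinj : Function.Injective N := by
    rintro ⟨t, z, w⟩ ⟨t', z', w'⟩ hN
    have h1 : t = t' := congr_arg (fun p => p.1.1) hN
    subst h1
    have h2 : frame q γ θ (t, z, w) = frame q γ θ (t, z', w') := congr_arg (fun p => p.1.2) hN
    have e : ∀ z w, (z, w) = (Circle.exp (2 * Real.pi * turn z),
        (w * Circle.exp (turn z * θ t)) * Circle.exp (-(turn z * θ t))) := fun z w => by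
      rw [circleExp_turn, mul_assoc, ← Circle.exp_add]
      simp
    refine Prod.ext rfl ?_
    simp only
    rw [e z w, e z' w']
    rcases h.inj _ _ _ _ _ h2 with ⟨h3, h4⟩ | ⟨h3, h4, h5⟩ | ⟨h3, h4, h5⟩
    · simp only at h3 h4
      rw [h4, h3]
    · simp only at h3 h4 h5
      rw [h5, h3, h4, hlam]
      simp
    · simp only at h3 h4 h5
      rw [h5, h3, h4, hlam]
      simp
  have hsurj : Function.Surjective N := by
    rintro ⟨⟨t, e⟩, he⟩
    obtain ⟨⟨v, s, w⟩, rfl⟩ := h.quot.surjective e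
    have hv : v = γ t := by simpa [h.proj] using he
    subst hv
    exact ⟨_, key t s w⟩
  have hNc : Continuous (Equiv.ofBijective N ⟨hinj, hsurj⟩) :=
    (continuous_fst.prodMk hc).subtype_mk _
  refine ⟨hNc.homeoOfEquivCompactToT2, fun t s w => ?_⟩
  rw [Homeomorph.symm_apply_eq]
  exact (key t s w).symm

/-- The shear `(i, j) ↦ (i, j + i)`. -/
def shear : ℤ × ℤ ≃+ ℤ × ℤ where
  toFun z := (z.1, z.2 + z.1)
  invFun z := (z.1, z.2 - z.1)
  left_inv z := by simp
  right_inv z := by simp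
  map_add' z z' := by ext <;> simp; ring

/-- In the frame, any transport moves a loop by a free homotopy and keeps its degrees. The frames at
the two ends of `γ` are coordinates on the same fibre and differ by `(z, w) ↦ (z, w z)`, since `θ`
gains `2π`; this is the shear on degrees. -/
theorem exists_monodromy (h : IsTwistedTorus π lam q) [T2Space E] {b : B} (γ : Path b b)
    {θ : I → ℝ} (hθ : Continuous θ) (hlam : ∀ t, lam (γ t) = Circle.exp (-θ t))
    (h1 : θ 1 = θ 0 + 2 * Real.pi) (x : π ⁻¹' {b}) :
    ∃ u : (π ⁻¹' {b}) ≃ₜ Circle × Circle,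
      (∀ s w, u ⟨q (b, s, w), h.proj _ _ _⟩ =
        (Circle.exp (2 * Real.pi * s), w * Circle.exp (-(s * θ 0)))) ∧
      ∃ M : H1 (π ⁻¹' {b}) x ≃+ H1 (π ⁻¹' {b}) x, (∀ M', IsMonodromy π γ x M' ↔ M' = M) ∧
        ∀ g, degreesH1 u x (M g) = shear (degreesH1 u x g) := by
  obtain ⟨N, hN⟩ := h.exists_frame γ hθ hlam
  have hfib : ∀ (x : π ⁻¹' {b}), π x = γ 0 := fun x => by
    rw [γ.source]; exact x.2
  have hN1 : ∀ z, (N z).1.1 = z.1 := by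
    intro z
    obtain ⟨⟨⟨t, e⟩, he⟩, rfl⟩ := N.symm.surjective z
    obtain ⟨⟨v, s, w⟩, rfl⟩ := h.quot.surjective e
    have hv : v = γ t := by simpa [h.proj] using he
    subst hv
    rw [N.apply_symm_apply, hN]
  have hNs1 : ∀ p, (N.symm p).1 = p.1.1 := fun p => by
    rw [← hN1, N.apply_symm_apply]
  let u : (π ⁻¹' {b}) ≃ₜ Circle × Circle :=
    { toFun := fun x => (N.symm ⟨(0, x), hfib x⟩).2
      invFun := fun z => ⟨(N (0, z)).1.2, by
        have := (N (0, z)).2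
        rw [hN1] at this
        simpa using this⟩
      left_inv := fun x => by
        refine Subtype.ext ?_
        have h2 : ((0 : I), (N.symm ⟨(0, x), hfib x⟩).2) = N.symm ⟨(0, x), hfib x⟩ :=
          Prod.ext (hNs1 ⟨(0, x), hfib x⟩).symm rfl
        simp only [h2, N.apply_symm_apply]
      right_inv := fun z => by
        have h2 : (⟨(0, (N (0, z)).1.2), by
            have := (N (0, z)).2
            rwa [hN1] at this⟩ : {p : I × E // π p.2 = γ p.1}) = N (0, z) :=
          Subtype.ext (Prod.ext (hN1 (0, z)).symm rfl)
        simp only [h2, N.symm_apply_apply]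
      continuous_toFun := by fun_prop
      continuous_invFun := by fun_prop }
  have hu : ∀ s w, u ⟨q (b, s, w), h.proj _ _ _⟩ =
        (Circle.exp (2 * Real.pi * s), w * Circle.exp (-(s * θ 0))) := by
    intro s w
    have := congr_arg Prod.snd (hN 0 s w)
    simpa [u] using this
  -- Because `θ 1 = θ 0 + 2π`, the factors `exp (-(s θ 0))` and `exp (-(s θ 1))` differ by `exp
  -- (2πs)`, the first circle coordinate.
  have hu1 : ∀ (y : π ⁻¹' {b}) (hy : π y = γ 1), u y = ((N.symm ⟨(1, y), hy⟩).2.1,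
      (N.symm ⟨(1, y), hy⟩).2.2 * (N.symm ⟨(1, y), hy⟩).2.1) := by
    rintro ⟨e, he⟩ hy
    obtain ⟨⟨v, s, w⟩, rfl⟩ := h.quot.surjective e
    have hv : v = b := by simpa [h.proj] using he
    subst hv
    have e1 := hN 1 s w
    simp only [γ.target] at e1
    rw [hu, e1]
    simp only [mul_assoc, ← Circle.exp_add, h1]
    ring_nf
  -- the action of the return map of any transport
  have hR : ∀ (Ψ : FibreTransport π γ) {y : π ⁻¹' {b}} (c : Path y y),
      degrees u (c.map Ψ.returnMap.continuous) = shear (degrees u c) := by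
    intro Ψ y c
    let K : I × I → Circle × Circle :=
      fun z => (N.symm ⟨(z.1, Ψ.toFun z.1 (c z.2)), Ψ.mem_fibre _ _⟩).2
    have hK : Continuous K := by
      have hΨ : Continuous fun z : I × I => Ψ.toFun z.1 (c z.2) :=
        Ψ.continuous_uncurry.comp (g := Function.uncurry Ψ.toFun)
          (f := fun z : I × I => (z.1, c z.2)) (by fun_prop)
      fun_prop
    have hK0 : ∀ s, K (0, s) = u (c s) := fun s => by
      simp only [K, u, Ψ.start]
      rfl
    have hK1 : ∀ s, u (c.map Ψ.returnMap.continuous s) = ((K (1, s)).1, (K (1, s)).2 *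
        (K (1, s)).1) := fun s => hu1 (Ψ.returnMap (c s)) (Ψ.mem_fibre 1 (c s))
    have hl : ∀ t, K (t, 0) = K (t, 1) := fun t => by simp [K]
    have a1 := HasAngle.homotopy (K := fun z => (K z).1) (by fun_prop) (fun t => by rw [hl])
      (by simpa only [hK0] using hasAngle_fst u c)
    have a2 := HasAngle.homotopy (K := fun z => (K z).2) (by fun_prop) (fun t => by rw [hl])
      (by simpa only [hK0] using hasAngle_snd u c)
    have a3 := a2.mul a1
    rw [← add_mul, ← Int.cast_add] at a3
    refine Prod.ext ?_ ?_
    · refine HasAngle.degree_eq ?_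
      simpa only [hK1] using! a1
    · refine HasAngle.degree_eq ?_
      simpa only [hK1] using! a3
  let M : H1 (π ⁻¹' {b}) x ≃+ H1 (π ⁻¹' {b}) x :=
    ((degreesEquiv u x).trans shear).trans (degreesEquiv u x).symm
  have hM : ∀ g, degreesH1 u x (M g) = shear (degreesH1 u x g) :=
    fun g => (degreesEquiv u x).apply_symm_apply _
  refine ⟨u, hu, M, fun M' => ⟨?_, ?_⟩, hM⟩
  · rintro ⟨Ψ, α, hΨ⟩
    refine AddEquiv.ext fun g => degreesH1_injective u x ?_
    obtain ⟨c, rfl⟩ := exists_loopClass x g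
    rw [← loopClass_refl, hΨ, hM, degreesH1_loopClass, degreesH1_loopClass, hR]
  · rintro rfl
    have hmem : ∀ t (y : π ⁻¹' {b}), (N (t, u y)).1.2 ∈ π ⁻¹' {γ t} := fun t y => by
      have := (N (t, u y)).2
      rw [hN1] at this
      exact this
    -- Existence: the frame itself, started from its identification `u` at time `0`, is a transport.
    let Ψ : FibreTransport π γ :=
      { toFun := fun t y => (N (t, u y)).1.2
        continuous_uncurry := by
          change Continuous fun z : I × (π ⁻¹' {b}) => (N (z.1, u z.2)).1.2
          fun_prop
        mem_fibre := hmem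
        isHomeomorph := fun t => by
          have : CompactSpace (π ⁻¹' {b}) := u.symm.compactSpace
          rw [isHomeomorph_iff_continuous_bijective]
          refine ⟨by fun_prop, fun y y' hy => ?_, fun e => ?_⟩
          · have e1 : N (t, u y) = N (t, u y') := Subtype.ext
              (Prod.ext (by rw [hN1, hN1]) (congr_arg Subtype.val hy))
            have e2 : (t, u y) = (t, u y') := N.injective e1
            exact u.injective (Prod.mk.inj e2).2
          · refine ⟨u.symm (N.symm ⟨(t, e), e.2⟩).2, Subtype.ext ?_⟩
            have e1 : (t, (N.symm ⟨(t, e), e.2⟩).2) = N.symm ⟨(t, e), e.2⟩ :=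
              Prod.ext (hNs1 ⟨(t, e), e.2⟩).symm rfl
            simp only [u.apply_symm_apply, e1, N.apply_symm_apply]
        start := fun y => congr_arg Subtype.val (u.symm_apply_apply y) }
    have : PathConnectedSpace Circle := by
      rw [pathConnectedSpace_iff_univ, ← (Circle.exp_surjective).range_eq]
      exact isPathConnected_range Circle.exp.continuous
    have : PathConnectedSpace (π ⁻¹' {b}) := by
      rw [pathConnectedSpace_iff_univ, ← u.symm.surjective.range_eq]
      exact isPathConnected_range u.symm.continuous
    refine ⟨Ψ, PathConnectedSpace.somePath _ _, fun c => degreesH1_injective u x ?_⟩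
    rw [hM, degreesH1_loopClass, degreesH1_loopClass, hR]

end IsTwistedTorus

/-! ### Coordinates adapted to both flows -/

open ComplexConjugate in
/-- The coordinate which is expanded by the flow of `X_H`. -/
def unst (x : Phase) : ℂ := x.1 - Complex.I * conj x.2

open ComplexConjugate in
/-- The coordinate which is contracted by the flow of `X_H`. -/
def stab (x : Phase) : ℂ := x.1 + Complex.I * conj x.2

open ComplexConjugate in
/-- The point with given expanded and contracted coordinates. -/
def ofCoord (a b : ℂ) : Phase := ((a + b) / 2, -Complex.I * conj (a - b) / 2)

/-- The value `(h, j)` as the complex number `j + i h`. -/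
def val (v : ℝ × ℝ) : ℂ := v.2 + v.1 * Complex.I

@[fun_prop] theorem continuous_unst : Continuous unst := by unfold unst; fun_prop

@[fun_prop] theorem continuous_stab : Continuous stab := by unfold stab; fun_prop

@[fun_prop] theorem continuous_val : Continuous val := by unfold val; fun_prop

theorem continuous_ofCoord : Continuous fun z : ℂ × ℂ => ofCoord z.1 z.2 := by
  unfold ofCoord; fun_prop

theorem continuous_F : Continuous F := by unfold F H J; fun_prop

theorem unst_ofCoord (a b : ℂ) : unst (ofCoord a b) = a := by
  simp only [unst, ofCoord, map_div₀, map_mul, map_neg, Complex.conj_I, Complex.conj_conj,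
    map_ofNat]
  linear_combination -((a - b) / 2) * Complex.I_mul_I

theorem stab_ofCoord (a b : ℂ) : stab (ofCoord a b) = b := by
  simp only [stab, ofCoord, map_div₀, map_mul, map_neg, Complex.conj_I, Complex.conj_conj,
    map_ofNat]
  linear_combination ((a - b) / 2) * Complex.I_mul_I

theorem fst_eq (x : Phase) : x.1 = (unst x + stab x) / 2 := by
  simp only [unst, stab]; ring

theorem ofCoord_unst_stab (x : Phase) : ofCoord (unst x) (stab x) = x := by
  refine Prod.ext (fst_eq x).symm ?_
  simp only [unst, stab, ofCoord, map_sub, map_add, map_mul, Complex.conj_I, Complex.conj_conj]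
  linear_combination -x.2 * Complex.I_mul_I

theorem ext_coord {x y : Phase} (h : unst x = unst y) (h' : stab x = stab y) : x = y := by
  rw [← ofCoord_unst_stab x, h, h', ofCoord_unst_stab]

theorem unst_flowH (t : ℝ) (x : Phase) : unst (flowH t x) = Real.exp t * unst x := by
  simp only [unst, flowH, map_sub, map_mul, Complex.conj_I, Complex.conj_conj,
    Complex.conj_ofReal, ← Real.cosh_add_sinh t, Complex.ofReal_add]
  linear_combination -(Real.sinh t : ℂ) * x.1 * Complex.I_mul_I

theorem stab_flowH (t : ℝ) (x : Phase) : stab (flowH t x) = Real.exp (-t) * stab x := by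
  simp only [stab, flowH, map_sub, map_mul, Complex.conj_I, Complex.conj_conj,
    Complex.conj_ofReal, ← Real.cosh_sub_sinh t, Complex.ofReal_sub]
  linear_combination (Real.sinh t : ℂ) * x.1 * Complex.I_mul_I

theorem conj_exp_mul_I (u : ℝ) : (starRingEnd ℂ) (Complex.exp (u * Complex.I)) =
    Complex.exp (-(u * Complex.I)) := by
  rw [← Complex.exp_conj]; simp

theorem unst_flowJ (u : ℝ) (x : Phase) :
    unst (flowJ u x) = Complex.exp (-(u * Complex.I)) * unst x := by
  simp only [unst, flowJ, map_mul, conj_exp_mul_I]; ring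

theorem stab_flowJ (u : ℝ) (x : Phase) :
    stab (flowJ u x) = Complex.exp (-(u * Complex.I)) * stab x := by
  simp only [stab, flowJ, map_mul, conj_exp_mul_I]; ring

/-- This identity turns `F` into a product of two complex numbers: a fibre with `F ≠ 0` is
parametrized by `a ≠ 0` alone, and the singular fibre is the union of `a = 0` and `b = 0`. -/
theorem unst_mul_conj_stab (x : Phase) :
    unst x * (starRingEnd ℂ) (stab x) = 2 * (starRingEnd ℂ) (val (F x)) := by
  apply Complex.ext <;>
    simp only [unst, stab, val, F, Complex.conj_re, Complex.conj_im, Complex.add_re, Complex.add_im,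
      Complex.sub_re, Complex.sub_im, Complex.mul_re, Complex.mul_im, Complex.ofReal_re,
      Complex.ofReal_im, Complex.I_re, Complex.I_im, Complex.re_ofNat, Complex.im_ofNat, H, J] <;>
    ring

theorem val_injective : Function.Injective val := by
  intro v w h
  have h1 := congr_arg Complex.re h
  have h2 := congr_arg Complex.im h
  simp [val] at h1 h2
  exact Prod.ext h2 h1

theorem F_eq_of_coord {x : Phase} {v : ℝ × ℝ}
    (h : unst x * (starRingEnd ℂ) (stab x) = 2 * (starRingEnd ℂ) (val v)) : F x = v := by
  rw [unst_mul_conj_stab] at h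
  exact val_injective ((starRingEnd ℂ).injective (mul_left_cancel₀ two_ne_zero h))

theorem norm_unst_mul_norm_stab (x : Phase) : ‖unst x‖ * ‖stab x‖ = 2 * ‖val (F x)‖ := by
  simpa using congr_arg norm (unst_mul_conj_stab x)

theorem F_flowH (t : ℝ) (x : Phase) : F (flowH t x) = F x := by
  refine F_eq_of_coord ?_
  rw [unst_flowH, stab_flowH, ← unst_mul_conj_stab, map_mul, Complex.conj_ofReal, Real.exp_neg,
    Complex.ofReal_inv]
  have : (Real.exp t : ℂ) ≠ 0 := by exact_mod_cast (Real.exp_pos t).ne'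
  field_simp

theorem val_zero : val 0 = 0 := by simp [val]

theorem val_F_eq_zero_of_unst {x : Phase} (h : unst x = 0) : F x = 0 :=
  F_eq_of_coord (by simp [h, val])

theorem val_F_eq_zero_of_stab {x : Phase} (h : stab x = 0) : F x = 0 :=
  F_eq_of_coord (by simp [h, val])

theorem unst_ne_zero {x : Phase} (h : F x ≠ 0) : unst x ≠ 0 := mt val_F_eq_zero_of_unst h

theorem stab_ne_zero {x : Phase} (h : F x ≠ 0) : stab x ≠ 0 := mt val_F_eq_zero_of_stab h

theorem val_ne_zero {v : ℝ × ℝ} (h : v ≠ 0) : val v ≠ 0 := fun h' =>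
  h (val_injective (h'.trans val_zero.symm))

/-! ### Orbits of the circle action -/

theorem norm_exp_neg_mul_I (u : ℝ) : ‖Complex.exp (-(u * Complex.I))‖ = 1 := by
  rw [← neg_mul, ← Complex.ofReal_neg, Complex.norm_exp_ofReal_mul_I]

theorem norm_unst_flowJ (u : ℝ) (x : Phase) : ‖unst (flowJ u x)‖ = ‖unst x‖ := by
  rw [unst_flowJ, norm_mul, norm_exp_neg_mul_I, one_mul]

theorem norm_stab_flowJ (u : ℝ) (x : Phase) : ‖stab (flowJ u x)‖ = ‖stab x‖ := by
  rw [stab_flowJ, norm_mul, norm_exp_neg_mul_I, one_mul]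

theorem exists_exp_mul {z w : ℂ} (h : ‖z‖ = ‖w‖) :
    ∃ u : ℝ, w = Complex.exp (-(u * Complex.I)) * z := by
  by_cases hz : z = 0
  · subst hz
    exact ⟨0, by simpa using h.symm⟩
  · refine ⟨-Complex.arg (w / z), ?_⟩
    have h1 := Complex.norm_mul_exp_arg_mul_I (w / z)
    rw [norm_div, h, div_self (by rw [← h]; exact norm_ne_zero_iff.2 hz), Complex.ofReal_one,
      one_mul] at h1
    rw [Complex.ofReal_neg, neg_mul, neg_neg, h1, div_mul_cancel₀ _ hz]

/-- Rotate until the `a` coordinates agree; a nonzero `a` together with the value of `a b̄`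
determines `b`. -/
theorem exists_flowJ_of_unst {x y : Phase} (hF : F x = F y) (hx : unst x ≠ 0)
    (h : ‖unst x‖ = ‖unst y‖) : ∃ u : ℝ, y = flowJ u x := by
  obtain ⟨u, hu⟩ := exists_exp_mul h
  have h1 : unst (flowJ u x) = unst y := by rw [unst_flowJ, hu]
  refine ⟨u, ext_coord h1.symm ?_⟩
  have h2 := (unst_mul_conj_stab y).trans
    (((F_flowJ u x).trans hF) ▸ (unst_mul_conj_stab (flowJ u x))).symm
  rw [h1] at h2
  have hy : unst y ≠ 0 := by rw [← norm_ne_zero_iff, ← h]; exact norm_ne_zero_iff.2 hx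
  exact (starRingEnd ℂ).injective (mul_left_cancel₀ hy h2)

theorem exists_flowJ_of_stab {x y : Phase} (hF : F x = F y) (hx : stab x ≠ 0)
    (h : ‖stab x‖ = ‖stab y‖) : ∃ u : ℝ, y = flowJ u x := by
  obtain ⟨u, hu⟩ := exists_exp_mul h
  have h1 : stab (flowJ u x) = stab y := by rw [stab_flowJ, hu]
  refine ⟨u, ext_coord ?_ h1.symm⟩
  have h2 := (unst_mul_conj_stab y).trans
    (((F_flowJ u x).trans hF) ▸ (unst_mul_conj_stab (flowJ u x))).symm
  rw [h1] at h2
  have hy : stab y ≠ 0 := by rw [← norm_ne_zero_iff, ← h]; exact norm_ne_zero_iff.2 hx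
  exact mul_right_cancel₀ ((map_ne_zero _).2 hy) h2

/-- The function which together with `F` parametrizes the reduced space; it is non-decreasing along
the flow of `X_H`. -/
def rise (x : Phase) : ℝ := (‖unst x‖ ^ 2 - ‖stab x‖ ^ 2) / 4

theorem continuous_rise : Continuous rise := by unfold rise; fun_prop

theorem rise_flowJ (u : ℝ) (x : Phase) : rise (flowJ u x) = rise x := by
  simp only [rise, norm_unst_flowJ, norm_stab_flowJ]

theorem rise_le_flowH {t : ℝ} (ht : 0 ≤ t) (x : Phase) : rise x ≤ rise (flowH t x) := by
  simp only [rise, unst_flowH, stab_flowH, norm_mul, Complex.norm_real, Real.norm_eq_abs,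
    Real.abs_exp]
  have h1 : ‖unst x‖ ≤ Real.exp t * ‖unst x‖ :=
    le_mul_of_one_le_left (norm_nonneg _) (Real.one_le_exp ht)
  have h2 : Real.exp (-t) * ‖stab x‖ ≤ ‖stab x‖ :=
    mul_le_of_le_one_left (norm_nonneg _) (Real.exp_le_one_iff.2 (by linarith))
  have h3 := pow_le_pow_left₀ (norm_nonneg _) h1 2
  have h4 := pow_le_pow_left₀ (by positivity) h2 2
  linarith

/-- This is `(A + B)² = (A - B)² + 4AB` for `A = |a|²`, `B = |b|²`. It shows that `F` and `rise`
determine both moduli, and bounds them. -/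
theorem sq_norm_add_sq_norm (x : Phase) : (‖unst x‖ ^ 2 + ‖stab x‖ ^ 2) ^ 2 =
    16 * (rise x ^ 2 + ‖val (F x)‖ ^ 2) := by
  have h := norm_unst_mul_norm_stab x
  have h2 : ‖val (F x)‖ = ‖unst x‖ * ‖stab x‖ / 2 := by rw [h]; ring
  rw [h2, rise]
  ring

theorem exists_flowJ {x y : Phase} (hF : F x = F y) (hr : rise x = rise y) :
    ∃ u : ℝ, y = flowJ u x := by
  have h1 : ‖unst x‖ ^ 2 + ‖stab x‖ ^ 2 = ‖unst y‖ ^ 2 + ‖stab y‖ ^ 2 := by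
    have h := sq_norm_add_sq_norm x
    rw [hF, hr, ← sq_norm_add_sq_norm y] at h
    exact (pow_left_inj₀ (by positivity) (by positivity) two_ne_zero).1 h
  have h2 : ‖unst x‖ ^ 2 - ‖stab x‖ ^ 2 = ‖unst y‖ ^ 2 - ‖stab y‖ ^ 2 := by
    simp only [rise] at hr
    linarith
  have h3 : ‖unst x‖ = ‖unst y‖ := (pow_left_inj₀ (norm_nonneg _) (norm_nonneg _) two_ne_zero).1
    (by linarith)
  have h4 : ‖stab x‖ = ‖stab y‖ := (pow_left_inj₀ (norm_nonneg _) (norm_nonneg _) two_ne_zero).1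
    (by linarith)
  by_cases hx : unst x = 0
  · by_cases hx' : stab x = 0
    · refine ⟨0, ?_⟩
      rw [flowJ_zero]
      refine ext_coord ?_ ?_
      · rw [hx]; simpa [hx] using h3.symm
      · rw [hx']; simpa [hx'] using h4.symm
    · exact exists_flowJ_of_stab hF hx' h4
  · exact exists_flowJ_of_unst hF hx h3

/-! ### The reduced space is a product. -/

theorem exists_F_rise (v : ℝ × ℝ) (y : ℝ) : ∃ x : Phase, F x = v ∧ rise x = y := by
  set R := Real.sqrt (y ^ 2 + ‖val v‖ ^ 2) with hR
  have hR2 : R ^ 2 = y ^ 2 + ‖val v‖ ^ 2 := Real.sq_sqrt (by positivity)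
  have hyR : |y| ≤ R := Real.abs_le_sqrt (by nlinarith [sq_nonneg ‖val v‖])
  have hy1 := abs_le.1 hyR
  -- From `|a|² - |b|² = 4y` and `|a|² + |b|² = 4R` one gets `|a|² = 2(y + R)`; the circle action
  -- allows `a = α` to be real. If `α = 0` then `val v = 0`, and a point with `a = 0` is taken.
  set α := Real.sqrt (2 * (y + R)) with hα
  have hα2 : α ^ 2 = 2 * (y + R) := Real.sq_sqrt (by linarith)
  by_cases h0 : α = 0
  · have hyR0 : R = -y := by rw [h0] at hα2; linarith
    have hv : val v = 0 := by
      rw [hyR0, neg_sq] at hR2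
      have : ‖val v‖ ^ 2 = 0 := by linarith
      simpa using this
    refine ⟨ofCoord 0 (Real.sqrt (-4 * y) : ℝ), F_eq_of_coord ?_, ?_⟩
    · simp [unst_ofCoord, hv]
    · have h5 : Real.sqrt (-4 * y) ^ 2 = -4 * y := Real.sq_sqrt (by linarith)
      rw [rise, unst_ofCoord, stab_ofCoord, Complex.norm_real, Real.norm_eq_abs, sq_abs, h5]
      simp
  · have hα0 : (α : ℂ) ≠ 0 := by exact_mod_cast h0
    refine ⟨ofCoord α (2 * val v / α), F_eq_of_coord ?_, ?_⟩
    · rw [unst_ofCoord, stab_ofCoord]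
      simp only [map_div₀, map_mul, Complex.conj_ofReal, map_ofNat]
      field_simp
    · rw [rise, unst_ofCoord, stab_ofCoord]
      simp only [norm_div, norm_mul, Complex.norm_real, Real.norm_eq_abs, div_pow, mul_pow, sq_abs,
        Complex.norm_ofNat]
      have h6 : ‖val v‖ ^ 2 = R ^ 2 - y ^ 2 := by linarith
      have hs : y + R ≠ 0 := fun h => h0 (by
        rw [h, mul_zero] at hα2
        exact pow_eq_zero_iff two_ne_zero |>.1 hα2)
      rw [hα2, h6]
      field_simp
      ring

/-- By `sq_norm_add_sq_norm` bounds on `F` and `rise` bound `|a|` and `|b|`. -/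
theorem isProperMap_F_rise : IsProperMap fun x : Phase => (F x, rise x) := by
  have hc : Continuous fun x : Phase => (F x, rise x) := continuous_F.prodMk continuous_rise
  rw [isProperMap_iff_isCompact_preimage]
  refine ⟨hc, fun K hK => ?_⟩
  obtain ⟨R, hR⟩ := hK.isBounded.exists_norm_le
  have hv : Bornology.IsBounded (val '' (Prod.fst '' K)) :=
    ((hK.image continuous_fst).image continuous_val).isBounded
  obtain ⟨R', hR'⟩ := hv.exists_norm_le
  refine Metric.isCompact_of_isClosed_isBounded (hK.isClosed.preimage hc) ?_
  refine isBounded_iff_forall_norm_le.2 ⟨1 + 4 * (|R| + |R'|), fun x hx => ?_⟩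
  have h1 : |rise x| ≤ |R| := (norm_snd_le (F x, rise x)).trans ((hR _ hx).trans (le_abs_self _))
  have h2 : ‖val (F x)‖ ≤ |R'| :=
    (hR' _ ⟨F x, ⟨_, hx, rfl⟩, rfl⟩).trans (le_abs_self _)
  have h3 : ‖unst x‖ ^ 2 + ‖stab x‖ ^ 2 ≤ 4 * (|R| + |R'|) := by
    refine abs_le_of_sq_le_sq' ?_ (by positivity) |>.2
    rw [sq_norm_add_sq_norm, ← sq_abs (rise x)]
    nlinarith [abs_nonneg (rise x), norm_nonneg (val (F x)), abs_nonneg R, abs_nonneg R']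
  have h4 : ‖unst x‖ + ‖stab x‖ ≤ 1 + 4 * (|R| + |R'|) + 1 := by
    nlinarith [sq_nonneg (‖unst x‖ - 1), sq_nonneg (‖stab x‖ - 1)]
  have h5 : ‖unst x‖ + ‖stab x‖ ≤ 2 * (1 + 4 * (|R| + |R'|)) := by
    nlinarith [abs_nonneg R, abs_nonneg R']
  rw [← ofCoord_unst_stab x]
  refine norm_prod_le_iff.2 ⟨?_, ?_⟩
  · simp only [ofCoord, norm_div, Complex.norm_ofNat]
    have := norm_add_le (unst x) (stab x)
    linarith
  · simp only [ofCoord, norm_div, norm_mul, norm_neg, Complex.norm_I, RCLike.norm_conj,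
      Complex.norm_ofNat, one_mul]
    have := norm_sub_le (unst x) (stab x)
    linarith

/-- `(F, rise)` separates the circle orbits and takes all values; being proper, also over the closed
set `D`, it induces a closed continuous bijection of the quotient. -/
theorem nonempty_reducedTriv {D : Set (ℝ × ℝ)} (hD : IsClosed D) : Nonempty (ReducedTriv D) := by
  let φ : Over D → D × ℝ := fun x => (x.base, rise x.1)
  have hφ : Continuous φ := by
    refine Continuous.prodMk ?_ (continuous_rise.comp continuous_subtype_val)
    exact (continuous_F.comp continuous_subtype_val).subtype_mk _
  have hp : IsProperMap φ := by
    refine isProperMap_of_comp_of_inj (g := fun z : D × ℝ => ((z.1 : ℝ × ℝ), z.2)) hφ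
      (by fun_prop) ?_ ?_
    · exact isProperMap_F_rise.comp (hD.preimage continuous_F).isClosedEmbedding_subtypeVal.isProperMap
    · rintro ⟨v, y⟩ ⟨w, z⟩ h
      simp only [Prod.mk.injEq] at h
      exact Prod.ext (Subtype.ext h.1) h.2
  let f : Reduced D → D × ℝ := Quotient.lift φ (by
    rintro x y ⟨u, hu⟩
    exact Prod.ext (base_eq_of_flowJ hu).symm (by simp only [φ, hu, rise_flowJ]))
  have hf : Continuous f := hφ.quotient_lift _
  have hinj : Function.Injective f := by
    intro x y h
    induction x using Quotient.inductionOn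
    induction y using Quotient.inductionOn
    rename_i x y
    have h1 : F x.1 = F y.1 := congr_arg (fun z => (z.1 : ℝ × ℝ)) h
    have h2 : rise x.1 = rise y.1 := congr_arg (fun z => z.2) h
    exact Quotient.sound (exists_flowJ h1 h2)
  have hsurj : Function.Surjective f := by
    rintro ⟨v, y⟩
    obtain ⟨x, hx, hy⟩ := exists_F_rise v y
    exact ⟨reduction ⟨x, hx ▸ v.2⟩, Prod.ext (Subtype.ext hx) hy⟩
  have hcl : IsClosedMap f := by
    intro C hC
    have : f '' C = φ '' (Quotient.mk (orbitSetoid D) ⁻¹' C) := by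
      ext z
      constructor
      · rintro ⟨x, hx, rfl⟩
        induction x using Quotient.inductionOn
        exact ⟨_, hx, rfl⟩
      · rintro ⟨x, hx, rfl⟩
        exact ⟨_, hx, rfl⟩
    rw [this]
    exact hp.isClosedMap _ (hC.preimage continuous_quotient_mk')
  let e : Reduced D ≃ₜ D × ℝ := (isHomeomorph_iff_continuous_isClosedMap_bijective.2
    ⟨hf, hcl, hinj, hsurj⟩).homeomorph
  refine ⟨⟨e, fun x => rfl, fun x y t ht h => ?_⟩⟩
  change rise x.1 ≤ rise y.1
  rw [h]
  exact rise_le_flowH ht _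

/-! ### Heights and sections -/

section Height

variable {D : Set (ℝ × ℝ)} (g : ReducedTriv D)

theorem height_eq_of_flowJ {x y : Over D} {u : ℝ} (h : y.1 = flowJ u x.1) :
    g.height y = g.height x := by
  have : reduction y = reduction x := (Quotient.sound (s := orbitSetoid D) ⟨u, h⟩).symm
  rw [ReducedTriv.height, this, ReducedTriv.height]

theorem continuous_height : Continuous g.height :=
  continuous_snd.comp (g.g.continuous.comp continuous_quotient_mk')

theorem exists_flowJ_of_height {x y : Over D} (hF : F x.1 = F y.1)
    (h : g.height x = g.height y) : ∃ u : ℝ, y.1 = flowJ u x.1 := by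
  have h1 : g.g (reduction x) = g.g (reduction y) :=
    Prod.ext (by rw [g.fst_eq, g.fst_eq]; exact Subtype.ext hF) h
  exact Quotient.exact (g.g.injective h1)

/-- Increasing `|a|` within a fibre means flowing forward along `X_H`, up to a rotation. This
compares an arbitrary `g`, known only to be monotone along the flow, with the explicit coordinate
`|a|`. -/
theorem height_le_of_norm_le {x y : Over D} (hF : F x.1 = F y.1) (hx : unst x.1 ≠ 0)
    (h : ‖unst x.1‖ ≤ ‖unst y.1‖) : g.height x ≤ g.height y := by
  have hx' : 0 < ‖unst x.1‖ := norm_pos_iff.2 hx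
  set t := Real.log (‖unst y.1‖ / ‖unst x.1‖) with ht
  have ht0 : 0 ≤ t := Real.log_nonneg ((one_le_div hx').2 h)
  let z : Over D := ⟨flowH t x.1, by rw [F_flowH]; exact x.2⟩
  have h1 : ‖unst z.1‖ = ‖unst y.1‖ := by
    rw [unst_flowH, norm_mul, Complex.norm_real, Real.norm_eq_abs, Real.abs_exp, ht,
      Real.exp_log (div_pos (hx'.trans_le h) hx'), div_mul_cancel₀ _ hx'.ne']
  obtain ⟨u, hu⟩ := exists_flowJ_of_unst (x := z.1) (y := y.1) ((F_flowH t x.1).trans hF)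
    (by rw [← norm_pos_iff, h1]; exact hx'.trans_le h) h1
  rw [height_eq_of_flowJ g hu]
  exact g.mono x z t ht0 rfl

theorem norm_le_of_height_le {x y : Over D} (hF : F x.1 = F y.1) (hy : unst y.1 ≠ 0)
    (h : g.height x ≤ g.height y) : ‖unst x.1‖ ≤ ‖unst y.1‖ := by
  by_contra! hlt
  obtain ⟨u, hu⟩ := exists_flowJ_of_height g hF
    (h.antisymm (height_le_of_norm_le g hF.symm hy hlt.le))
  rw [hu, norm_unst_flowJ] at hlt
  exact hlt.false

/-- If `a = 0` the orbit tends to the origin for `t → ∞` while its height does not decrease, so it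
starts no higher than the origin. -/
theorem unst_ne_zero_of_height (h0 : F 0 ∈ D) {x : Over D}
    (h : g.height ⟨0, h0⟩ < g.height x) : unst x.1 ≠ 0 := by
  intro hx
  refine h.not_ge ?_
  let z : ℝ → Over D := fun t => ⟨flowH t x.1, by rw [F_flowH]; exact x.2⟩
  have hz : Tendsto z atTop (𝓝 ⟨0, h0⟩) := by
    rw [tendsto_subtype_rng]
    have h1 : ∀ t, (z t).1 = ofCoord 0 (Real.exp (-t) * stab x.1) := fun t =>
      ext_coord (by rw [unst_ofCoord, unst_flowH, hx, mul_zero]) (by rw [stab_ofCoord, stab_flowH])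
    have h2 : Tendsto (fun t : ℝ => ((Real.exp (-t) : ℝ) : ℂ) * stab x.1) atTop (𝓝 0) := by
      have := (Complex.continuous_ofReal.tendsto 0).comp Real.tendsto_exp_neg_atTop_nhds_zero
      simpa using this.mul_const (stab x.1)
    have h3 : Tendsto (fun t : ℝ => ofCoord 0 (Real.exp (-t) * stab x.1)) atTop
        (𝓝 (ofCoord 0 0)) :=
      ((by unfold ofCoord; fun_prop : Continuous fun w : ℂ => ofCoord 0 w).tendsto 0).comp h2
    rw [show ofCoord 0 0 = 0 by simp [ofCoord]] at h3
    exact h3.congr fun t => (h1 t).symm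
  refine ge_of_tendsto ((continuous_height g).continuousAt.tendsto.comp hz) ?_
  filter_upwards [eventually_ge_atTop 0] with t ht
  exact g.mono x (z t) t ht rfl

/-- The time-reversed argument: for `b = 0` the orbit comes from the origin. -/
theorem stab_ne_zero_of_height (h0 : F 0 ∈ D) {x : Over D}
    (h : g.height x < g.height ⟨0, h0⟩) : stab x.1 ≠ 0 := by
  intro hx
  refine h.not_ge ?_
  let z : ℝ → Over D := fun t => ⟨flowH (-t) x.1, by rw [F_flowH]; exact x.2⟩
  have hz : Tendsto z atTop (𝓝 ⟨0, h0⟩) := by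
    rw [tendsto_subtype_rng]
    have h1 : ∀ t, (z t).1 = ofCoord (Real.exp (-t) * unst x.1) 0 := fun t =>
      ext_coord (by rw [unst_ofCoord, unst_flowH]) (by rw [stab_ofCoord, stab_flowH, hx, mul_zero])
    have h2 : Tendsto (fun t : ℝ => ((Real.exp (-t) : ℝ) : ℂ) * unst x.1) atTop (𝓝 0) := by
      have := (Complex.continuous_ofReal.tendsto 0).comp Real.tendsto_exp_neg_atTop_nhds_zero
      simpa using this.mul_const (unst x.1)
    have h3 : Tendsto (fun t : ℝ => ofCoord (Real.exp (-t) * unst x.1) 0) atTop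
        (𝓝 (ofCoord 0 0)) :=
      ((by unfold ofCoord; fun_prop : Continuous fun w : ℂ => ofCoord w 0).tendsto 0).comp h2
    rw [show ofCoord 0 0 = 0 by simp [ofCoord]] at h3
    exact h3.congr fun t => (h1 t).symm
  refine le_of_tendsto ((continuous_height g).continuousAt.tendsto.comp hz) ?_
  filter_upwards [eventually_ge_atTop 0] with t ht
  refine g.mono (z t) x t ht ?_
  refine ext_coord ?_ ?_
  · rw [unst_flowH, unst_flowH, ← mul_assoc, ← Complex.ofReal_mul, ← Real.exp_add]
    simp
  · rw [stab_flowH, stab_flowH, ← mul_assoc, ← Complex.ofReal_mul, ← Real.exp_add]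
    simp

/-- A continuous choice of points with given circle invariant functions is a section. -/
theorem nonempty_endSection_of_flowJ (c : ℝ) (p : D → Phase) (hp : Continuous p)
    (h : ∀ (v : D) (x : Over D), x.base = v → g.height x = c → ∃ u : ℝ, p v = flowJ u x.1) :
    Nonempty (EndSection g c) := by
  have hx : ∀ v : D, ∃ x : Over D, x.base = v ∧ g.height x = c := fun v => by
    obtain ⟨x, hx⟩ := Quotient.exists_rep (g.g.symm (v, c))
    have h1 : g.g (reduction x) = (v, c) := by
      rw [reduction, hx, g.g.apply_symm_apply]
    exact ⟨x, by rw [← g.fst_eq, h1], by rw [ReducedTriv.height, h1]⟩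
  choose x hxb hxh using hx
  choose u hu using fun v => h v (x v) (hxb v) (hxh v)
  have hF : ∀ v, F (p v) = v := fun v => by
    rw [hu, F_flowJ]
    exact congr_arg Subtype.val (hxb v)
  refine ⟨⟨fun v => ⟨p v, (hF v).symm ▸ v.2⟩, hp.subtype_mk _, fun v => Subtype.ext (hF v),
    fun v => ?_⟩⟩
  rw [height_eq_of_flowJ g (hu v), hxh]

/-- An invariant function descends to the reduced space, where the level `c` is a copy of `D` under
`g`; continuity in the base point follows for every `g`. -/
theorem exists_continuous_of_invariant (c : ℝ) {f : Phase → ℝ} (hf : Continuous f)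
    (hinv : ∀ u x, f (flowJ u x) = f x) :
    ∃ α : D → ℝ, Continuous α ∧ ∀ x : Over D, g.height x = c → α x.base = f x.1 := by
  let f' : Reduced D → ℝ := Quotient.lift (fun x : Over D => f x.1) (by
    rintro x y ⟨u, hu⟩
    simp only [hu, hinv])
  have hf' : Continuous f' := (hf.comp continuous_subtype_val).quotient_lift _
  refine ⟨fun v => f' (g.g.symm (v, c)), by fun_prop, fun x hx => ?_⟩
  have h1 : g.g (reduction x) = (x.base, c) := Prod.ext (g.fst_eq x) hx
  simp only [← h1, g.g.symm_apply_apply]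
  rfl

/-- Above the origin `a` never vanishes, even over `0 ∈ D`, so each orbit of this level has exactly
one point with `a > 0`, namely `a = α`, `b = 2 val / α`. -/
theorem nonempty_endSection_pos (h0 : F 0 ∈ D) {m : ℝ} (hm : g.height ⟨0, h0⟩ < m) :
    Nonempty (EndSection g m) := by
  obtain ⟨α, hα, hαx⟩ := exists_continuous_of_invariant g m (f := fun x => ‖unst x‖)
    (by fun_prop) norm_unst_flowJ
  have hne : ∀ x : Over D, g.height x = m → unst x.1 ≠ 0 := fun x hx =>
    unst_ne_zero_of_height g h0 (hx ▸ hm)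
  have hx : ∀ v : D, α v ≠ 0 := fun v => by
    obtain ⟨x, hx⟩ := Quotient.exists_rep (g.g.symm (v, m))
    have h1 : g.g (reduction x) = (v, m) := by
      rw [reduction, hx, g.g.apply_symm_apply]
    have hxb : x.base = v := by rw [← g.fst_eq, h1]
    have hxh : g.height x = m := by rw [ReducedTriv.height, h1]
    rw [← hxb, hαx x hxh]
    exact norm_ne_zero_iff.2 (hne x hxh)
  refine nonempty_endSection_of_flowJ g m (fun v => ofCoord (α v) (2 * val v / α v)) ?_ ?_
  · refine continuous_ofCoord.comp (Continuous.prodMk (Complex.continuous_ofReal.comp hα) ?_)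
    exact Continuous.div (by fun_prop) (Complex.continuous_ofReal.comp hα) fun v => by exact_mod_cast hx v
  · rintro v x rfl hxh
    have hα0 : (α x.base : ℂ) ≠ 0 := by exact_mod_cast hx _
    refine exists_flowJ_of_unst (Eq.symm (F_eq_of_coord ?_)) (hne x hxh) ?_
    · rw [unst_ofCoord, stab_ofCoord]
      simp only [map_div₀, map_mul, Complex.conj_ofReal, map_ofNat]
      field_simp
      rfl
    · rw [unst_ofCoord, hαx x hxh]
      simp

/-- Below the origin `b` never vanishes, and the section is normalized by `b > 0` instead. -/
theorem nonempty_endSection_neg (h0 : F 0 ∈ D) {m : ℝ} (hm : m < g.height ⟨0, h0⟩) :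
    Nonempty (EndSection g m) := by
  obtain ⟨α, hα, hαx⟩ := exists_continuous_of_invariant g m (f := fun x => ‖stab x‖)
    (by fun_prop) norm_stab_flowJ
  have hne : ∀ x : Over D, g.height x = m → stab x.1 ≠ 0 := fun x hx =>
    stab_ne_zero_of_height g h0 (hx ▸ hm)
  have hx : ∀ v : D, α v ≠ 0 := fun v => by
    obtain ⟨x, hx⟩ := Quotient.exists_rep (g.g.symm (v, m))
    have h1 : g.g (reduction x) = (v, m) := by
      rw [reduction, hx, g.g.apply_symm_apply]
    have hxb : x.base = v := by rw [← g.fst_eq, h1]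
    have hxh : g.height x = m := by rw [ReducedTriv.height, h1]
    rw [← hxb, hαx x hxh]
    exact norm_ne_zero_iff.2 (hne x hxh)
  refine nonempty_endSection_of_flowJ g m
    (fun v => ofCoord (2 * (starRingEnd ℂ) (val v) / α v) (α v)) ?_ ?_
  · refine continuous_ofCoord.comp (Continuous.prodMk ?_ (Complex.continuous_ofReal.comp hα))
    exact Continuous.div (by fun_prop) (Complex.continuous_ofReal.comp hα) fun v => by exact_mod_cast hx v
  · rintro v x rfl hxh
    have hα0 : (α x.base : ℂ) ≠ 0 := by exact_mod_cast hx _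
    refine exists_flowJ_of_stab (Eq.symm (F_eq_of_coord ?_)) (hne x hxh) ?_
    · rw [unst_ofCoord, stab_ofCoord]
      simp only [Complex.conj_ofReal]
      field_simp
      rfl
    · rw [stab_ofCoord, hαx x hxh]
      simp

end Height

/-! ### Directions of complex numbers -/

/-- The direction of a complex number. -/
def dir (z : ℂ) : Circle := Circle.exp (Complex.arg z)

theorem norm_mul_dir (z : ℂ) : (‖z‖ : ℂ) * dir z = z := by
  rw [dir, Circle.coe_exp, Complex.norm_mul_exp_arg_mul_I]

theorem coe_dir {z : ℂ} (hz : z ≠ 0) : (dir z : ℂ) = z / ‖z‖ := by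
  have : (‖z‖ : ℂ) ≠ 0 := by exact_mod_cast norm_ne_zero_iff.2 hz
  rw [eq_div_iff this, mul_comm, norm_mul_dir]

theorem dir_eq {z : ℂ} {r : ℝ} (hr : 0 < r) {w : Circle} (h : z = r * w) : dir z = w := by
  have hz : ‖z‖ = r := by rw [h, norm_mul, Circle.norm_coe, Complex.norm_real]; simp [hr.le]
  have h0 : (r : ℂ) ≠ 0 := by exact_mod_cast hr.ne'
  refine Circle.ext (mul_left_cancel₀ h0 ?_)
  rw [← hz, norm_mul_dir, hz, h]

theorem dir_mul {z w : ℂ} (hz : z ≠ 0) (hw : w ≠ 0) : dir (z * w) = dir z * dir w := by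
  refine dir_eq (mul_pos (norm_pos_iff.2 hz) (norm_pos_iff.2 hw)) ?_
  nth_rewrite 1 [← norm_mul_dir z, ← norm_mul_dir w]
  push_cast
  ring

theorem dir_conj {z : ℂ} (hz : z ≠ 0) : dir ((starRingEnd ℂ) z) = (dir z)⁻¹ := by
  refine dir_eq (norm_pos_iff.2 hz) ?_
  nth_rewrite 1 [← norm_mul_dir z]
  rw [map_mul, Complex.conj_ofReal, Circle.coe_inv_eq_conj]

theorem dir_ofReal {r : ℝ} (hr : 0 < r) : dir r = 1 := dir_eq hr (by simp)

theorem dir_coe (w : Circle) : dir w = w := dir_eq one_pos (by simp)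

theorem continuous_dir {X : Type*} [TopologicalSpace X] {f : X → ℂ} (hf : Continuous f)
    (h : ∀ x, f x ≠ 0) : Continuous fun x => dir (f x) := by
  refine continuous_induced_rng.2 ?_
  refine Continuous.congr (f := fun x => f x / ‖f x‖) ?_ fun x => (coe_dir (h x)).symm
  exact hf.div (by fun_prop) fun x => by exact_mod_cast norm_ne_zero_iff.2 (h x)

/-- The directions in `a b̄ = 2 conj val`. The winding of `val` enters both the gluing of `T_m` and
the scattering angle through this formula. -/
theorem dir_unst {x : Phase} (h : F x ≠ 0) : dir (unst x) = (dir (val (F x)))⁻¹ * dir (stab x) := by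
  have h1 := congr_arg dir (unst_mul_conj_stab x)
  have h2 : (2 : ℂ) = ((2 : ℝ) : ℂ) := by norm_num
  rw [dir_mul (unst_ne_zero h) ((map_ne_zero _).2 (stab_ne_zero h)), dir_conj (stab_ne_zero h),
    dir_mul two_ne_zero ((map_ne_zero _).2 (val_ne_zero h)), h2, dir_ofReal two_pos, one_mul,
    dir_conj (val_ne_zero h)] at h1
  rw [← h1]
  simp

/-! ### The spaces `T_m` are twisted tori -/

theorem eq_of_unst {x y : Phase} (hF : F x = F y) (h0 : F x ≠ 0) (h : unst x = unst y) :
    x = y := by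
  refine ext_coord h ?_
  have h1 := unst_mul_conj_stab x
  rw [hF, ← unst_mul_conj_stab y, h] at h1
  exact (starRingEnd ℂ).injective (mul_left_cancel₀ (h ▸ unst_ne_zero h0) h1)

/-- The circle action, with the circle as group. -/
def rotate (w : Circle) (x : Phase) : Phase := ofCoord (w * unst x) (w * stab x)

theorem unst_rotate (w : Circle) (x : Phase) : unst (rotate w x) = w * unst x := unst_ofCoord _ _

theorem stab_rotate (w : Circle) (x : Phase) : stab (rotate w x) = w * stab x := stab_ofCoord _ _

theorem F_rotate (w : Circle) (x : Phase) : F (rotate w x) = F x := by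
  refine F_eq_of_coord ?_
  rw [unst_rotate, stab_rotate, ← unst_mul_conj_stab, map_mul, ← Circle.coe_inv_eq_conj]
  have : (w : ℂ) * ((w⁻¹ : Circle) : ℂ) = 1 := by rw [← Circle.coe_mul]; simp
  linear_combination unst x * (starRingEnd ℂ) (stab x) * this

theorem coe_circleExp_neg (u : ℝ) :
    ((Circle.exp (-u) : Circle) : ℂ) = Complex.exp (-(u * Complex.I)) := by
  rw [Circle.coe_exp]; simp

section Cylinder

variable {D : Set (ℝ × ℝ)} {g : ReducedTriv D} {m : ℝ} {Γ : Set D}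
  (σp : EndSection g m) (σn : EndSection g (-m))

theorem EndSection.F_eq {c : ℝ} (τ : EndSection g c) (v : D) : F (τ.toFun v).1 = v :=
  congr_arg Subtype.val (τ.base_eq v)

theorem EndSection.continuous_phase {c : ℝ} (τ : EndSection g c) :
    Continuous fun v => (τ.toFun v).1 :=
  continuous_subtype_val.comp τ.continuous_toFun

theorem EndSection.unst_ne {c : ℝ} (τ : EndSection g c) {v : D} (hv : (v : ℝ × ℝ) ≠ 0) :
    unst (τ.toFun v).1 ≠ 0 := unst_ne_zero (by rwa [τ.F_eq])

/-- The time which the flow of `X_H` needs from `A_{-m}` to `A_{+m}`. -/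
def transit (v : D) : ℝ := Real.log (‖unst (σp.toFun v).1‖ / ‖unst (σn.toFun v).1‖)

/-- The relative position of the two sections on the fibre over `v`. -/
def offset (v : D) : Circle := dir (unst (σn.toFun v).1) / dir (unst (σp.toFun v).1)

variable {σp σn}

theorem exp_transit {v : D} (hv : (v : ℝ × ℝ) ≠ 0) : Real.exp (transit σp σn v) =
    ‖unst (σp.toFun v).1‖ / ‖unst (σn.toFun v).1‖ :=
  Real.exp_log (div_pos (norm_pos_iff.2 (σp.unst_ne hv)) (norm_pos_iff.2 (σn.unst_ne hv)))

theorem transit_pos (hm : 0 < m) {v : D} (hv : (v : ℝ × ℝ) ≠ 0) : 0 < transit σp σn v := by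
  have hF : F (σp.toFun v).1 = F (σn.toFun v).1 := by rw [σp.F_eq, σn.F_eq]
  refine Real.log_pos ((one_lt_div (norm_pos_iff.2 (σn.unst_ne hv))).2 ?_)
  by_contra! h
  have := height_le_of_norm_le g hF (σp.unst_ne hv) h
  rw [σp.height_eq, σn.height_eq] at this
  linarith

/-- The transit time matches the moduli of `a` on the two sections; the remaining discrepancy of
directions is the offset. -/
theorem exp_transit_mul_unst {v : D} (hv : (v : ℝ × ℝ) ≠ 0) :
    (Real.exp (transit σp σn v) : ℂ) * unst (σn.toFun v).1 =
      offset σp σn v * unst (σp.toFun v).1 := by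
  have h1 : (‖unst (σn.toFun v).1‖ : ℂ) ≠ 0 := by
    exact_mod_cast norm_ne_zero_iff.2 (σn.unst_ne hv)
  rw [exp_transit hv, offset, Circle.coe_div]
  nth_rewrite 2 [← norm_mul_dir (unst (σn.toFun v).1)]
  nth_rewrite 3 [← norm_mul_dir (unst (σp.toFun v).1)]
  have h2 : (dir (unst (σp.toFun v).1) : ℂ) ≠ 0 := Circle.coe_ne_zero _
  push_cast
  field_simp

theorem unst_flowH_rotate (v : D) (s : ℝ) (w : Circle) :
    unst (flowH s (rotate w (σn.toFun v).1)) = Real.exp s * (w * unst (σn.toFun v).1) := by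
  rw [unst_flowH, unst_rotate]

theorem F_flowH_rotate (v : D) (s : ℝ) (w : Circle) :
    F (flowH s (rotate w (σn.toFun v).1)) = v := by
  rw [F_flowH, F_rotate, σn.F_eq]

variable (hm : 0 < m) (hΓ : ∀ v ∈ Γ, (v : ℝ × ℝ) ≠ 0)

theorem abs_height_flowH_rotate (hm : 0 < m) {v : D} (hv : (v : ℝ × ℝ) ≠ 0) (s : I) (w : Circle)
    (h : F (flowH (s * transit σp σn v) (rotate w (σn.toFun v).1)) ∈ D) :
    |g.height ⟨flowH (s * transit σp σn v) (rotate w (σn.toFun v).1), h⟩| ≤ m := by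
  have hT := transit_pos (σp := σp) (σn := σn) hm hv
  have hn : ‖unst (flowH (s * transit σp σn v) (rotate w (σn.toFun v).1))‖ =
      Real.exp (s * transit σp σn v) * ‖unst (σn.toFun v).1‖ := by
    rw [unst_flowH_rotate]
    simp only [norm_mul, Complex.norm_real, Real.norm_eq_abs, Real.abs_exp, Circle.norm_coe,
      one_mul]
  have hF := F_flowH_rotate (σn := σn) v (s * transit σp σn v) w
  have hpos := norm_pos_iff.2 (σn.unst_ne hv)
  rw [abs_le]
  constructor
  · refine (σn.height_eq v).symm.trans_le ?_
    refine height_le_of_norm_le g (by rw [σn.F_eq, hF]) (σn.unst_ne hv) ?_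
    simp only [hn]
    exact le_mul_of_one_le_left hpos.le (Real.one_le_exp (mul_nonneg s.2.1 hT.le))
  · refine LE.le.trans_eq ?_ (σp.height_eq v)
    refine height_le_of_norm_le g (by rw [σp.F_eq, hF]) (unst_ne_zero (by rwa [hF])) ?_
    simp only [hn]
    calc _ ≤ Real.exp (transit σp σn v) * ‖unst (σn.toFun v).1‖ := by
            gcongr
            exact mul_le_of_le_one_left hT.le s.2.2
      _ = _ := by rw [exp_transit hv, div_mul_cancel₀ _ hpos.ne']

variable (σp σn) in
/-- The point of the truncated cylinder bundle with given coordinates. -/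
def cutPoint (z : Γ × I × Circle) : Cut g m Γ :=
  ⟨⟨flowH (z.2.1 * transit σp σn z.1.1) (rotate z.2.2 (σn.toFun z.1.1).1), by
      rw [F_flowH_rotate]; exact z.1.1.2⟩, by
    have hb : F (flowH (z.2.1 * transit σp σn z.1.1) (rotate z.2.2 (σn.toFun z.1.1).1)) = z.1.1 :=
      F_flowH_rotate _ _ _
    refine ⟨?_, abs_height_flowH_rotate hm (hΓ _ z.1.2) _ _ _⟩
    have : Over.base (⟨flowH (z.2.1 * transit σp σn z.1.1) (rotate z.2.2 (σn.toFun z.1.1).1), by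
      rw [F_flowH_rotate]; exact z.1.1.2⟩ : Over D) = z.1.1 := Subtype.ext hb
    rw [this]
    exact z.1.2⟩

theorem unst_cutPoint (z : Γ × I × Circle) : unst (cutPoint σp σn hm hΓ z).1.1 =
    Real.exp (z.2.1 * transit σp σn z.1.1) * (z.2.2 * unst (σn.toFun z.1.1).1) :=
  unst_flowH_rotate _ _ _

theorem F_cutPoint (z : Γ × I × Circle) : F (cutPoint σp σn hm hΓ z).1.1 = z.1.1 :=
  F_flowH_rotate _ _ _

theorem cutPoint_eq {z : Γ × I × Circle} {p : Phase} (hF : F p = z.1.1)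
    (h : unst p = Real.exp (z.2.1 * transit σp σn z.1.1) * (z.2.2 * unst (σn.toFun z.1.1).1)) :
    (cutPoint σp σn hm hΓ z).1.1 = p :=
  eq_of_unst ((F_cutPoint hm hΓ z).trans hF.symm) (by rw [F_cutPoint]; exact hΓ _ z.1.2)
    ((unst_cutPoint hm hΓ z).trans h.symm)

theorem continuous_cutPoint : Continuous (cutPoint σp σn hm hΓ) := by
  have hp : Continuous fun z : Γ × I × Circle => unst (σp.toFun z.1.1).1 :=
    continuous_unst.comp (σp.continuous_phase.comp (by fun_prop))
  have hn : Continuous fun z : Γ × I × Circle => unst (σn.toFun z.1.1).1 :=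
    continuous_unst.comp (σn.continuous_phase.comp (by fun_prop))
  have hn' : Continuous fun z : Γ × I × Circle => stab (σn.toFun z.1.1).1 :=
    continuous_stab.comp (σn.continuous_phase.comp (by fun_prop))
  have hT : Continuous fun z : Γ × I × Circle => transit σp σn z.1.1 := by
    refine Continuous.log (hp.norm.div hn.norm fun z => ?_) fun z => ?_
    · exact norm_ne_zero_iff.2 (σn.unst_ne (hΓ _ z.1.2))
    · exact (div_pos (norm_pos_iff.2 (σp.unst_ne (hΓ _ z.1.2)))
        (norm_pos_iff.2 (σn.unst_ne (hΓ _ z.1.2)))).ne'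
  have hR : Continuous fun z : Γ × I × Circle => rotate z.2.2 (σn.toFun z.1.1).1 :=
    continuous_ofCoord.comp (f := fun z : Γ × I × Circle => ((z.2.2 : ℂ) * unst (σn.toFun z.1.1).1,
      (z.2.2 : ℂ) * stab (σn.toFun z.1.1).1)) (by fun_prop)
  refine Continuous.subtype_mk (Continuous.subtype_mk ?_ _) _
  unfold flowH
  fun_prop

/-- The coordinate `s` of a point of the cylinder. -/
def cutParam (σp : EndSection g m) (σn : EndSection g (-m)) (x : Cut g m Γ) : ℝ :=
  Real.log (‖unst x.1.1‖ / ‖unst (σn.toFun x.1.base).1‖) / transit σp σn x.1.base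

/-- The coordinate `w` of a point of the cylinder. -/
def cutDir (σn : EndSection g (-m)) (x : Cut g m Γ) : Circle :=
  dir (unst x.1.1) / dir (unst (σn.toFun x.1.base).1)

include hm hΓ in
-- The hypothesis is a polar decomposition of `a` relative to `σ₋`: the modulus gives `r`, the
-- direction gives `w`.
theorem cutParam_eq {x : Cut g m Γ} {r : ℝ} {w : Circle}
    (h : unst x.1.1 = Real.exp (r * transit σp σn x.1.base) *
      (w * unst (σn.toFun x.1.base).1)) : cutParam σp σn x = r ∧ cutDir σn x = w := by
  have hv := hΓ _ x.2.1
  have hT := transit_pos (σp := σp) (σn := σn) hm hv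
  have hpos := norm_pos_iff.2 (σn.unst_ne hv)
  constructor
  · have h1 : ‖unst x.1.1‖ =
        Real.exp (r * transit σp σn x.1.base) * ‖unst (σn.toFun x.1.base).1‖ := by
      rw [h]
      simp only [norm_mul, Complex.norm_real, Real.norm_eq_abs, Real.abs_exp, Circle.norm_coe,
        one_mul]
    rw [cutParam, h1, mul_div_cancel_right₀ _ hpos.ne', Real.log_exp, mul_div_cancel_right₀ _ hT.ne']
  · rw [cutDir, h, dir_mul (by exact_mod_cast (Real.exp_pos _).ne')
      (mul_ne_zero (Circle.coe_ne_zero _) (σn.unst_ne hv)), dir_ofReal (Real.exp_pos _), one_mul,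
      dir_mul (Circle.coe_ne_zero _) (σn.unst_ne hv), dir_coe, mul_div_cancel_right]

theorem base_cutPoint (z : Γ × I × Circle) : (cutPoint σp σn hm hΓ z).1.base = z.1.1 :=
  Subtype.ext (F_cutPoint hm hΓ z)

theorem cutParam_cutPoint (z : Γ × I × Circle) :
    cutParam σp σn (cutPoint σp σn hm hΓ z) = z.2.1 ∧ cutDir σn (cutPoint σp σn hm hΓ z) = z.2.2 :=
  cutParam_eq hm hΓ (by rw [base_cutPoint, unst_cutPoint])

include hm hΓ in
theorem unst_eq_cutParam (x : Cut g m Γ) :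
    unst x.1.1 = Real.exp (cutParam σp σn x * transit σp σn x.1.base) *
      (cutDir σn x * unst (σn.toFun x.1.base).1) := by
  have hv := hΓ _ x.2.1
  have hT := transit_pos (σp := σp) (σn := σn) hm hv
  have hpos := norm_pos_iff.2 (σn.unst_ne hv)
  have hx : unst x.1.1 ≠ 0 := unst_ne_zero hv
  rw [cutParam, div_mul_cancel₀ _ hT.ne', Real.exp_log (div_pos (norm_pos_iff.2 hx) hpos), cutDir,
    Circle.coe_div]
  nth_rewrite 1 [← norm_mul_dir (unst x.1.1)]
  nth_rewrite 3 [← norm_mul_dir (unst (σn.toFun x.1.base).1)]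
  have h1 : (‖unst (σn.toFun x.1.base).1‖ : ℂ) ≠ 0 := by exact_mod_cast hpos.ne'
  have h2 : (dir (unst (σn.toFun x.1.base).1) : ℂ) ≠ 0 := Circle.coe_ne_zero _
  push_cast
  field_simp

include hm hΓ in
theorem cutParam_mem (x : Cut g m Γ) : cutParam σp σn x ∈ I := by
  have hv := hΓ _ x.2.1
  have hT := transit_pos (σp := σp) (σn := σn) hm hv
  have hpos := norm_pos_iff.2 (σn.unst_ne hv)
  have hx : unst x.1.1 ≠ 0 := unst_ne_zero hv
  have hh := abs_le.1 x.2.2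
  have h1 : ‖unst (σn.toFun x.1.base).1‖ ≤ ‖unst x.1.1‖ :=
    norm_le_of_height_le g (σn.F_eq _) hx (by rw [σn.height_eq]; exact hh.1)
  have h2 : ‖unst x.1.1‖ ≤ ‖unst (σp.toFun x.1.base).1‖ :=
    norm_le_of_height_le g (σp.F_eq x.1.base).symm (σp.unst_ne hv) (by rw [σp.height_eq]; exact hh.2)
  constructor
  · exact div_nonneg (Real.log_nonneg ((one_le_div hpos).2 h1)) hT.le
  · refine (div_le_one hT).2 (Real.log_le_log (div_pos (norm_pos_iff.2 hx) hpos) ?_)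
    gcongr

theorem surjective_cutPoint : Function.Surjective (cutPoint σp σn hm hΓ) := by
  intro x
  refine ⟨(⟨x.1.base, x.2.1⟩, ⟨cutParam σp σn x, cutParam_mem hm hΓ x⟩, cutDir σn x), ?_⟩
  exact Subtype.ext (Subtype.ext (cutPoint_eq hm hΓ rfl (unst_eq_cutParam hm hΓ x)))

theorem cutPoint_one {v : Γ} {w : Circle} {t : ℝ}
    (h : (w * offset σp σn v : Circle) = Circle.exp (-t)) :
    (cutPoint σp σn hm hΓ (v, 1, w)).1.1 = flowJ t (σp.toFun v).1 := by
  refine cutPoint_eq hm hΓ (by rw [F_flowJ, σp.F_eq]) ?_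
  rw [unst_flowJ, ← coe_circleExp_neg, ← h]
  have := exp_transit_mul_unst (σp := σp) (σn := σn) (hΓ v v.2)
  simp only [Set.Icc.coe_one, one_mul, Circle.coe_mul]
  linear_combination -(w : ℂ) * this

theorem cutPoint_zero {v : Γ} {w : Circle} {t : ℝ} (h : w = Circle.exp (-t)) :
    (cutPoint σp σn hm hΓ (v, 0, w)).1.1 = flowJ t (σn.toFun v).1 := by
  refine cutPoint_eq hm hΓ (by rw [F_flowJ, σn.F_eq]) ?_
  rw [unst_flowJ, ← coe_circleExp_neg, ← h]
  simp

theorem cutPoint_flowH {v : Γ} (s : I) :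
    (cutPoint σp σn hm hΓ (v, s, 1)).1.1 = flowH (s * transit σp σn v) (σn.toFun v).1 := by
  refine cutPoint_eq hm hΓ (by rw [F_flowH, σn.F_eq]) ?_
  rw [unst_flowH]
  simp

include hm hΓ in
theorem flowH_transit {v : Γ} {t : ℝ} (h : offset σp σn v = Circle.exp (-t)) :
    flowH (transit σp σn v) (σn.toFun v).1 = flowJ t (σp.toFun v).1 := by
  rw [← cutPoint_one hm hΓ (w := 1) (by rw [one_mul, h])]
  have := cutPoint_flowH (σp := σp) (σn := σn) hm hΓ (v := v) 1
  rw [this]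
  simp

include hΓ in
-- Modulus and direction of `a` determine `T`, and `t` modulo `2π`; hence the loop `γ` of an adapted
-- basis is free only in its `X_J` part.
theorem eq_transit {v : Γ} {T t : ℝ}
    (h : flowH T (σn.toFun v).1 = flowJ t (σp.toFun v).1) :
    T = transit σp σn v ∧ offset σp σn v = Circle.exp (-t) := by
  have hv := hΓ v v.2
  have h1 := congr_arg unst h
  rw [unst_flowH, unst_flowJ, ← coe_circleExp_neg] at h1
  have hT : T = transit σp σn v := by
    have h2 := congr_arg norm h1
    simp only [norm_mul, Complex.norm_real, Real.norm_eq_abs, Real.abs_exp, Circle.norm_coe,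
      one_mul] at h2
    rw [transit, ← h2, mul_div_cancel_right₀ _ (norm_ne_zero_iff.2 (σn.unst_ne hv)), Real.log_exp]
  refine ⟨hT, Circle.ext ?_⟩
  rw [hT, exp_transit_mul_unst hv] at h1
  exact mul_right_cancel₀ (σp.unst_ne hv) h1

theorem continuous_offset (hΓ : ∀ v ∈ Γ, (v : ℝ × ℝ) ≠ 0) :
    Continuous fun v : Γ => offset σp σn v := by
  have h1 : Continuous fun v : Γ => dir (unst (σn.toFun v).1) :=
    continuous_dir (continuous_unst.comp (σn.continuous_phase.comp continuous_subtype_val))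
      fun v => σn.unst_ne (hΓ v v.2)
  have h2 : Continuous fun v : Γ => dir (unst (σp.toFun v).1) :=
    continuous_dir (continuous_unst.comp (σp.continuous_phase.comp continuous_subtype_val))
      fun v => σp.unst_ne (hΓ v v.2)
  exact h1.div' h2

theorem isTwistedTorus_projTm [CompactSpace Γ] :
    IsTwistedTorus (projTm Γ σp σn) (fun v => offset σp σn v)
      (fun z => Quot.mk _ (cutPoint σp σn hm hΓ z)) where
  quot := by
    -- The source is compact because `Γ` is, and the cylinder is Hausdorff, so this continuous
    -- surjection is closed.
    have h1 : IsQuotientMap (cutPoint σp σn hm hΓ) :=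
      (continuous_cutPoint hm hΓ).isClosedMap.isQuotientMap (continuous_cutPoint hm hΓ)
        (surjective_cutPoint hm hΓ)
    exact isQuotientMap_quot_mk.comp h1
  proj v s w := Subtype.ext (base_cutPoint hm hΓ _)
  glue v w := by
    refine Quot.sound ⟨v, -Complex.arg (w * offset σp σn v : Circle), ?_, ?_⟩
    · exact cutPoint_one hm hΓ (by rw [neg_neg, Circle.exp_arg])
    · exact cutPoint_zero hm hΓ (by rw [neg_neg, Circle.exp_arg])
  inj v s s' w w' h := by
    classical
    -- A normal form: points of the end `s = 1` are replaced by their partners at `s = 0`. It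
    -- respects `glue` and so factors through `Quot`, which avoids describing the equivalence
    -- relation generated by `glue`.
    let N : Cut g m Γ → ℝ × Circle := fun x =>
      if cutParam σp σn x = 1 then (0, cutDir σn x * offset σp σn x.1.base)
      else (cutParam σp σn x, cutDir σn x)
    have hN : ∀ x y, glue Γ σp σn x y → N x = N y := by
      rintro x y ⟨v, t, hx, hy⟩
      have hxb : x.1.base = v := by rw [base_eq_of_flowJ hx, σp.base_eq]
      have hyb : y.1.base = v := by rw [base_eq_of_flowJ hy, σn.base_eq]
      have hv : (v : ℝ × ℝ) ≠ 0 := hΓ v (hxb ▸ x.2.1)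
      have e1 := cutParam_eq (σp := σp) (σn := σn) hm hΓ (x := x) (r := 1)
        (w := Circle.exp (-t) / offset σp σn v) (by
          rw [hx, hxb, unst_flowJ, ← coe_circleExp_neg, one_mul, Circle.coe_div]
          have := exp_transit_mul_unst (σp := σp) (σn := σn) hv
          have h2 : (offset σp σn v : ℂ) ≠ 0 := Circle.coe_ne_zero _
          field_simp
          linear_combination -this)
      have e2 := cutParam_eq (σp := σp) (σn := σn) hm hΓ (x := y) (r := 0)
        (w := Circle.exp (-t)) (by rw [hy, hyb, unst_flowJ, ← coe_circleExp_neg]; simp)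
      simp only [N, e1.1, e2.1, e1.2, e2.2, hxb, zero_ne_one, if_true, if_false, div_mul_cancel]
    have hNs : ∀ s w, N (cutPoint σp σn hm hΓ (v, s, w)) =
        if (s : ℝ) = 1 then (0, w * offset σp σn v) else ((s : ℝ), w) := fun s w => by
      simp only [N, (cutParam_cutPoint hm hΓ (v, s, w)).1, (cutParam_cutPoint hm hΓ (v, s, w)).2,
        base_cutPoint]
    have key : N (cutPoint σp σn hm hΓ (v, s, w)) = N (cutPoint σp σn hm hΓ (v, s', w')) :=
      congr_arg (Quot.lift N hN) h
    rw [hNs, hNs] at key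
    have c1 : ∀ s : I, (s : ℝ) = 1 ↔ s = 1 := fun s => by
      rw [← Set.Icc.coe_one, Subtype.ext_iff]
    have c0 : ∀ s : I, (s : ℝ) = 0 ↔ s = 0 := fun s => by
      rw [← Set.Icc.coe_zero, Subtype.ext_iff]
    split_ifs at key with h1 h2 h2 <;> simp only [Prod.mk.injEq] at key
    · exact Or.inl ⟨((c1 _).1 h1).trans ((c1 _).1 h2).symm, mul_right_cancel key.2⟩
    · exact Or.inr (Or.inl ⟨(c1 _).1 h1, (c0 _).1 key.1.symm, key.2.symm⟩)
    · exact Or.inr (Or.inr ⟨(c0 _).1 key.1, (c1 _).1 h2, key.2⟩)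
    · exact Or.inl ⟨Subtype.ext key.1, key.2⟩

end Cylinder

/-! ### The winding of the relative position along the boundary of the disk -/

theorem Disk.periodic_bdry (d : Disk) : Function.Periodic d.bdry 1 := by
  intro s
  apply Subtype.ext
  simp only [Disk.bdry]
  congr 2
  rw [mul_add, mul_one, Complex.ofReal_add, add_mul, Complex.exp_add]
  simp [Complex.exp_two_pi_mul_I]

instance (d : Disk) : CompactSpace d.Γ :=
  isCompact_iff_compactSpace.1 (d.periodic_bdry.compact_of_continuous one_ne_zero d.continuous_bdry)

theorem Disk.isClosed_D (d : Disk) : IsClosed d.D :=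
  (isCompact_range d.continuous_toFun).isClosed

theorem Disk.WindsOnce.bdry_ne_zero {d : Disk} (h : d.WindsOnce) (s : ℝ) : (d.bdry s).1 ≠ 0 := by
  obtain ⟨θ, -, -, hθ⟩ := h
  obtain ⟨ρ, hρ, h⟩ := hθ s
  intro h0
  rw [h0] at h
  have h1 : (ρ : ℂ) * Complex.exp (θ s * Complex.I) ≠ 0 :=
    mul_ne_zero (by exact_mod_cast hρ.ne') (Complex.exp_ne_zero _)
  exact h1 (by rw [← h]; simp)

theorem Disk.WindsOnce.ne_zero {d : Disk} (h : d.WindsOnce) : ∀ v ∈ d.Γ, (v : ℝ × ℝ) ≠ 0 := by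
  rintro _ ⟨s, rfl⟩
  exact h.bdry_ne_zero s

theorem Disk.WindsOnce.hasAngle {d : Disk} (h : d.WindsOnce) :
    HasAngle (fun t : I => dir (val (d.bdry t).1)) (2 * Real.pi) := by
  obtain ⟨θ, hc, h1, hθ⟩ := h
  refine ⟨fun t => θ t, by fun_prop, fun t => ?_, by simpa using h1⟩
  obtain ⟨ρ, hρ, h⟩ := hθ t
  exact (dir_eq hρ h).symm

/-- Shrinking the boundary radially to the centre is a homotopy to a constant loop. It needs `f` on
all of `D`, which is why sections over the full disk are required. -/
theorem Disk.hasAngle_zero (d : Disk) {f : d.D → Circle} (hf : Continuous f) :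
    HasAngle (fun t : I => f (d.bdry t)) 0 := by
  have hmem : ∀ z : I × I, ((z.1 : ℝ) : ℂ) * Complex.exp ((2 * Real.pi * z.2 : ℝ) * Complex.I) ∈
      Metric.closedBall (0 : ℂ) 1 := fun z => by
    rw [mem_closedBall_zero_iff, norm_mul, Complex.norm_exp_ofReal_mul_I, mul_one,
      Complex.norm_real, Real.norm_eq_abs, abs_of_nonneg z.1.2.1]
    exact z.1.2.2
  let K : I × I → Circle := fun z => f ⟨d.toFun ⟨_, hmem z⟩, mem_range_self _⟩
  have hK : Continuous K := by
    refine hf.comp (Continuous.subtype_mk (d.continuous_toFun.comp (Continuous.subtype_mk ?_ _)) _)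
    fun_prop
  have h01 : ∀ t, K (t, 0) = K (t, 1) := fun t => by
    simp only [K]
    congr 4
    simp [Complex.exp_two_pi_mul_I]
  have h0 : HasAngle (fun s => K (0, s)) 0 := by
    refine ⟨fun _ => Complex.arg (K (0, 0)), continuous_const, fun s => ?_, by simp⟩
    rw [Circle.exp_arg]
    simp [K]
  have h1 := HasAngle.homotopy hK h01 h0
  convert h1 using 3 with s
  simp [Disk.bdry]

section

variable {d : Disk} {g : ReducedTriv d.D} {m : ℝ}
  {σp : EndSection g m} {σn : EndSection g (-m)}

/-- The offset is `(dir val)⁻¹ · dir b(σ₋) / dir a(σ₊)`. The bound on `m` makes the last two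
directions continuous over `D`, including the value `0`, so only the first factor winds. -/
theorem hasAngle_offset (h : d.WindsOnce) (h0 : F 0 ∈ d.D) (hm : |g.height ⟨0, h0⟩| < m) :
    HasAngle (fun t : I => offset σp σn (d.bdry t)) (-(2 * Real.pi)) := by
  have hm' := abs_lt.1 hm
  have hp : ∀ v, unst (σp.toFun v).1 ≠ 0 := fun v =>
    unst_ne_zero_of_height g h0 (by rw [σp.height_eq]; exact hm'.2)
  have hn : ∀ v, stab (σn.toFun v).1 ≠ 0 := fun v =>
    stab_ne_zero_of_height g h0 (by rw [σn.height_eq]; exact hm'.1)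
  have h1 := d.hasAngle_zero (continuous_dir (continuous_unst.comp σp.continuous_phase) hp)
  have h2 := d.hasAngle_zero (continuous_dir (continuous_stab.comp σn.continuous_phase) hn)
  have h3 := (h.hasAngle.inv.mul h2).mul h1.inv
  rw [neg_zero, add_zero, add_zero] at h3
  convert h3 using 2 with t
  have hv := h.bdry_ne_zero t
  rw [offset, dir_unst (by rwa [σn.F_eq]), σn.F_eq, div_eq_mul_inv]
  rfl

theorem exists_offset_arg (h : d.WindsOnce) (h0 : F 0 ∈ d.D) (hm : |g.height ⟨0, h0⟩| < m) :
    ∃ θ : I → ℝ, Continuous θ ∧ (∀ t, offset σp σn (d.loop t).1 = Circle.exp (-θ t)) ∧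
      θ 1 = θ 0 + 2 * Real.pi := by
  obtain ⟨f, hf, hfp, hf1⟩ := hasAngle_offset (σp := σp) (σn := σn) h h0 hm
  refine ⟨fun t => -f t, hf.neg, fun t => ?_, by simp only [hf1]; ring⟩
  rw [neg_neg, hfp]
  rfl

end

/-! ### The monodromy number of `T_m` -/

section

variable {D : Set (ℝ × ℝ)} {g : ReducedTriv D} {m : ℝ} {Γ : Set D}
  {σp : EndSection g m} {σn : EndSection g (-m)}

theorem IsClassOf.eq_mk {x : Tm Γ σp σn} {p : Phase} (h : IsClassOf x p) {y : Cut g m Γ}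
    (hy : y.1.1 = p) : x = Quot.mk _ y := by
  obtain ⟨z, hz, rfl⟩ := h
  rw [show z = y from Subtype.ext (Subtype.ext (hz.trans hy.symm))]

theorem IsClassOf.unique {x y : Tm Γ σp σn} {p : Phase} (h : IsClassOf x p) (h' : IsClassOf y p) :
    x = y := by
  obtain ⟨z, hz, rfl⟩ := h'
  exact h.eq_mk hz

variable (hm : 0 < m) (hΓ : ∀ v ∈ Γ, (v : ℝ × ℝ) ≠ 0) {v : Γ}
  (hproj : ∀ (s : I) (w : Circle),
    projTm Γ σp σn (Quot.mk _ (cutPoint σp σn hm hΓ (v, s, w))) = v)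

/-- The sign is that of the flow: `φ_J^u` multiplies `a` by `exp (-iu)`. -/
theorem degrees_orbit {u : (projTm Γ σp σn ⁻¹' {v}) ≃ₜ Circle × Circle} {θ₀ : ℝ}
    (hu : ∀ s w, u ⟨Quot.mk _ (cutPoint σp σn hm hΓ (v, s, w)), hproj s w⟩ =
        (Circle.exp (2 * Real.pi * s), w * Circle.exp (-(s * θ₀))))
    {x : projTm Γ σp σn ⁻¹' {v}} (cJ : Path x x)
    (h : ∀ s : I, IsClassOf (cJ s).1 (flowJ (2 * Real.pi * s) (σn.toFun v.1).1)) :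
    degrees u cJ = (0, -1) := by
  have hc : ∀ s, u (cJ s) = (1, Circle.exp (-(2 * Real.pi * s))) := fun s => by
    have e : cJ s = ⟨Quot.mk _ (cutPoint σp σn hm hΓ (v, 0, Circle.exp (-(2 * Real.pi * s)))),
        hproj _ _⟩ := Subtype.ext ((h s).eq_mk (cutPoint_zero hm hΓ rfl))
    rw [e, hu]
    simp
  refine Prod.ext (HasAngle.degree_eq ?_) (HasAngle.degree_eq ?_)
  · exact ⟨fun _ => 0, continuous_const, fun s => by simp [hc], by simp⟩
  · exact ⟨fun s => -(2 * Real.pi * s), by fun_prop, fun s => by simp only [hc], by simp⟩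

/-- The `X_H` part runs once through `s`, and the untwisting turns its second coordinate by `-θ₀`;
the `X_J` part stays at `s = 1` and turns it by `θ`. The total is `θ - θ₀ = 2πl`. -/
theorem degrees_transit {u : (projTm Γ σp σn ⁻¹' {v}) ≃ₜ Circle × Circle} {θ₀ : ℝ}
    (hu : ∀ s w, u ⟨Quot.mk _ (cutPoint σp σn hm hΓ (v, s, w)), hproj s w⟩ =
        (Circle.exp (2 * Real.pi * s), w * Circle.exp (-(s * θ₀))))
    {x y : projTm Γ σp σn ⁻¹' {v}} (c₁ : Path x y) (c₂ : Path y x) {T θ : ℝ}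
    (hT : flowH T (σn.toFun v.1).1 = flowJ θ (σp.toFun v.1).1)
    (h₁ : ∀ s : I, IsClassOf (c₁ s).1 (flowH (s * T) (σn.toFun v.1).1))
    (h₂ : ∀ s : I, IsClassOf (c₂ s).1 (flowJ ((1 - s) * θ) (σp.toFun v.1).1))
    {l : ℤ} (hl : θ = θ₀ + l * (2 * Real.pi)) :
    degrees u (c₁.trans c₂) = (1, l) := by
  obtain ⟨rfl, hoff⟩ := eq_transit hΓ hT
  have hc₁ : ∀ s, u (c₁ s) = (Circle.exp (2 * Real.pi * s), Circle.exp (-(s * θ₀))) := fun s => by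
    have e : c₁ s = ⟨Quot.mk _ (cutPoint σp σn hm hΓ (v, s, 1)), hproj _ _⟩ :=
      Subtype.ext ((h₁ s).eq_mk (cutPoint_flowH hm hΓ s))
    rw [e, hu, one_mul]
  have hc₂ : ∀ s, u (c₂ s) = (1, Circle.exp (-((1 - s) * θ))) := fun s => by
    have e : c₂ s = ⟨Quot.mk _ (cutPoint σp σn hm hΓ
        (v, 1, Circle.exp (-((1 - s) * θ)) / offset σp σn v)), hproj _ _⟩ :=
      Subtype.ext ((h₂ s).eq_mk (cutPoint_one hm hΓ (div_mul_cancel _ _)))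
    have h3 : Circle.exp (-θ) = Circle.exp (-θ₀) := by
      rw [hl, neg_add, ← neg_mul, ← Int.cast_neg, exp_add_int]
    rw [e, hu, hoff, h3]
    simp
  have a1 : HasAngle (fun s => (u (c₁ s)).1) (2 * Real.pi) :=
    ⟨fun s => 2 * Real.pi * s, by fun_prop, fun s => by simp only [hc₁], by simp⟩
  have a2 : HasAngle (fun s => (u (c₂ s)).1) 0 :=
    ⟨fun _ => 0, continuous_const, fun s => by simp [hc₂], by simp⟩
  have b1 : HasAngle (fun s => (u (c₁ s)).2) (-θ₀) :=
    ⟨fun s => -(s * θ₀), by fun_prop, fun s => by simp only [hc₁], by simp⟩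
  have b2 : HasAngle (fun s => (u (c₂ s)).2) θ :=
    ⟨fun s => -((1 - s) * θ), by fun_prop, fun s => by simp only [hc₂], by simp⟩
  have a := a1.trans (u := fun z => (u z).1) a2
  have b := b1.trans (u := fun z => (u z).2) b2
  refine Prod.ext (HasAngle.degree_eq ?_) (HasAngle.degree_eq ?_)
  · simpa using a
  · convert b using 1
    rw [hl]; ring

end

/-- The linear isomorphism `(i, j) ↦ (-j, i)`. -/
def quarterTurn : (ℤ × ℤ) ≃+ (Fin 2 → ℤ) where
  toFun z := ![-z.2, z.1]
  invFun f := (f 1, -f 0)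
  left_inv z := by simp
  right_inv f := by ext i; fin_cases i <;> simp
  map_add' z w := by ext i; fin_cases i <;> simp; ring

theorem hasMonodromyNumber {d : Disk} (hd : d.WindsOnce) {g : ReducedTriv d.D} {m : ℝ}
    (h0 : F 0 ∈ d.D) (hm : |g.height ⟨0, h0⟩| < m) (σp : EndSection g m)
    (σn : EndSection g (-m)) : HasMonodromyNumber σp σn d.loop (-1) := by
  have hm0 : 0 < m := (abs_nonneg _).trans_lt hm
  have hΓ := hd.ne_zero
  have tw := isTwistedTorus_projTm (σp := σp) (σn := σn) hm0 hΓ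
  have hbun := tw.isTorusBundle (continuous_offset hΓ)
  have : T2Space (Tm d.Γ σp σn) := hbun.t2Space tw.continuous_proj
  obtain ⟨θ, hθ, hoff, h1⟩ := exists_offset_arg (σp := σp) (σn := σn) hd h0 hm
  set v : d.Γ := ⟨d.bdry 0, mem_range_self 0⟩ with hv
  have hoff0 : offset σp σn v = Circle.exp (-θ 0) := by simpa using hoff 0
  have hproj : ∀ (s : I) (w : Circle),
      projTm d.Γ σp σn (Quot.mk _ (cutPoint σp σn hm0 hΓ (v, s, w))) = v :=
    fun s w => tw.proj v s w
  let x : projTm d.Γ σp σn ⁻¹' {v} := ⟨Quot.mk _ (cutPoint σp σn hm0 hΓ (v, 0, 1)), hproj _ _⟩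
  have hx : IsClassOf x.1 (σn.toFun v.1).1 :=
    ⟨_, (cutPoint_zero hm0 hΓ (t := 0) (by simp)).trans (flowJ_zero _), rfl⟩
  obtain ⟨u, hu, M, hM, hMdeg⟩ := tw.exists_monodromy d.loop hθ hoff h1 x
  refine ⟨tw.continuous_proj, hbun, x, hx, ?_, M, hM, ?_⟩
  · have hq : Continuous fun z : I × Circle =>
        (⟨Quot.mk _ (cutPoint σp σn hm0 hΓ (v, z)), hproj _ _⟩ : projTm d.Γ σp σn ⁻¹' {v}) :=
      (tw.quot.continuous.comp (Continuous.prodMk_right v)).subtype_mk _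
    let P : I → Circle → projTm d.Γ σp σn ⁻¹' {v} :=
      fun s w => ⟨Quot.mk _ (cutPoint σp σn hm0 hΓ (v, s, w)), hproj s w⟩
    let cJ : Path x x :=
      { toFun := fun s => P 0 (Circle.exp (-(2 * Real.pi * s)))
        continuous_toFun := hq.comp (f := fun s : I => ((0 : I), Circle.exp (-(2 * Real.pi * s))))
          (by fun_prop)
        source' := by simp [P, x]
        target' := by simp [P, x] }
    let c₁ : Path x (P 1 1) :=
      { toFun := fun s => P s 1
        continuous_toFun := hq.comp (f := fun s : I => (s, (1 : Circle))) (by fun_prop)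
        source' := rfl
        target' := rfl }
    let c₂ : Path (P 1 1) x :=
      { toFun := fun s => P 1 (Circle.exp (-((1 - s) * θ 0)) / offset σp σn v)
        continuous_toFun := hq.comp (f := fun s : I =>
          ((1 : I), Circle.exp (-((1 - s) * θ 0)) / offset σp σn v)) (by fun_prop)
        source' := by simp [hoff0]
        target' := by
          refine Subtype.ext ((tw.glue v _).trans ?_)
          rw [div_mul_cancel]
          simp [x] }
    have hJ : ∀ s : I, IsClassOf (cJ s).1 (flowJ (2 * Real.pi * s) (σn.toFun v.1).1) :=
      fun s => ⟨_, cutPoint_zero hm0 hΓ rfl, rfl⟩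
    have hT : flowH (transit σp σn v) (σn.toFun v.1).1 = flowJ (θ 0) (σp.toFun v.1).1 :=
      flowH_transit hm0 hΓ hoff0
    have h₁ : ∀ s : I, IsClassOf (c₁ s).1 (flowH (s * transit σp σn v) (σn.toFun v.1).1) :=
      fun s => ⟨_, cutPoint_flowH hm0 hΓ s, rfl⟩
    have h₂ : ∀ s : I, IsClassOf (c₂ s).1 (flowJ ((1 - s) * θ 0) (σp.toFun v.1).1) :=
      fun s => ⟨_, cutPoint_one hm0 hΓ (div_mul_cancel _ _), rfl⟩
    have d0 := degrees_orbit hm0 hΓ hproj hu cJ hJ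
    have d1 := degrees_transit hm0 hΓ hproj hu c₁ c₂ hT h₁ h₂ (l := 0) (by simp)
    -- `quarterTurn` sends the degrees `(0, -1)` of `γ_J` and `(1, 0)` of `γ` to the standard basis.
    let e : H1 (projTm d.Γ σp σn ⁻¹' {v}) x ≃ₗ[ℤ] (Fin 2 → ℤ) :=
      ((degreesEquiv u x).trans quarterTurn).toIntLinearEquiv
    have he : ∀ c : Path x x, e (loopClass (Path.refl x) c) = quarterTurn (degrees u c) :=
      fun c => congr_arg quarterTurn (degreesH1_loopClass u (Path.refl x) c)
    refine ⟨Module.Basis.ofEquivFun e, cJ, P 1 1, c₁, c₂, transit σp σn v, θ 0, hJ,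
      transit_pos hm0 (hΓ _ v.2), hT, h₁, h₂, ?_, ?_⟩
    · rw [Module.Basis.coe_ofEquivFun, LinearEquiv.symm_apply_eq, he, d0]
      ext i; fin_cases i <;> simp [quarterTurn]
    · rw [Module.Basis.coe_ofEquivFun, LinearEquiv.symm_apply_eq, he, d1]
      ext i; fin_cases i <;> simp [quarterTurn]
  · rintro b ⟨cJ, y, c₁, c₂, T, θ', hJ, -, hT, h₁, h₂, hb0, hb1⟩
    have hθ' : Circle.exp (-θ') = Circle.exp (-θ 0) := by
      rw [← hoff0, (eq_transit hΓ hT).2]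
    -- Another choice of `θ'` changes `γ` by a multiple of `γ_J`, which the shear fixes; the matrix
    -- is unaffected.
    obtain ⟨l, hl⟩ := Circle.exp_eq_exp.1 hθ'
    have d0 := degrees_orbit hm0 hΓ hproj hu cJ hJ
    have d1 := degrees_transit hm0 hΓ hproj hu c₁ c₂ hT h₁ h₂ (l := -l)
      (by push_cast; linarith)
    have e0 : degreesH1 u x (b 0) = (0, -1) := by rw [hb0, degreesH1_loopClass, d0]
    have e1 : degreesH1 u x (b 1) = (1, -l) := by rw [hb1, degreesH1_loopClass, d1]
    have m0 : M (b 0) = b 0 := degreesH1_injective u x (by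
      rw [hMdeg, e0]; simp [IsTwistedTorus.shear])
    -- The shear takes `(1, -l)` to `(1, -l + 1) = (1, -l) - (0, -1)`: this is the sign of the
    -- monodromy number.
    have m1 : M (b 1) = b 1 - b 0 := degreesH1_injective u x (by
      rw [hMdeg, map_sub, e0, e1]; simp [IsTwistedTorus.shear])
    ext i j
    rw [LinearMap.toMatrix_apply]
    change b.repr (M (b j)) i = _
    fin_cases j
    · change b.repr (M (b 0)) i = _
      rw [m0]
      fin_cases i <;> simp
    · change b.repr (M (b 1)) i = _
      rw [m1]
      fin_cases i <;> simp

theorem HasMonodromyNumber.unique {D : Set (ℝ × ℝ)} {g : ReducedTriv D} {m : ℝ} {Γ : Set D}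
    {σp : EndSection g m} {σn : EndSection g (-m)} {v : Γ} {γ : Path v v} {k l : ℤ}
    (h : HasMonodromyNumber σp σn γ k) (h' : HasMonodromyNumber σp σn γ l) : k = l := by
  obtain ⟨-, -, x, hx, ⟨b, hb⟩, M, hM, hk⟩ := h
  obtain ⟨-, -, x', hx', -, M', hM', hl⟩ := h'
  obtain rfl : x = x' := Subtype.ext (hx.unique hx')
  obtain rfl : M = M' := (hM' M).1 ((hM M).2 rfl)
  have := (hk b hb).symm.trans (hl b hb)
  simpa using congr_fun (congr_fun this 0) 1

theorem hasNoncompactMonodromyNumber_iff {d : Disk} (hd : d.WindsOnce) (g : ReducedTriv d.D)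
    (h0 : F 0 ∈ d.D) (k : ℤ) : HasNoncompactMonodromyNumber g d.loop k ↔ k = -1 := by
  have key : ∀ m, |g.height ⟨0, h0⟩| < m →
      Nonempty (EndSection g m) ∧ Nonempty (EndSection g (-m)) := fun m hm =>
    ⟨nonempty_endSection_pos g h0 (abs_lt.1 hm).2, nonempty_endSection_neg g h0 (abs_lt.1 hm).1⟩
  constructor
  · rintro ⟨M, hM, h⟩
    have h1 := le_max_left M |g.height ⟨0, h0⟩|
    have h2 := le_max_right M |g.height ⟨0, h0⟩|
    -- Beyond both bounds sections exist, so the assumed number `k` can be compared with `-1` on an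
    -- actual `T_m`.
    have h3 : |g.height ⟨0, h0⟩| < max M |g.height ⟨0, h0⟩| + 1 := by linarith
    obtain ⟨⟨σp⟩, ⟨σn⟩⟩ := key _ h3
    exact ((h _ (by linarith)).2.2 σp σn).unique (hasMonodromyNumber hd h0 h3 σp σn)
  · rintro rfl
    refine ⟨|g.height ⟨0, h0⟩| + 1, by positivity, fun m hm => ?_⟩
    have hm' : |g.height ⟨0, h0⟩| < m := by linarith
    exact ⟨(key m hm').1, (key m hm').2, hasMonodromyNumber hd h0 hm'⟩

/-! ### The variation of a function with a continuous lift modulo `2π` -/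

theorem eventually_eq_of_tendsto_two_pi {X : Type*} {L : Filter X} {u : X → ℝ} {a : ℝ}
    (hu : Tendsto u L (𝓝 a)) (h : ∀ᶠ t in L, ∃ n : ℤ, u t = n * (2 * Real.pi)) :
    ∀ᶠ t in L, u t = a := by
  rcases L.eq_or_neBot with rfl | hL
  · exact eventually_bot
  have hπ := Real.pi_pos
  have h1 : ∀ᶠ t in L, |u t - a| < Real.pi := by
    simpa [Real.dist_eq] using Metric.tendsto_nhds.1 hu _ hπ
  obtain ⟨t₀, ht₀, n₀, hn₀⟩ := (h1.and h).exists
  have h2 : ∀ᶠ t in L, u t = u t₀ := by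
    filter_upwards [h1, h] with t ht ⟨n, hn⟩
    have h3 := abs_lt.1 ht
    have h4 := abs_lt.1 ht₀
    have h5 : ((n : ℝ) - n₀) * (2 * Real.pi) < 1 * (2 * Real.pi) := by linarith
    have h6 : (-1) * (2 * Real.pi) < ((n : ℝ) - n₀) * (2 * Real.pi) := by linarith
    have h7 := lt_of_mul_lt_mul_right h5 (by positivity)
    have h8 := lt_of_mul_lt_mul_right h6 (by positivity)
    have h9 : n - n₀ < 1 := by exact_mod_cast h7
    have h10 : -1 < n - n₀ := by exact_mod_cast h8
    have : n = n₀ := by omega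
    rw [hn, hn₀, this]
  have h3 : a = u t₀ := tendsto_nhds_unique hu (tendsto_const_nhds.congr' (h2.mono fun t ht => ht.symm))
  rwa [h3]

/-- `g - f` is a step function; subtracting the accumulated jumps `P` leaves a constant. Over one
period `g` returns, `f` gains `2π` and `P` gains the sum of the jumps, so this sum is `-2π`.
Punctured neighbourhoods are used throughout, since the values of `g` at its jumps are arbitrary. -/
theorem HasVariation.eq_two_pi {g f : ℝ → ℝ} {V : ℝ} (h : HasVariation g V) (hf : Continuous f)
    (hf1 : ∀ s, f (s + 1) = f s + 2 * Real.pi)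
    (hgf : ∀ s, ∀ᶠ t in 𝓝[≠] s, ∃ n : ℤ, g t - f t = n * (2 * Real.pi)) : V = 2 * Real.pi := by
  classical
  obtain ⟨hper, S, l, r, hS, hcont, hjump, rfl⟩ := h
  let u : ℝ → ℝ := fun t => g t - f t
  let P : ℝ → ℝ := fun t => ∑ a ∈ S, if a < t then r a - l a else 0
  let w : ℝ → ℝ := fun t => u t - P t
  -- one-sided limits
  have hleft : ∀ s ∈ Ico (0 : ℝ) 1, ∀ᶠ t in 𝓝[<] s,
      u t = (if s ∈ S then l s else g s) - f s := by
    intro s hs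
    refine eventually_eq_of_tendsto_two_pi ?_ ((hgf s).filter_mono (nhdsLT_le_nhdsNE s))
    refine Tendsto.sub ?_ hf.continuousAt.continuousWithinAt
    split_ifs with h
    · exact (hjump s h).1
    · exact (hcont s hs h).continuousWithinAt
  have hright : ∀ s ∈ Ico (0 : ℝ) 1, ∀ᶠ t in 𝓝[>] s,
      u t = (if s ∈ S then r s else g s) - f s := by
    intro s hs
    refine eventually_eq_of_tendsto_two_pi ?_ ((hgf s).filter_mono (nhdsGT_le_nhdsNE s))
    refine Tendsto.sub ?_ hf.continuousAt.continuousWithinAt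
    split_ifs with h
    · exact (hjump s h).2
    · exact (hcont s hs h).continuousWithinAt
  have hPleft : ∀ s, ∀ᶠ t in 𝓝[<] s, P t = P s := by
    intro s
    have : ∀ᶠ t in 𝓝[<] s, ∀ a ∈ S, (a < t ↔ a < s) := by
      rw [eventually_all_finset]
      intro a _
      rcases lt_or_ge a s with h | h
      · filter_upwards [Ioo_mem_nhdsLT h] with t ht
        exact ⟨fun _ => h, fun _ => ht.1⟩
      · filter_upwards [self_mem_nhdsWithin] with t ht
        exact ⟨fun h' => h'.trans ht, fun h' => absurd h' h.not_gt⟩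
    filter_upwards [this] with t ht
    exact Finset.sum_congr rfl fun a ha => by simp only [ht a ha]
  have hPright : ∀ s, ∀ᶠ t in 𝓝[>] s, P t = P s + if s ∈ S then r s - l s else 0 := by
    intro s
    have : ∀ᶠ t in 𝓝[>] s, ∀ a ∈ S, (a < t ↔ a ≤ s) := by
      rw [eventually_all_finset]
      intro a _
      rcases le_or_gt a s with h | h
      · filter_upwards [self_mem_nhdsWithin] with t ht
        exact ⟨fun _ => h, fun _ => h.trans_lt ht⟩
      · filter_upwards [Ioo_mem_nhdsGT h] with t ht
        exact ⟨fun h' => absurd h' ht.2.not_gt, fun h' => absurd h' h.not_ge⟩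
    filter_upwards [this] with t ht
    rw [← Finset.sum_ite_eq S s fun a => r a - l a, ← Finset.sum_add_distrib]
    refine Finset.sum_congr rfl fun a ha => ?_
    simp only [ht a ha]
    rcases lt_trichotomy a s with h | h | h
    · simp [h, h.le, h.ne']
    · simp [h]
    · simp [h.not_gt, h.not_ge, h.ne]
  have hk : ∀ s ∈ Ico (0 : ℝ) 1, ∃ k, ∀ᶠ t in 𝓝[≠] s, w t = k := by
    intro s hs
    refine ⟨(if s ∈ S then l s else g s) - f s - P s, ?_⟩
    rw [← nhdsLT_sup_nhdsGT, eventually_sup]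
    constructor
    · filter_upwards [hleft s hs, hPleft s] with t h1 h2
      simp only [w, h1, h2]
    · filter_upwards [hright s hs, hPright s] with t h1 h2
      simp only [w, h1, h2]
      split_ifs <;> ring
  choose! k hk using hk
  have hkeq : ∀ s ∈ Ico (0 : ℝ) 1, ∀ c, (∀ᶠ t in 𝓝 s, w t = c) → k s = c := by
    intro s hs c hc
    obtain ⟨t, h1, h2⟩ := ((hk s hs).and (hc.filter_mono nhdsWithin_le_nhds)).exists
    rw [← h1, h2]
  have hconst : IsLocallyConstant fun s : Ico (0 : ℝ) 1 => k s := by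
    rw [IsLocallyConstant.iff_eventually_eq]
    rintro ⟨s, hs⟩
    have h1 : ∀ᶠ t in 𝓝 s, t ≠ s → t ∈ Ico (0 : ℝ) 1 → k t = k s := by
      have h2 := eventually_eventually_nhdsWithin.2 (hk s hs)
      rw [eventually_nhdsWithin_iff] at h2
      filter_upwards [h2] with t ht hts htI
      have h3 := ht hts
      rw [isOpen_compl_singleton.nhdsWithin_eq hts] at h3
      exact hkeq t htI _ h3
    have h4 := (continuous_subtype_val.tendsto (⟨s, hs⟩ : Ico (0 : ℝ) 1)).eventually h1
    filter_upwards [h4] with t ht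
    by_cases hts : (t : ℝ) = s
    · simp only [hts]
    · exact ht hts t.2
  have h0 : (0 : ℝ) ∈ Ico (0 : ℝ) 1 := ⟨le_rfl, one_pos⟩
  have hP0 : ∀ t ≤ (0 : ℝ), P t = 0 := fun t ht =>
    Finset.sum_eq_zero fun a ha => if_neg (not_lt.2 (ht.trans (hS ha).1))
  -- comparison of the left neighbourhoods of `0` and `1`
  have hone : ∀ᶠ t in 𝓝[<] (1 : ℝ), w t = k 0 - 2 * Real.pi - ∑ a ∈ S, (r a - l a) := by
    have h1 : ∀ᶠ t in 𝓝[<] (0 : ℝ), w t = k 0 := (hk 0 h0).filter_mono (nhdsLT_le_nhdsNE 0)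
    have h2 : Tendsto (fun t : ℝ => t - 1) (𝓝[<] 1) (𝓝[<] 0) := by
      refine tendsto_nhdsWithin_iff.2 ⟨?_, ?_⟩
      · have : Tendsto (fun t : ℝ => t - 1) (𝓝 1) (𝓝 (1 - 1)) := by
          exact (continuous_id.sub continuous_const).tendsto 1
        rw [sub_self] at this
        exact this.mono_left nhdsWithin_le_nhds
      · filter_upwards [self_mem_nhdsWithin] with t ht
        exact sub_neg.2 (mem_Iio.1 ht)
    filter_upwards [h2.eventually h1, h2.eventually self_mem_nhdsWithin, hPleft 1] with t h3 h4 h5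
    have hP1 : P 1 = ∑ a ∈ S, (r a - l a) :=
      Finset.sum_congr rfl fun a ha => if_pos (hS ha).2
    have hg : g t = g (t - 1) := by simpa using hper (t - 1)
    have hft := hf1 (t - 1)
    rw [sub_add_cancel] at hft
    have hPt := hP0 _ (le_of_lt h4)
    simp only [w, u, hPt] at h3
    simp only [w, u, h5, hP1, hg, hft]
    linarith
  have h5 := eventually_eventually_nhdsWithin.2 hone
  have h6 : ∀ᶠ t in 𝓝[<] (1 : ℝ), t ∈ Ioo (0 : ℝ) 1 := Ioo_mem_nhdsLT one_pos
  obtain ⟨t, h7, h8⟩ := (h5.and h6).exists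
  rw [isOpen_Iio.nhdsWithin_eq h8.2] at h7
  have h9 := hkeq t ⟨h8.1.le, h8.2⟩ _ h7
  have : PreconnectedSpace (Ico (0 : ℝ) 1) := Subtype.preconnectedSpace isPreconnected_Ico
  have h10 := hconst.apply_eq_of_preconnectedSpace ⟨0, h0⟩ ⟨t, h8.1.le, h8.2⟩
  simp only at h10
  linarith

theorem eventually_notMem_of_periodic {E : Set ℝ} (hE : ∀ s ∈ E, ∀ n : ℤ, s + n ∈ E)
    (hfin : (E ∩ Ico 0 1).Finite) (s : ℝ) : ∀ᶠ t in 𝓝[≠] s, t ∉ E := by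
  let A : Set ℝ := image2 (fun a (n : ℤ) => a + n) (E ∩ Ico 0 1) (Icc ⌊s - 1⌋ ⌊s + 1⌋)
  have hA : A.Finite := hfin.image2 _ (finite_Icc _ _)
  have h1 : ∀ᶠ t in 𝓝 s, t ∉ A \ {s} :=
    (hA.subset sdiff_subset).isClosed.isOpen_compl.mem_nhds (by simp)
  have h2 : ∀ᶠ t in 𝓝 s, t ∈ Ioo (s - 1) (s + 1) := Ioo_mem_nhds (by linarith) (by linarith)
  filter_upwards [nhdsWithin_le_nhds h1, nhdsWithin_le_nhds h2, self_mem_nhdsWithin] with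
    t h3 h4 h5 h6
  refine h3 ⟨⟨Int.fract t, ⟨?_, Int.fract_nonneg t, Int.fract_lt_one t⟩, ⌊t⌋,
    ⟨Int.floor_le_floor h4.1.le, Int.floor_le_floor h4.2.le⟩, Int.fract_add_floor t⟩, h5⟩
  have := hE t h6 (-⌊t⌋)
  rwa [Int.cast_neg, ← sub_eq_add_neg] at this

/-- On intervals free of `E` the function `g` is `f` plus a constant, so one-sided limits exist
everywhere. Thus `g` has some variation, and `HasVariation.eq_two_pi` gives its value. -/
theorem hasVariation_two_pi {g f : ℝ → ℝ} (hg : Function.Periodic g 1) (hf : Continuous f)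
    (hf1 : ∀ s, f (s + 1) = f s + 2 * Real.pi) {E : Set ℝ}
    (hE : ∀ s ∈ E, ∀ n : ℤ, s + n ∈ E) (hfin : (E ∩ Ico 0 1).Finite)
    (hcont : ∀ s ∉ E, ContinuousAt g s)
    (hgf : ∀ s ∉ E, ∃ n : ℤ, g s - f s = n * (2 * Real.pi)) (V : ℝ) :
    HasVariation g V ↔ V = 2 * Real.pi := by
  have hev := eventually_notMem_of_periodic hE hfin
  have huniq : ∀ V, HasVariation g V → V = 2 * Real.pi := fun V h =>
    h.eq_two_pi hf hf1 fun s => (hev s).mono fun t ht => hgf t ht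
  have hlim : ∀ (s : ℝ) (J : Set ℝ), IsPreconnected J → (∀ t ∈ J, t ∉ E) → J.Nonempty →
      ∃ a, Tendsto g (𝓝[J] s) (𝓝 a) := by
    rintro s J hJ hJE ⟨t₀, ht₀⟩
    have hc : ContinuousOn (fun t => g t - f t) J := fun t ht =>
      ((hcont t (hJE t ht)).sub hf.continuousAt).continuousWithinAt
    refine ⟨f s + (g t₀ - f t₀), ?_⟩
    have h1 : Tendsto (fun t => f t + (g t₀ - f t₀)) (𝓝[J] s) (𝓝 (f s + (g t₀ - f t₀))) :=
      (hf.continuousAt.continuousWithinAt).add_const _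
    refine h1.congr' ?_
    filter_upwards [self_mem_nhdsWithin] with t ht
    have := eq_of_mem_two_pi_int hJ hc (fun t ht => hgf t (hJE t ht)) ht ht₀
    linarith
  have hl : ∀ s, ∃ a, Tendsto g (𝓝[<] s) (𝓝 a) := by
    intro s
    have h1 : ∀ᶠ t in 𝓝[<] s, t ∉ E := (hev s).filter_mono (nhdsLT_le_nhdsNE s)
    obtain ⟨b, hb, hbE⟩ := (mem_nhdsLT_iff_exists_Ioo_subset.1 h1)
    have hne : (Ioo b s).Nonempty := nonempty_Ioo.2 hb
    obtain ⟨a, ha⟩ := hlim s (Ioo b s) isPreconnected_Ioo (fun t ht => hbE ht) hne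
    exact ⟨a, by rwa [nhdsWithin_Ioo_eq_nhdsLT hb] at ha⟩
  have hr : ∀ s, ∃ a, Tendsto g (𝓝[>] s) (𝓝 a) := by
    intro s
    have h1 : ∀ᶠ t in 𝓝[>] s, t ∉ E := (hev s).filter_mono (nhdsGT_le_nhdsNE s)
    obtain ⟨b, hb, hbE⟩ := (mem_nhdsGT_iff_exists_Ioo_subset.1 h1)
    have hne : (Ioo s b).Nonempty := nonempty_Ioo.2 hb
    obtain ⟨a, ha⟩ := hlim s (Ioo s b) isPreconnected_Ioo (fun t ht => hbE ht) hne
    exact ⟨a, by rwa [nhdsWithin_Ioo_eq_nhdsGT hb] at ha⟩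
  choose l hl using hl
  choose r hr using hr
  refine ⟨huniq V, ?_⟩
  rintro rfl
  have key : HasVariation g (-∑ s ∈ hfin.toFinset, (r s - l s)) := by
    refine ⟨hg, hfin.toFinset, l, r, ?_, fun s hs hsS => hcont s fun hsE => hsS ?_,
      fun s _ => ⟨hl s, hr s⟩, rfl⟩
    · intro s hs
      simp only [Finite.coe_toFinset] at hs
      exact hs.2
    · simp only [Finite.mem_toFinset]
      exact ⟨hsE, hs⟩
  rwa [← huniq _ key]

/-- A continuous argument of the boundary path. -/
theorem Disk.WindsOnce.exists_arg {d : Disk} (h : d.WindsOnce) : ∃ θ : ℝ → ℝ, Continuous θ ∧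
    (∀ s, θ (s + 1) = θ s + 2 * Real.pi) ∧ ∀ s, Circle.exp (θ s) = dir (val (d.bdry s).1) := by
  obtain ⟨θ, hc, h1, hθ⟩ := h
  have hd : ∀ s, Circle.exp (θ s) = dir (val (d.bdry s).1) := fun s => by
    obtain ⟨ρ, hρ, h⟩ := hθ s
    exact (dir_eq hρ h).symm
  refine ⟨θ, hc, fun s => ?_, hd⟩
  have := eq_of_mem_two_pi_int isPreconnected_univ (u := fun s => θ (s + 1) - θ s)
    (by fun_prop) (fun t _ => by
      have h2 : Circle.exp (θ (t + 1)) = Circle.exp (θ t) := by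
        rw [hd, hd, d.periodic_bdry]
      obtain ⟨n, hn⟩ := Circle.exp_eq_exp.1 h2
      exact ⟨n, by linarith⟩) (mem_univ s) (mem_univ 0)
  simp only [zero_add] at this
  linarith

/-! ### Scattering monodromy -/

theorem tendsto_direction {L : Filter ℝ} {a b : ℂ} (ha : a ≠ 0) {c e : ℝ → ℝ} (hc : ∀ t, 0 < c t)
    (he : Tendsto e L (𝓝 0)) {z : ℝ → ℂ} (hz : ∀ t, z t = c t * (a + e t * b)) :
    Tendsto (fun t => z t / (‖z t‖ : ℂ)) L (𝓝 (dir a)) := by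
  have h1 : Tendsto (fun t => a + (e t : ℂ) * b) L (𝓝 a) := by
    have := ((Complex.continuous_ofReal.tendsto 0).comp he).mul_const b
    simpa using this.const_add a
  have h2 : Tendsto (fun t => (a + (e t : ℂ) * b) / (‖a + (e t : ℂ) * b‖ : ℂ)) L
      (𝓝 (a / ‖a‖)) :=
    h1.div ((Complex.continuous_ofReal.tendsto _).comp h1.norm)
      (by exact_mod_cast norm_ne_zero_iff.2 ha)
  rw [coe_dir ha]
  refine h2.congr fun t => ?_
  have h3 : (c t : ℂ) ≠ 0 := by exact_mod_cast (hc t).ne'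
  rw [hz, norm_mul, Complex.norm_real, Real.norm_eq_abs, abs_of_pos (hc t), Complex.ofReal_mul,
    mul_div_mul_left _ _ h3]

/-- Since `z₁ = (e^t a + e^{-t} b) / 2`, its direction tends to `dir a` at `+∞` and to `dir b` at
`-∞`, and `dir_unst` gives their quotient. -/
theorem isScatteringAngle_iff {x : Phase} (h : F x ≠ 0) (θ : ℝ) :
    IsScatteringAngle x θ ↔ Circle.exp θ = dir (val (F x)) := by
  have hz : ∀ t, (flowH t x).1 = (Real.exp t * unst x + Real.exp (-t) * stab x) / 2 := fun t => by
    rw [fst_eq, unst_flowH, stab_flowH]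
  have htop : Tendsto (fun t : ℝ => (flowH t x).1 / (‖(flowH t x).1‖ : ℂ)) atTop
      (𝓝 (dir (unst x))) := by
    refine tendsto_direction (unst_ne_zero h) (b := stab x) (c := fun t => Real.exp t / 2)
      (e := fun t => Real.exp (-(2 * t))) (fun t => by positivity) ?_ fun t => ?_
    · exact Real.tendsto_exp_neg_atTop_nhds_zero.comp (tendsto_id.const_mul_atTop two_pos)
    · have : (Real.exp t : ℂ) * Real.exp (-(2 * t)) = Real.exp (-t) := by
        rw [← Complex.ofReal_mul, ← Real.exp_add]; ring_nf
      rw [hz, Complex.ofReal_div, Complex.ofReal_ofNat]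
      linear_combination -(stab x / 2) * this
  have hbot : Tendsto (fun t : ℝ => (flowH t x).1 / (‖(flowH t x).1‖ : ℂ)) atBot
      (𝓝 (dir (stab x))) := by
    refine tendsto_direction (stab_ne_zero h) (b := unst x) (c := fun t => Real.exp (-t) / 2)
      (e := fun t => Real.exp (2 * t)) (fun t => by positivity) ?_ fun t => ?_
    · exact Real.tendsto_exp_atBot.comp (tendsto_id.const_mul_atBot two_pos)
    · have : (Real.exp (-t) : ℂ) * Real.exp (2 * t) = Real.exp t := by
        rw [← Complex.ofReal_mul, ← Real.exp_add]; ring_nf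
      rw [hz, Complex.ofReal_div, Complex.ofReal_ofNat]
      linear_combination -(unst x / 2) * this
  have hu := dir_unst h
  have hiff : (dir (unst x) : ℂ) = Complex.exp (-(θ * Complex.I)) * dir (stab x) ↔
      Circle.exp θ = dir (val (F x)) := by
    rw [← coe_circleExp_neg, ← Circle.coe_mul, Circle.coe_inj, hu, mul_left_inj, Circle.exp_neg,
      inv_inj, eq_comm]
  constructor
  · rintro ⟨e₁, e₂, h1, h2, -, h3⟩
    rw [tendsto_nhds_unique h1 hbot, tendsto_nhds_unique h2 htop] at h3
    exact hiff.1 h3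
  · intro h'
    exact ⟨_, _, hbot, htop, Circle.norm_coe _, hiff.2 h'⟩

theorem isScatteringMonodromyNumber_iff {d : Disk} (hd : d.WindsOnce) (k : ℤ) :
    IsScatteringMonodromyNumber (fun s => (d.bdry s).1) k ↔ k = -1 := by
  obtain ⟨θ, hc, h1, hθ⟩ := hd.exists_arg
  have hπ := Real.two_pi_pos
  constructor
  · rintro ⟨Θ, hΘ, hV⟩
    have h2 : -(2 * Real.pi * k) = 2 * Real.pi := by
      refine hV.eq_two_pi hc h1 fun s => Eventually.of_forall fun t => ?_
      obtain ⟨x, hx, -⟩ := exists_F_rise (d.bdry t).1 0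
      have h3 := (isScatteringAngle_iff (hx ▸ hd.bdry_ne_zero t) _).1 (hΘ t x hx)
      rw [hx, ← hθ] at h3
      obtain ⟨n, hn⟩ := Circle.exp_eq_exp.1 h3
      exact ⟨n, by linarith⟩
    have h3 : (2 * Real.pi) * (k : ℝ) = (2 * Real.pi) * (-1) := by linarith
    exact_mod_cast mul_left_cancel₀ hπ.ne' h3
  · rintro rfl
    have hdir : ∀ s, Circle.exp (θ (Int.fract s)) = dir (val (d.bdry s).1) := fun s => by
      rw [hθ, Int.fract]
      have := d.periodic_bdry.sub_zsmul_eq (x := s) ⌊s⌋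
      rw [zsmul_one] at this
      rw [this]
    -- This representative is continuous off the integers, where it jumps by `-2π`.
    refine ⟨fun s => θ (Int.fract s), fun s x hx => ?_, ?_⟩
    · rw [isScatteringAngle_iff (hx ▸ hd.bdry_ne_zero s), hx, hdir]
    · rw [hasVariation_two_pi (E := range ((↑) : ℤ → ℝ)) (fun s => by simp) hc h1]
      · push_cast; ring
      · rintro _ ⟨a, rfl⟩ n
        exact ⟨a + n, by push_cast; rfl⟩
      · refine (finite_singleton (0 : ℝ)).subset ?_
        rintro _ ⟨⟨a, rfl⟩, h2, h3⟩
        have h2' : 0 ≤ a := by exact_mod_cast h2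
        have h3' : a < 1 := by exact_mod_cast h3
        have : a = 0 := by omega
        simp [this]
      · intro s hs
        have h4 : ContinuousAt Int.fract s := by
          refine continuousAt_fract fun h => hs ⟨⌊s⌋, h.symm⟩
        exact hc.continuousAt.comp h4
      · intro s _
        obtain ⟨n, hn⟩ := Circle.exp_eq_exp.1 ((hdir s).trans (hθ s).symm)
        exact ⟨n, by linarith⟩

/-! ### Local monodromy -/

theorem sq_norm_unst (x : Phase) :
    ‖unst x‖ ^ 2 = (x.1.re - x.2.im) ^ 2 + (x.1.im - x.2.re) ^ 2 := by
  rw [← Complex.normSq_eq_norm_sq, Complex.normSq_apply]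
  simp [unst]
  ring

theorem sq_norm_stab (x : Phase) :
    ‖stab x‖ ^ 2 = (x.1.re + x.2.im) ^ 2 + (x.1.im + x.2.re) ^ 2 := by
  rw [← Complex.normSq_eq_norm_sq, Complex.normSq_apply]
  simp [stab]
  ring

theorem mem_ballB_iff (r : ℝ) (x : Phase) :
    x ∈ ballB r ↔ (‖unst x‖ ^ 2 + ‖stab x‖ ^ 2) / 4 < r := by
  rw [sq_norm_unst, sq_norm_stab, ballB, mem_ofPred_eq]
  constructor <;> intro h <;> nlinarith

/-- Half the squared norm of `x` plus `J` is `q₁² + p₁²`. Since `H` and `J` are constant along the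
orbit, only the half squared norm depends on time. -/
theorem rotForm_hamVec (x : Phase) : rotForm x (hamVec H x) =
    H x / ((‖unst x‖ ^ 2 + ‖stab x‖ ^ 2) / 4 + J x) := by
  rw [hamVec_H, rotForm, sq_norm_unst, sq_norm_stab, H, J]
  congr 1
  · simp
    ring
  · ring

/-- A combination of `e^{2t}` and `e^{-2t}` with positive coefficients is a shifted hyperbolic
cosine; its amplitude is `|a| |b| / 2 = |val|`. -/
theorem half_sq_norm_flowH {x : Phase} (h : F x ≠ 0) : ∃ δ : ℝ, ∀ t,
    (‖unst (flowH t x)‖ ^ 2 + ‖stab (flowH t x)‖ ^ 2) / 4 =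
      ‖val (F x)‖ * Real.cosh (2 * (t + δ)) := by
  have ha := norm_pos_iff.2 (unst_ne_zero h)
  have hb := norm_pos_iff.2 (stab_ne_zero h)
  refine ⟨Real.log (‖unst x‖ / ‖stab x‖) / 2, fun t => ?_⟩
  have hn := norm_unst_mul_norm_stab x
  have e1 : Real.exp (2 * (t + Real.log (‖unst x‖ / ‖stab x‖) / 2)) =
      Real.exp t ^ 2 * (‖unst x‖ / ‖stab x‖) := by
    rw [mul_add, mul_div_cancel₀ _ two_ne_zero, Real.exp_add, Real.exp_log (div_pos ha hb), two_mul,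
      Real.exp_add, sq]
  have hv : ‖val (F x)‖ = ‖unst x‖ * ‖stab x‖ / 2 := by rw [hn]; ring
  rw [Real.cosh_eq, Real.exp_neg, e1, hv, unst_flowH, stab_flowH]
  simp only [norm_mul, Complex.norm_real, Real.norm_eq_abs, Real.abs_exp]
  rw [Real.exp_neg]
  have := Real.exp_pos t
  field_simp
  ring

/-- The primitive of the integrand of `Φ_rel`. -/
theorem hasDerivAt_arctan_tanh {θ : ℝ} (hθ : Real.cos (θ / 2) ≠ 0) (t : ℝ) :
    HasDerivAt (fun t => Real.arctan (Real.sinh t / Real.cosh t * Real.tan (θ / 2)))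
      (Real.sin θ / (Real.cosh (2 * t) + Real.cos θ)) t := by
  have hc := (Real.cosh_pos t).ne'
  have h1 : HasDerivAt (fun t => Real.arctan (Real.sinh t / Real.cosh t * Real.tan (θ / 2)))
      (1 / (1 + (Real.sinh t / Real.cosh t * Real.tan (θ / 2)) ^ 2) *
        ((Real.cosh t * Real.cosh t - Real.sinh t * Real.sinh t) / Real.cosh t ^ 2 *
          Real.tan (θ / 2))) t := ((((Real.hasDerivAt_sinh t).div (Real.hasDerivAt_cosh t) hc).mul_const
    (Real.tan (θ / 2))).arctan)
  convert h1 using 1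
  have hs2 : Real.sin θ = 2 * Real.sin (θ / 2) * Real.cos (θ / 2) := by
    rw [← Real.sin_two_mul]; ring_nf
  have hc2 : Real.cos θ = 2 * Real.cos (θ / 2) ^ 2 - 1 := by
    rw [← Real.cos_two_mul]; ring_nf
  have hch := Real.cosh_sq t
  have hsc := Real.sin_sq_add_cos_sq (θ / 2)
  rw [hs2, hc2, Real.cosh_two_mul, Real.tan_eq_sin_div_cos]
  have hden : Real.cosh t ^ 2 + Real.sinh t ^ 2 + (2 * Real.cos (θ / 2) ^ 2 - 1) ≠ 0 := by
    have : 0 < Real.cos (θ / 2) ^ 2 := by positivity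
    nlinarith [sq_nonneg (Real.sinh t)]
  have hden2 : (1 + (Real.sinh t / Real.cosh t * (Real.sin (θ / 2) / Real.cos (θ / 2))) ^ 2) ≠ 0 := by
    positivity
  have e : (1 + (Real.sinh t / Real.cosh t * (Real.sin (θ / 2) / Real.cos (θ / 2))) ^ 2) =
      (Real.cosh t ^ 2 + Real.sinh t ^ 2 + (2 * Real.cos (θ / 2) ^ 2 - 1)) /
        (2 * Real.cosh t ^ 2 * Real.cos (θ / 2) ^ 2) := by
    field_simp
    linear_combination (2 * Real.sinh t ^ 2) * hsc + (2 * Real.cos (θ / 2) ^ 2 - 1) * hch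
  have e2 : (Real.cosh t * Real.cosh t - Real.sinh t * Real.sinh t) = 1 := by
    linear_combination hch
  rw [e, e2]
  field_simp

/-- The orbit is in the ball exactly for `|t + δ| < τ` with `cosh 2τ = r / ρ`, and the square root
is `tanh τ`. The integrand `sin θ / (cosh 2t + cos θ)` has the primitive `arctan (tanh t · tan
(θ/2))`. -/
theorem phiRel_eq {r : ℝ} {x : Phase} (h : F x ≠ 0) (hr : ‖val (F x)‖ < r) {θ : ℝ}
    (hθ : Circle.exp θ = dir (val (F x))) :
    phiRel r x = 2 * Real.arctan
      (Real.sqrt ((r - ‖val (F x)‖) / (r + ‖val (F x)‖)) * Real.tan (θ / 2)) := by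
  obtain ⟨δ, hδ⟩ := half_sq_norm_flowH h
  set ρ := ‖val (F x)‖ with hρ
  have hρ0 : 0 < ρ := norm_pos_iff.2 (val_ne_zero h)
  have hval : val (F x) = ρ * Complex.exp (θ * Complex.I) := by
    rw [← Circle.coe_exp, hθ, hρ, norm_mul_dir]
  have hJ : ∀ t, J (flowH t x) = ρ * Real.cos θ := fun t => by
    have h1 := congr_arg Complex.re hval
    have h2 : J (flowH t x) = (F x).2 := congr_arg Prod.snd (F_flowH t x)
    rw [h2]
    simpa [val, Complex.exp_re] using h1
  have hH : ∀ t, H (flowH t x) = ρ * Real.sin θ := fun t => by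
    have h1 := congr_arg Complex.im hval
    have h2 : H (flowH t x) = (F x).1 := congr_arg Prod.fst (F_flowH t x)
    rw [h2]
    simpa [val, Complex.exp_im] using h1
  set τ := Real.arcosh (r / ρ) / 2 with hτ
  have hrρ : 1 < r / ρ := (one_lt_div hρ0).2 hr
  have hτ0 : 0 < τ := half_pos (Real.arcosh_pos hrρ)
  have hcτ : Real.cosh (2 * τ) = r / ρ := by
    rw [hτ, mul_div_cancel₀ _ two_ne_zero, Real.cosh_arcosh hrρ.le]
  have hset : {t : ℝ | flowH t x ∈ ballB r} = Ioo (-τ - δ) (τ - δ) := by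
    ext t
    rw [mem_ofPred_eq, mem_ballB_iff, hδ, ← lt_div_iff₀' hρ0, ← hcτ, Real.cosh_lt_cosh, abs_mul,
      abs_mul, mul_lt_mul_iff_right₀ (by norm_num), abs_of_pos hτ0, abs_lt, mem_Ioo]
    constructor <;> rintro ⟨h1, h2⟩ <;> constructor <;> linarith
  have h_integrand : ∀ t, rotForm (flowH t x) (hamVec H (flowH t x)) =
      Real.sin θ / (Real.cosh (2 * (t + δ)) + Real.cos θ) := fun t => by
    rw [rotForm_hamVec, hδ, hJ, hH, ← mul_add, mul_div_mul_left _ _ hρ0.ne']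
  have hκ : Real.sqrt ((r - ρ) / (r + ρ)) = Real.sinh τ / Real.cosh τ := by
    have hs := Real.sinh_pos_iff.2 hτ0
    have hc := Real.cosh_pos τ
    rw [Real.sqrt_eq_iff_mul_self_eq (div_nonneg (by linarith) (by linarith)) (by positivity)]
    have h1 : r = ρ * (Real.cosh τ ^ 2 + Real.sinh τ ^ 2) := by
      rw [← Real.cosh_two_mul, hcτ, mul_div_cancel₀ _ hρ0.ne']
    have hch := Real.cosh_sq τ
    have h2 : r - ρ = 2 * ρ * Real.sinh τ ^ 2 := by rw [h1, hch]; ring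
    have h3 : r + ρ = 2 * ρ * Real.cosh τ ^ 2 := by
      rw [h1, ← sub_eq_iff_eq_add.2 hch]; ring
    rw [h2, h3]
    field_simp
  rw [phiRel, hset, hκ, ← MeasureTheory.integral_Ioc_eq_integral_Ioo,
    ← intervalIntegral.integral_of_le (by linarith)]
  simp only [h_integrand]
  rw [intervalIntegral.integral_comp_add_right
    (fun t => Real.sin θ / (Real.cosh (2 * t) + Real.cos θ)) δ]
  -- Over the image of the polar set the numerator `sin θ` vanishes and `tan (θ / 2)` has its
  -- default value `0`, so both sides are `0`.
  by_cases hcos : Real.cos (θ / 2) = 0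
  · have hs2 : Real.sin θ = 0 := by
      rw [show θ = 2 * (θ / 2) by ring, Real.sin_two_mul, hcos, mul_zero]
    simp [hs2, Real.tan_eq_sin_div_cos, hcos]
  · rw [intervalIntegral.integral_eq_sub_of_hasDerivAt
      (fun t _ => hasDerivAt_arctan_tanh hcos t)]
    · simp only [sub_add_cancel, Real.sinh_neg, Real.cosh_neg, neg_div, neg_mul, Real.arctan_neg]
      ring
    · refine Continuous.intervalIntegrable (Continuous.div (by fun_prop) (by fun_prop) ?_) _ _
      intro t
      have h1 := Real.one_le_cosh (2 * t)
      have h2 : Real.cos θ = 2 * Real.cos (θ / 2) ^ 2 - 1 := by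
        rw [← Real.cos_two_mul]; ring_nf
      have h3 : 0 < Real.cos (θ / 2) ^ 2 := by positivity
      linarith

/-- The continuous version of `2 arctan (κ tan (θ / 2))`. -/
def arctanLift (κ θ : ℝ) : ℝ :=
  θ + 2 * Real.arctan ((κ - 1) * (Real.sin (θ / 2) * Real.cos (θ / 2)) /
    (Real.cos (θ / 2) ^ 2 + κ * Real.sin (θ / 2) ^ 2))

theorem cos_sq_add_mul_sin_sq_pos {κ : ℝ} (hκ : 0 < κ) (x : ℝ) :
    0 < Real.cos x ^ 2 + κ * Real.sin x ^ 2 := by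
  have h := Real.sin_sq_add_cos_sq x
  by_cases hc : Real.cos x = 0
  · have : Real.sin x ^ 2 = 1 := by rw [hc] at h; linarith
    rw [hc, this]; linarith
  · positivity

theorem arctanLift_add_two_pi (κ θ : ℝ) :
    arctanLift κ (θ + 2 * Real.pi) = arctanLift κ θ + 2 * Real.pi := by
  have h : (θ + 2 * Real.pi) / 2 = θ / 2 + Real.pi := by ring
  simp only [arctanLift, h, Real.sin_add_pi, Real.cos_add_pi, neg_mul_neg, neg_sq]
  ring

/-- `arctan (κ tan y) - y` has tangent `(κ - 1) sin y cos y / (cos² y + κ sin² y)`, whose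
denominator never vanishes. With `y = θ / 2` the angles agree modulo `π`, and doubling gives `2π`.
-/
theorem arctan_sub_arctanLift {κ θ : ℝ} (hκ : 0 < κ) (hθ : Real.cos (θ / 2) ≠ 0) :
    ∃ n : ℤ, 2 * Real.arctan (κ * Real.tan (θ / 2)) - arctanLift κ θ = n * (2 * Real.pi) := by
  set s := Real.sin (θ / 2) with hs
  set c := Real.cos (θ / 2) with hc
  set Q := (κ - 1) * (s * c) / (c ^ 2 + κ * s ^ 2) with hQ
  set α := Real.arctan (κ * Real.tan (θ / 2)) with hα
  set β := Real.arctan Q with hβ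
  have hden := cos_sq_add_mul_sin_sq_pos hκ (θ / 2)
  have hQ' : Q * (c ^ 2 + κ * s ^ 2) = (κ - 1) * (s * c) := div_mul_cancel₀ _ hden.ne'
  have hsα : Real.sin α = κ * Real.tan (θ / 2) * Real.cos α := by
    rw [← Real.tan_mul_cos (Real.cos_arctan_pos _).ne', hα, Real.tan_arctan]
  have hsβ : Real.sin β = Q * Real.cos β := by
    rw [← Real.tan_mul_cos (Real.cos_arctan_pos _).ne', hβ, Real.tan_arctan]
  have key : Real.sin (α - (β + θ / 2)) = 0 := by
    rw [Real.sin_sub, Real.cos_add, Real.sin_add, hsα, hsβ, ← hs, ← hc, Real.tan_eq_sin_div_cos,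
      ← hs, ← hc]
    field_simp
    linear_combination -Real.cos α * Real.cos β * hQ'
  obtain ⟨n, hn⟩ := Real.sin_eq_zero_iff.1 key
  refine ⟨n, ?_⟩
  rw [arctanLift, ← hs, ← hc, ← hQ, ← hβ]
  linarith

theorem norm_val_sq (v : ℝ × ℝ) : ‖val v‖ ^ 2 = v.1 ^ 2 + v.2 ^ 2 := by
  rw [← Complex.normSq_eq_norm_sq, Complex.normSq_apply]
  simp [val]
  ring

theorem exists_mem_polar {v : ℝ × ℝ} (h1 : v.1 = 0) (h2 : v.2 ≤ 0) :
    ∃ x : Phase, x.1 = 0 ∧ F x = v := by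
  refine ⟨(0, (Real.sqrt (-2 * v.2) : ℝ)), rfl, Prod.ext (by simp [F, H, h1]) ?_⟩
  have := Real.sq_sqrt (show 0 ≤ -2 * v.2 by linarith)
  simp only [F, J, Complex.zero_re, Complex.zero_im, Complex.ofReal_re, Complex.ofReal_im, this]
  ring

theorem isLocalMonodromyNumber_iff {d : Disk} (hd : d.WindsOnce) {r : ℝ} (hr0 : 0 < r)
    (hr : ∀ s, (d.bdry s).1.1 ^ 2 + (d.bdry s).1.2 ^ 2 < r ^ 2)
    (hfin : {s ∈ Ico (0 : ℝ) 1 | ∃ x : Phase, x.1 = 0 ∧ F x = (d.bdry s).1}.Finite) (k : ℤ) :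
    IsLocalMonodromyNumber r (fun s => (d.bdry s).1) k ↔ k = -1 := by
  obtain ⟨θ, hc, h1, hθ⟩ := hd.exists_arg
  let ρ : ℝ → ℝ := fun s => ‖val (d.bdry s).1‖
  have hρc : Continuous ρ := (continuous_val.comp
    (continuous_subtype_val.comp d.continuous_bdry)).norm
  have hρ0 : ∀ s, 0 < ρ s := fun s => norm_pos_iff.2 (val_ne_zero (hd.bdry_ne_zero s))
  have hρr : ∀ s, ρ s < r := fun s =>
    lt_of_pow_lt_pow_left₀ 2 hr0.le ((norm_val_sq _).trans_lt (hr s))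
  let κ : ℝ → ℝ := fun s => Real.sqrt ((r - ρ s) / (r + ρ s))
  have hκ0 : ∀ s, 0 < κ s := fun s =>
    Real.sqrt_pos.2 (div_pos (by linarith [hρr s]) (by linarith [hρ0 s]))
  have hκc : Continuous κ := Real.continuous_sqrt.comp
    (Continuous.div (by fun_prop) (by fun_prop) fun s => by linarith [hρ0 s])
  have hκ1 : ∀ s, κ (s + 1) = κ s := fun s => by simp only [κ, ρ, d.periodic_bdry s]
  let f : ℝ → ℝ := fun s => arctanLift (κ s) (θ s)
  have hfc : Continuous f := by
    refine hc.add (continuous_const.mul (Real.continuous_arctan.comp ?_))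
    exact Continuous.div (by fun_prop) (by fun_prop)
      fun s => (cos_sq_add_mul_sin_sq_pos (hκ0 s) _).ne'
  have hf1 : ∀ s, f (s + 1) = f s + 2 * Real.pi := fun s => by
    simp only [f, hκ1, h1, arctanLift_add_two_pi]
  let φ : ℝ → ℝ := fun s => 2 * Real.arctan (κ s * Real.tan (θ s / 2))
  have hφ1 : Function.Periodic φ 1 := fun s => by
    have h2 : (θ s + 2 * Real.pi) / 2 = θ s / 2 + Real.pi := by ring
    simp only [φ, hκ1, h1, h2, Real.tan_add_pi]
  have hθper : ∀ s, Real.cos (θ s / 2) = 0 ↔ Real.cos (θ (s + 1) / 2) = 0 := fun s => by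
    have h2 : (θ s + 2 * Real.pi) / 2 = θ s / 2 + Real.pi := by ring
    rw [h1, h2, Real.cos_add_pi, neg_eq_zero]
  have hVar : ∀ V, HasVariation φ V ↔ V = 2 * Real.pi := by
    -- These are the parameters where `val` lies on the negative `j`-axis; by `exists_mem_polar`
    -- they are among the finitely many meeting points with the image of the polar set.
    refine hasVariation_two_pi (E := {s | Real.cos (θ s / 2) = 0}) hφ1 hfc hf1 ?_ ?_ ?_ ?_
    · have hper : Function.Periodic (fun s => Real.cos (θ s / 2) = 0) 1 :=
        fun s => propext (hθper s).symm
      intro s hs n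
      have := hper.zsmul n s
      rw [zsmul_one] at this
      exact this.mpr hs
    · refine hfin.subset ?_
      rintro s ⟨hs, hsI⟩
      refine ⟨hsI, ?_⟩
      have hval : val (d.bdry s).1 = ρ s * Complex.exp (θ s * Complex.I) := by
        rw [← Circle.coe_exp, hθ, norm_mul_dir]
      have hs' : Real.cos (θ s / 2) = 0 := hs
      have hsin : Real.sin (θ s) = 0 := by
        rw [show θ s = 2 * (θ s / 2) by ring, Real.sin_two_mul, hs', mul_zero]
      have hcos : Real.cos (θ s) = -1 := by
        rw [show θ s = 2 * (θ s / 2) by ring, Real.cos_two_mul, hs']; norm_num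
      refine exists_mem_polar ?_ ?_
      · have := congr_arg Complex.im hval
        simpa [val, Complex.exp_im, hsin] using this
      · have := congr_arg Complex.re hval
        have h3 : (d.bdry s).1.2 = -ρ s := by
          simpa [val, Complex.exp_re, hcos] using this
        rw [h3]
        linarith [hρ0 s]
    · intro s hs
      have h3 : ContinuousAt (fun s => Real.tan (θ s / 2)) s :=
        (Real.continuousAt_tan.2 hs).comp (f := fun s => θ s / 2) (by fun_prop)
      exact continuousAt_const.mul (Real.continuous_arctan.continuousAt.comp
        (hκc.continuousAt.mul h3))
    · intro s hs
      exact arctan_sub_arctanLift (hκ0 s) hs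
  have hphi : ∀ x : ℝ → Phase, (∀ s, F (x s) = (d.bdry s).1) →
      (fun s => phiRel r (x s)) = φ := by
    intro x hx
    funext s
    have := phiRel_eq (r := r) (x := x s) (θ := θ s) (by rw [hx]; exact hd.bdry_ne_zero s)
      (by rw [hx]; exact hρr s) (by rw [hx]; exact hθ s)
    rw [this, hx]
  constructor
  · intro h
    -- The definition quantifies over all choices of points in the fibres; exhibiting one keeps it
    -- from being vacuous. The height `0` is arbitrary.
    choose x hx _ using fun s => exists_F_rise (d.bdry s).1 0
    have h2 := h x hx
    rw [hphi x hx, hVar] at h2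
    have h3 : (2 * Real.pi) * (k : ℝ) = (2 * Real.pi) * (-1) := by linarith
    exact_mod_cast mul_left_cancel₀ Real.two_pi_pos.ne' h3
  · rintro rfl x hx
    rw [hphi x hx, hVar]
    push_cast
    ring

end FocusFocus

end

open FocusFocus

theorem mainTheorem5 (d : Disk) (hreg : ∀ s, IsRegularValue (d.bdry s).1)
    (h0 : F 0 ∈ d.D) (hpos : d.WindsOnce) :
    Nonempty (ReducedTriv d.D) ∧
    (∀ g : ReducedTriv d.D,
      (∀ k : ℤ, HasNoncompactMonodromyNumber g d.loop k ↔ k = -1) ∧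
      (∀ m : ℝ, |g.height ⟨0, h0⟩| < m →
        Nonempty (EndSection g m) ∧ Nonempty (EndSection g (-m)) ∧
        ∀ (σp : EndSection g m) (σn : EndSection g (-m)),
          HasMonodromyNumber σp σn d.loop (-1))) ∧
    (∀ r : ℝ, (∀ s, (d.bdry s).1.1 ^ 2 + (d.bdry s).1.2 ^ 2 < r ^ 2) → 0 < r →
      {s ∈ Set.Ico (0 : ℝ) 1 | ∃ x : Phase, x.1 = 0 ∧ F x = (d.bdry s).1}.Finite →
      ∀ k : ℤ, IsLocalMonodromyNumber r (fun s => (d.bdry s).1) k ↔ k = -1) ∧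
    (∀ k : ℤ, IsScatteringMonodromyNumber (fun s => (d.bdry s).1) k ↔ k = -1) :=
  ⟨nonempty_reducedTriv d.isClosed_D,
    fun g => ⟨hasNoncompactMonodromyNumber_iff hpos g h0, fun _ hm =>
      ⟨nonempty_endSection_pos g h0 (abs_lt.1 hm).2, nonempty_endSection_neg g h0 (abs_lt.1 hm).1,
        hasMonodromyNumber hpos h0 hm⟩⟩,
    fun _ hr hr0 hfin => isLocalMonodromyNumber_iff hpos hr0 hr hfin,
    isScatteringMonodromyNumber_iff hpos⟩
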